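/- Let $d\in\{1,2,3\}$, let $\mathcal O\subset\mathbb R^d$ be a bounded open set (for instance a bounded Lipschitz domain), and let $\Delta$ be the Dirichlet Laplacian on $L^2(\mathcal O)$, with domain $D(\Delta)=\{\phi\in H^1_0(\mathcal O):\Delta\phi\in L^2(\mathcal O)\}$. Let $(\phi_j)_{j\ge1}$ be a complete orthonormal system of $L^2(\mathcal O)$ with $-\Delta\phi_j=\lambda_j\phi_j$ and $\lambda_1\le\lambda_2\le\cdots$, let $W_1,W_2,\dots$ be independent standard one-dimensional Wiener processes on a probability space $\Omega$, and let $W(\cdot,t)=\sum_{j}\phi_jW_j(t)$ be the corresponding cylindrical Wiener process. Let $0<\alpha<2/d$, $T>0$, $N\ge1$, $\tau=T/N$, $t_n=n\tau$, and set $\delta_\tau(\zeta)=(1-\zeta)/\tau$, $(1-\zeta)^{1-\alpha}=\sum_{j\ge0}b_j\zeta^j$ and $$\bar\partial_\tau^{1-\alpha}u_n=\tau^{\alpha-1}\sum_{j=0}^n b_{n-j}u_j .$$ Let $\bar\partial_\tau W(\cdot,s)=\tau^{-1}(W(\cdot,t_n)-W(\cdot,t_{n-1}))$ for $s\in(t_{n-1},t_n]$,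 $1\le n\le N$, and $\bar\partial_\tau W(\cdot,s)=0$ for $s=0$ and for $s>t_N$; define $\bar\partial_\tau W_j$ in the same way. Consider the backward-Euler convolution quadrature scheme with $u_0=0$ and $$\frac{u_n-u_{n-1}}{\tau}-\Delta\bar\partial_\tau^{1-\alpha}u_n=\frac{W(\cdot,t_n)-W(\cdot,t_{n-1})}{\tau},\qquad n=1,\dots,N,$$ for $u_n\in L^2(\Omega;L^2(\mathcal O))$, where the equation holds in the dual of $D(\Delta)$: it is tested with all $v\in D(\Delta)$, with $\langle v,\Delta y\rangle=\langle\Delta v,y\rangle$ and with $\langle v,W(\cdot,t)\rangle=\sum_j\langle v,\phi_j\rangle W_j(t)$, convergent in $L^2(\Omega)$. Let $\theta$ and $\kappa$ satisfy $\frac\pi2<\theta<\operatorname{arccot}(-\frac2\pi)$ (with $\operatorname{arccot}$ valued in $(0,\pi)$), $\alpha\theta<\pi$ and $0<\kappa\le 1/T$, and let $$\Gamma_{\theta,\kappa}^{(\tau)}=\bigl\{z\in\mathbb C:\ |\operatorname{Im}z|\le\tfrac{\pi}{\tau},\ \text{and } |z|=\kappa,\ |\arg z|\le\theta,\ \text{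 or } z=\rho e^{\pm\mathrm i\theta}\text{ with }\rho\ge\kappa\bigr\},$$ where the bound on $\operatorname{Im}z$ applies to both alternatives, oriented with increasing imaginary parts. For $t\in\mathbb R$ and $\phi\in L^2(\mathcal O)$ put $$E_\tau(t)\phi=\frac1{2\pi\mathrm i}\int_{\Gamma_{\theta,\kappa}^{(\tau)}}e^{zt}\,\frac{z\tau}{e^{z\tau}-1}\,\delta_\tau(e^{-z\tau})^{\alpha-1}\bigl(\delta_\tau(e^{-z\tau})^{\alpha}-\Delta\bigr)^{-1}\phi\,\mathrm dz ,$$ with principal powers. Then the scheme has a solution, the resolvents and the integral in the definition of $E_\tau(t)$ exist, and every solution satisfies, almost surely, for each $n=1,\dots,N$, $$u_n=\int_0^{t_n}E_\tau(t_n-s)\,\bar\partial_\tau W(\cdot,s)\,\mathrm ds=\sum_{j=1}^\infty\int_0^{t_n}E_\tau(t_n-s)\phi_j\,\bar\partial_\tau W_j(s)\,\mathrm ds .$$ (In particular, the solution is unique.) Here $E_\tau(t_n-s)\bar\partial_\tau W(\cdot,s)=\sum_j E_\tau(t_n-s)\phi_j\,\bar\partial_\tau W_j(s)$ converges in $L^2(\Omega;L^2(\mathcal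 O))$ for every $s\in[0,t_n]$, the first integral is a Bochner integral in $L^2(\Omega;L^2(\mathcal O))$, and the last series converges in $L^2(\Omega;L^2(\mathcal O))$. -/

import Mathlib

open MeasureTheory ProbabilityTheory Filter Topology
open scoped NNReal ENNReal Distributions

noncomputable section

namespace FracCQ

/-- The space `L²(O)`, complex-valued because the resolvents below are taken at complex points. -/
abbrev L2 {d : ℕ} (O : TopologicalSpace.Opens (EuclideanSpace ℝ (Fin d))) : Type :=
  Lp ℂ 2 ((volume : Measure (EuclideanSpace ℝ (Fin d))).restrict O)

/-! ### The Dirichlet Laplacian -/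

/-- `f ∈ H¹₀(O)`: `f` is the limit in the `H¹(O)`-norm of smooth functions with compact support in
`O`, i.e. there are test functions `ψ n` such that `ψ n → f` in `L²(O)` and the partial derivatives
`∂ᵢ ψ n` converge in `L²(O)` (to functions `g i`, which are then the weak derivatives of `f`). -/
def MemH10 {d : ℕ} (O : TopologicalSpace.Opens (EuclideanSpace ℝ (Fin d))) (f : L2 O) : Prop :=
  ∃ (g : Fin d → L2 O) (ψ : ℕ → 𝓓(O, ℂ)),
    Tendsto (fun n => eLpNorm (fun x => ψ n x - f x) 2 (volume.restrict O)) atTop (𝓝 0) ∧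
    ∀ i, Tendsto (fun n => eLpNorm
      (fun x => fderiv ℝ (ψ n) x (EuclideanSpace.single i 1) - g i x) 2 (volume.restrict O))
      atTop (𝓝 0)

/-- `Δ f = h` in the sense of distributions on `O`, for `f, h ∈ L²(O)`. -/
def HasWeakLaplacian {d : ℕ} (O : TopologicalSpace.Opens (EuclideanSpace ℝ (Fin d)))
    (f h : L2 O) : Prop :=
  ∀ ψ : 𝓓(O, ℂ),
    ∫ x in (O : Set (EuclideanSpace ℝ (Fin d))), f x * Laplacian.laplacian (ψ : _ → ℂ) x =
      ∫ x in (O : Set (EuclideanSpace ℝ (Fin d))), h x * ψ x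

/-- The graph of the Dirichlet Laplacian with domain `D(Δ) = {f ∈ H¹₀(O) : Δ f ∈ L²(O)}`:
`f ∈ D(Δ)` and `Δ f = h`. -/
def IsDirichletLaplacian {d : ℕ} (O : TopologicalSpace.Opens (EuclideanSpace ℝ (Fin d)))
    (f h : L2 O) : Prop :=
  MemH10 O f ∧ HasWeakLaplacian O f h

/-- `R = (μ - Δ)⁻¹`: `v = R f` if and only if `v ∈ D(Δ)` and `μ v - Δ v = f`. -/
def IsDirichletResolvent {d : ℕ} (O : TopologicalSpace.Opens (EuclideanSpace ℝ (Fin d)))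
    (μ : ℂ) (R : L2 O →L[ℂ] L2 O) : Prop :=
  ∀ f v : L2 O, R f = v ↔ ∃ h, IsDirichletLaplacian O v h ∧ μ • v - h = f

theorem IsDirichletResolvent.unique {d : ℕ} {O : TopologicalSpace.Opens (EuclideanSpace ℝ (Fin d))}
    {μ : ℂ} {R S : L2 O →L[ℂ] L2 O} (hR : IsDirichletResolvent O μ R)
    (hS : IsDirichletResolvent O μ S) : R = S := by
  ext1 f
  exact (hR f (S f)).2 ((hS f (S f)).1 rfl)

open Classical in
/-- The resolvent `(μ - Δ)⁻¹` as a bounded operator on `L²(O)`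
(the zero operator if `μ` is not in the resolvent set of `Δ`). -/
def dirichletResolvent {d : ℕ} (O : TopologicalSpace.Opens (EuclideanSpace ℝ (Fin d)))
    (μ : ℂ) : L2 O →L[ℂ] L2 O :=
  if h : ∃ R, IsDirichletResolvent O μ R then h.choose else 0

/-- `φ 0, φ 1, …` is a complete orthonormal system of `L²(O)` made of eigenfunctions of `-Δ`, with
the eigenvalues `lam 0 ≤ lam 1 ≤ …` (the index is shifted by one from the usual `j = 1, 2, …`). -/
structure IsDirichletEigenbasis {d : ℕ} (O : TopologicalSpace.Opens (EuclideanSpace ℝ (Fin d)))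
    (φ : HilbertBasis ℕ ℂ (L2 O)) (lam : ℕ → ℝ) : Prop where
  eigen : ∀ j, IsDirichletLaplacian O (φ j) (-((lam j : ℂ) • φ j))
  mono : Monotone lam

/-! ### Noise -/

/-- `S = ∑_{j ≥ 0} f j`, as the limit in `L²(Ω; F)` of the partial sums. -/
def HasSumL2 {Ω F : Type*} [MeasurableSpace Ω] [NormedAddCommGroup F] (P : Measure Ω)
    (f : ℕ → Ω → F) (S : Ω → F) : Prop :=
  Tendsto (fun m : ℕ => eLpNorm (fun ω => (∑ j ∈ Finset.range m, f j ω) - S ω) 2 P) atTop (𝓝 0)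

/-- The difference quotient `(w(t_n) - w(t_{n-1})) / τ` on the grid `t_n = n τ`. -/
def diffQuot (τ : ℝ) (w : ℝ≥0 → ℝ) (n : ℕ) : ℝ :=
  (w (Real.toNNReal (n * τ)) - w (Real.toNNReal ((n - 1) * τ))) / τ

/-- The function equal to `(w(t_n) - w(t_{n-1})) / τ` on `(t_{n-1}, t_n]`, `n = 1, …, N`,
and to `0` elsewhere. -/
def pwDiffQuot (τ : ℝ) (N : ℕ) (w : ℝ≥0 → ℝ) (s : ℝ) : ℝ :=
  ∑ n ∈ Finset.Icc 1 N,
    (Set.Ioc (((n : ℝ) - 1) * τ) ((n : ℝ) * τ)).indicator (fun _ => diffQuot τ w n) s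

/-! ### The backward-Euler convolution quadrature -/

/-- The coefficients `b_j` of the power series `(1 - ζ)^β = ∑ b_j ζ^j`. -/
def cqCoeff (β : ℝ) (j : ℕ) : ℂ :=
  ((j.factorial : ℂ))⁻¹ * iteratedDeriv j (fun ζ : ℂ => (1 - ζ) ^ (β : ℂ)) 0

theorem hasSum_cqCoeff (β : ℝ) {ζ : ℂ} (hζ : ‖ζ‖ < 1) :
    HasSum (fun j => cqCoeff β j * ζ ^ j) ((1 - ζ) ^ (β : ℂ)) := by
  have hd : DifferentiableOn ℂ (fun ζ : ℂ => (1 - ζ) ^ (β : ℂ)) (Metric.ball 0 1) := by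
    intro z hz
    refine (DifferentiableAt.cpow (by fun_prop) (by fun_prop) (Or.inl ?_)).differentiableWithinAt
    have h1 := (Complex.abs_re_le_norm z).trans_lt (by simpa using hz)
    have := (abs_lt.1 h1).2
    simp only [Complex.sub_re, Complex.one_re]
    linarith
  have := Complex.hasSum_taylorSeries_on_ball hd (z := ζ) (by simpa using hζ)
  refine this.congr_fun ?_
  intro j
  simp only [cqCoeff, sub_zero, smul_eq_mul]
  ring

/-- The quadrature `τ^{-β} ∑_{j=0}^n b_{n-j} u_j` for the fractional derivative of order `β`. -/
def cqDeriv {V : Type*} [AddCommGroup V] [Module ℂ V] (β τ : ℝ) (u : ℕ → V) (n : ℕ) : V :=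
  (((τ ^ β : ℝ) : ℂ))⁻¹ • ∑ j ∈ Finset.range (n + 1), cqCoeff β (n - j) • u j

/-- `u_0, …, u_N ∈ L²(Ω; L²(O))` solves, with `u_0 = 0`, the time-stepping scheme
`(u_n - u_{n-1})/τ - Δ ∂̄_τ^{1-α} u_n = (W(t_n) - W(t_{n-1}))/τ`, `n = 1, …, N`,
driven by the cylindrical Wiener process `W(t) = ∑_j φ_j W_j(t)`. Since `W(t)` does not take values
in `L²(O)`, the scheme is an identity in the dual space of `D(Δ)`: for every `v ∈ D(Δ)`, both sides
are paired with `v`, with `⟨v, Δ y⟩ = ⟨Δ v, y⟩` and `⟨v, W(t)⟩ = ∑_j ⟨v, φ_j⟩ W_j(t)`. -/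
structure IsCQSolution {Ω : Type*} [MeasurableSpace Ω] (P : Measure Ω) {d : ℕ}
    (O : TopologicalSpace.Opens (EuclideanSpace ℝ (Fin d))) (φ : HilbertBasis ℕ ℂ (L2 O))
    (W : ℕ → ℝ≥0 → Ω → ℝ) (α τ : ℝ) (N : ℕ) (u : ℕ → Ω → L2 O) : Prop where
  memLp : ∀ n ≤ N, MemLp (u n) 2 P
  init : u 0 =ᵐ[P] 0
  step : ∀ n, 1 ≤ n → n ≤ N → ∀ v h : L2 O, IsDirichletLaplacian O v h →
    HasSumL2 P
      (fun j ω => inner ℂ v (φ j) * ((diffQuot τ (fun t => W j t ω) n : ℝ) : ℂ))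
      (fun ω => inner ℂ v ((τ : ℂ)⁻¹ • (u n ω - u (n - 1) ω)) -
        inner ℂ h (cqDeriv (1 - α) τ (fun k => u k ω) n))

/-! ### The contour and the discrete kernel -/

/-- The arccotangent with values in `(0, π)`. -/
def arccot (x : ℝ) : ℝ := Real.pi / 2 - Real.arctan x

/-- The part `|Im z| ≤ π/τ` of the contour formed by the arc `|z| = κ, |arg z| ≤ θ` and the rays
`z = r e^{±iθ}, r ≥ κ`. -/
def truncContour (θ κ τ : ℝ) : Set ℂ :=
  {z | ((‖z‖ = κ ∧ |z.arg| ≤ θ) ∨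
      ∃ r : ℝ, κ ≤ r ∧ (z = r * Complex.exp (θ * Complex.I) ∨
        z = r * Complex.exp (-(θ * Complex.I)))) ∧
    |z.im| ≤ Real.pi / τ}

/-- The integral of `F` over `truncContour θ κ τ` (for `0 < κ ≤ π/τ`, `0 < θ < π`), oriented with
increasing imaginary parts. On the rays, `|Im z| ≤ π/τ` means `r ≤ π / (τ sin θ)`. -/
def contourIntegral {V : Type*} [NormedAddCommGroup V] [NormedSpace ℂ V] (θ κ τ : ℝ)
    (F : ℂ → V) : V :=
  -(∫ r in κ..(Real.pi / (τ * Real.sin θ)),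
      Complex.exp (-(θ * Complex.I)) • F (r * Complex.exp (-(θ * Complex.I))))
  + (∫ x in (-θ)..θ,
      (κ * Complex.I * Complex.exp (x * Complex.I)) • F (κ * Complex.exp (x * Complex.I)))
  + ∫ r in κ..(Real.pi / (τ * Real.sin θ)),
      Complex.exp (θ * Complex.I) • F (r * Complex.exp (θ * Complex.I))

/-- Integrability of `F` along the three pieces of the truncated contour. -/
def ContourIntegrable {V : Type*} [NormedAddCommGroup V] [NormedSpace ℂ V] (θ κ τ : ℝ)
    (F : ℂ → V) : Prop :=
  IntervalIntegrable (fun r : ℝ => F (r * Complex.exp (-(θ * Complex.I)))) volume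
    κ (Real.pi / (τ * Real.sin θ)) ∧
  IntervalIntegrable (fun x : ℝ => F (κ * Complex.exp (x * Complex.I))) volume (-θ) θ ∧
  IntervalIntegrable (fun r : ℝ => F (r * Complex.exp (θ * Complex.I))) volume
    κ (Real.pi / (τ * Real.sin θ))

/-- `δ_τ(ζ) = (1 - ζ)/τ`. -/
def deltaTau (τ : ℝ) (ζ : ℂ) : ℂ := (1 - ζ) / τ

/-- `e^{zt} (zτ/(e^{zτ}-1)) δ_τ(e^{-zτ})^{α-1} (δ_τ(e^{-zτ})^α - Δ)⁻¹ f` (principal powers). -/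
def kernelIntegrand {d : ℕ} (O : TopologicalSpace.Opens (EuclideanSpace ℝ (Fin d)))
    (α τ t : ℝ) (f : L2 O) (z : ℂ) : L2 O :=
  (Complex.exp (z * t) * (z * τ / (Complex.exp (z * τ) - 1)) *
      deltaTau τ (Complex.exp (-(z * τ))) ^ ((α : ℂ) - 1)) •
    dirichletResolvent O (deltaTau τ (Complex.exp (-(z * τ))) ^ (α : ℂ)) f

/-- The discrete kernel `E_τ(t) f`. -/
def Etau {d : ℕ} (O : TopologicalSpace.Opens (EuclideanSpace ℝ (Fin d)))
    (α θ κ τ t : ℝ) (f : L2 O) : L2 O :=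
  (2 * Real.pi * Complex.I)⁻¹ • contourIntegral θ κ τ (kernelIntegrand O α τ t f)

end FracCQ

end

/-!
Expand everything in the eigenbasis. By Green's formula the Dirichlet Laplacian is symmetric, and by
the same formula it is closed, so it is the diagonal operator with entries `-λ_j` on its maximal
domain (`IsDirichletEigenbasis.isDirichletLaplacian_iff`). Hence its resolvents are diagonal, and the
scheme, tested with eigenfunctions, is equivalent to the scalar schemes with `-Δ` replaced by `λ_j`
(`isCQSolution_iff`).

A scalar scheme is a convolution equation whose weights are the Taylor coefficients of
`δ + λ δ^{1-α}`, where `δ = δ_τ(ζ)`. It is solved by convolution with the Taylor coefficients `g_m` of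
the inverse series `δ^{α-1} (δ^α + λ)⁻¹` (`sum_schemeCoeff_mul_taylorCoeff`, `eq_conv_of_conv_eq`).
On the other side, integrating `e^{z(t_n-s)}` over `(t_{k-1}, t_k]` cancels the factor
`zτ / (e^{zτ} - 1)`, and what is left of the contour integral defining `E_τ` is the Cauchy integral of
`g_{n-k}` in the variable `ζ = e^{-zτ}` (`ContourAdmissible.contourIntegral_eq_taylorCoeff`). The
contour stays inside the domain of holomorphy because `w ↦ 1 - e^{-w}` preserves the sector
`|arg w| ≤ θ` for `|Im w| ≤ π` and `π/2 < θ < 3π/4` (`abs_arg_one_sub_exp_neg_le`), and `αθ < π`. No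
contour is deformed: Taylor's polynomial is integrated explicitly, and the remainder has a primitive,
the sector being the image of a strip under the exponential.

Passing from the scalar identities to `L²(Ω; L²(O))` requires the eigenvalues of `E_τ(t)` to be square
summable, that is, `∑ (1 + λ_j)⁻² < ∞`, and this is where `d ≤ 3` enters
(`IsDirichletEigenbasis.summable_inv_sq`). No regularity of the domain is available, so the sum is
bounded directly: by Jensen's inequality `(1 + λ_j)⁻²` is at most the integral of `(1 + |ξ|²)⁻²`
against the spectral density of `φ_j`, and the spectral densities add up to a bounded function by
Bessel's inequality for plane waves. The eigenvalues of `E_τ(t)` then form the coordinates of a vector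
`e(t)` depending continuously on `t` (`ContourAdmissible.exists_kernelVector`). Each time step provides
a bounded operator `J_k` from `L²(O)` to `L²(Ω; L²(O))` that multiplies the `j`-th coordinate by the
`j`-th increment (`exists_noiseMap`); the orthogonality of the `φ_j` makes it bounded. The Bochner
integrand is `J_k e(t_n - s)` on `(t_{k-1}, t_k]`, and all identities and expansions follow by comparing
coordinates, a square integrable random vector being the `L²`-sum of its pointwise expansion
(`hasSumL2_expansion`).
-/

noncomputable section

namespace FracCQ

/-! ### The quadratic form and the spectral representation of the Dirichlet Laplacian -/

section DirichletForm

variable {d : ℕ} {O : TopologicalSpace.Opens (EuclideanSpace ℝ (Fin d))}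

/-- The bilinear pairings of the weak formulation as inner products: the conjugate lies on `k`. -/
theorem inner_toLp_left {k : EuclideanSpace ℝ (Fin d) → ℂ}
    (hk : MemLp k 2 (volume.restrict (O : Set (EuclideanSpace ℝ (Fin d))))) (f : L2 O) :
    inner ℂ hk.toLp f =
      ∫ x in (O : Set (EuclideanSpace ℝ (Fin d))), f x * (starRingEnd ℂ) (k x) := by
  rw [MeasureTheory.L2.inner_def]
  refine integral_congr_ae ?_
  filter_upwards [hk.coeFn_toLp] with x hx
  simp [hx, RCLike.inner_apply]

theorem testFunction_memLp (ψ : 𝓓(O, ℂ)) :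
    MemLp ψ 2 (volume.restrict (O : Set (EuclideanSpace ℝ (Fin d)))) :=
  ψ.continuous.memLp_of_hasCompactSupport ψ.hasCompactSupport

theorem testFunction_continuous_fderiv (ψ : 𝓓(O, ℂ)) (i : Fin d) :
    Continuous fun x => fderiv ℝ ψ x (EuclideanSpace.single i 1) :=
  (ψ.contDiff.continuous_fderiv (by simp)).clm_apply continuous_const

theorem testFunction_memLp_fderiv (ψ : 𝓓(O, ℂ)) (i : Fin d) :
    MemLp (fun x => fderiv ℝ ψ x (EuclideanSpace.single i 1)) 2
      (volume.restrict (O : Set (EuclideanSpace ℝ (Fin d)))) :=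
  (testFunction_continuous_fderiv ψ i).memLp_of_hasCompactSupport
    (ψ.hasCompactSupport.fderiv_apply ℝ _)

variable (O) in
/-- The map sending a test function to the pair of its class and the classes of its partial
derivatives in `L²(O)`. -/
def gradMap : 𝓓(O, ℂ) →ₗ[ℂ] L2 O × (Fin d → L2 O) where
  toFun ψ := ((testFunction_memLp ψ).toLp, fun i => (testFunction_memLp_fderiv ψ i).toLp)
  map_add' ψ χ := by
    refine Prod.ext ?_ (funext fun i => ?_)
    · exact MemLp.toLp_add (testFunction_memLp ψ) (testFunction_memLp χ)
    · refine Eq.trans ?_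
        (MemLp.toLp_add (testFunction_memLp_fderiv ψ i) (testFunction_memLp_fderiv χ i))
      refine MemLp.toLp_congr (testFunction_memLp_fderiv (ψ + χ) i) _
        (Eventually.of_forall fun x => ?_)
      have h1 := (ψ.contDiff.differentiable (by simp)).differentiableAt (x := x)
      have h2 := (χ.contDiff.differentiable (by simp)).differentiableAt (x := x)
      have : ((ψ + χ : 𝓓(O, ℂ)) : EuclideanSpace ℝ (Fin d) → ℂ) = ⇑ψ + ⇑χ := by ext; simp
      simp only [this, fderiv_add h1 h2]
      simp
  map_smul' c ψ := by
    refine Prod.ext ?_ (funext fun i => ?_)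
    · exact MemLp.toLp_const_smul c (testFunction_memLp ψ)
    · refine Eq.trans ?_ (MemLp.toLp_const_smul c (testFunction_memLp_fderiv ψ i))
      refine MemLp.toLp_congr (testFunction_memLp_fderiv (c • ψ) i) _
        (Eventually.of_forall fun x => ?_)
      have h1 := (ψ.contDiff.differentiable (by simp)).differentiableAt (x := x)
      have : ((c • ψ : 𝓓(O, ℂ)) : EuclideanSpace ℝ (Fin d) → ℂ) = c • ⇑ψ := by ext; simp
      simp only [this, fderiv_const_smul h1]
      simp

variable (O) in
/-- The graph of the gradient on `H¹₀(O)`, a closed subspace of `L²(O) × L²(O)ᵈ`. -/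
def gradGraph : Submodule ℂ (L2 O × (Fin d → L2 O)) := (LinearMap.range (gradMap O)).topologicalClosure

/-- `H¹₀(O)`, defined through sequences of test functions, is the projection to the first factor
of the closure of the range of `gradMap`; closedness arguments use this form. -/
theorem memH10_iff {f : L2 O} : MemH10 O f ↔ ∃ g, (f, g) ∈ gradGraph O := by
  have key : ∀ (g : Fin d → L2 O) (ψ : ℕ → 𝓓(O, ℂ)),
      (Tendsto (fun n => eLpNorm (fun x => ψ n x - f x) 2
        (volume.restrict (O : Set (EuclideanSpace ℝ (Fin d))))) atTop (𝓝 0) ∧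
      ∀ i, Tendsto (fun n => eLpNorm
        (fun x => fderiv ℝ (ψ n) x (EuclideanSpace.single i 1) - g i x) 2
          (volume.restrict (O : Set (EuclideanSpace ℝ (Fin d))))) atTop (𝓝 0)) ↔
      Tendsto (fun n => gradMap O (ψ n)) atTop (𝓝 (f, g)) := by
    intro g ψ
    rw [Prod.tendsto_iff, tendsto_pi_nhds]
    refine and_congr ?_ (forall_congr' fun i => ?_)
    · have := Lp.tendsto_Lp_iff_tendsto_eLpNorm'' (fi := atTop) (fun n => ⇑(ψ n))
        (fun n => testFunction_memLp (ψ n)) f (Lp.memLp f)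
      rw [Lp.toLp_coeFn] at this
      exact this.symm
    · have := Lp.tendsto_Lp_iff_tendsto_eLpNorm'' (fi := atTop) _
        (fun n => testFunction_memLp_fderiv (ψ n) i) (g i) (Lp.memLp (g i))
      rw [Lp.toLp_coeFn] at this
      exact this.symm
  constructor
  · rintro ⟨g, ψ, h⟩
    exact ⟨g, mem_closure_of_tendsto ((key g ψ).1 h) (Eventually.of_forall fun n => ⟨ψ n, rfl⟩)⟩
  · rintro ⟨g, hg⟩
    obtain ⟨x, hx, hxl⟩ := mem_closure_iff_seq_limit.1 hg
    choose ψ hψ using hx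
    refine ⟨g, ψ, (key g ψ).2 ?_⟩
    simpa only [hψ] using hxl

/-- Integration by parts for two test functions. -/
theorem integral_mul_laplacian_testFunction (φ ψ : 𝓓(O, ℂ)) :
    ∫ x in (O : Set (EuclideanSpace ℝ (Fin d))), φ x * Laplacian.laplacian (ψ : _ → ℂ) x =
      -∑ i, ∫ x in (O : Set (EuclideanSpace ℝ (Fin d))),
        fderiv ℝ φ x (EuclideanSpace.single i 1) * fderiv ℝ ψ x (EuclideanSpace.single i 1) := by
  have h0 : ∀ x ∉ (O : Set (EuclideanSpace ℝ (Fin d))), φ x = 0 := fun x hx =>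
    image_eq_zero_of_notMem_tsupport fun h => hx (φ.tsupport_subset h)
  have h0' : ∀ x ∉ (O : Set (EuclideanSpace ℝ (Fin d))), fderiv ℝ φ x = 0 := fun x hx =>
    image_eq_zero_of_notMem_tsupport fun h => hx (φ.tsupport_subset (tsupport_fderiv_subset ℝ h))
  rw [setIntegral_eq_integral_of_forall_compl_eq_zero fun x hx => by rw [h0 x hx, zero_mul]]
  simp_rw [fun i : Fin d => setIntegral_eq_integral_of_forall_compl_eq_zero
    (μ := (volume : Measure (EuclideanSpace ℝ (Fin d))))
    (s := (O : Set (EuclideanSpace ℝ (Fin d))))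
    (f := fun x => fderiv ℝ φ x (EuclideanSpace.single i 1) *
      fderiv ℝ ψ x (EuclideanSpace.single i 1)) fun x hx => by rw [h0' x hx]; simp]
  let φS := φ.hasCompactSupport.toSchwartzMap φ.contDiff
  let ψS := ψ.hasCompactSupport.toSchwartzMap ψ.contDiff
  have hL := SchwartzMap.laplacian_eq_sum (EuclideanSpace.basisFun (Fin d) ℝ) ψS
  have hpt : ∀ x, Laplacian.laplacian (ψ : _ → ℂ) x = ∑ i : Fin d,
      (LineDeriv.lineDerivOp (EuclideanSpace.single i (1 : ℝ))
        (LineDeriv.lineDerivOp (EuclideanSpace.single i (1 : ℝ)) ψS) : SchwartzMap _ ℂ) x := by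
    intro x
    have := SchwartzMap.laplacian_apply ψS x
    rw [hL] at this
    simp at this
    exact this.symm
  simp_rw [hpt, Finset.mul_sum]
  rw [integral_finsetSum, ← Finset.sum_neg_distrib]
  · refine Finset.sum_congr rfl fun i _ => ?_
    exact SchwartzMap.integral_mul_lineDerivOp_right_eq_neg_left φS
      (LineDeriv.lineDerivOp (EuclideanSpace.single i (1 : ℝ)) ψS : SchwartzMap _ ℂ)
      (EuclideanSpace.single i 1)
  · intro i _
    have h : Continuous fun x => φ x * (LineDeriv.lineDerivOp (EuclideanSpace.single i (1 : ℝ))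
        (LineDeriv.lineDerivOp (EuclideanSpace.single i (1 : ℝ)) ψS) : SchwartzMap _ ℂ) x :=
      φ.continuous.mul (SchwartzMap.continuous _)
    exact h.integrable_of_hasCompactSupport φ.hasCompactSupport.mul_right

/-- The complex conjugate of a test function. -/
def conjTest (ψ : 𝓓(O, ℂ)) : 𝓓(O, ℂ) :=
  TestFunction.postcompCLM (Complex.conjCLE : ℂ →L[ℝ] ℂ) ψ

theorem conjTest_apply (ψ : 𝓓(O, ℂ)) (x : EuclideanSpace ℝ (Fin d)) :
    conjTest ψ x = (starRingEnd ℂ) (ψ x) := by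
  simp [conjTest]

theorem fderiv_conjTest (ψ : 𝓓(O, ℂ)) (x v : EuclideanSpace ℝ (Fin d)) :
    fderiv ℝ (conjTest ψ) x v = (starRingEnd ℂ) (fderiv ℝ ψ x v) := by
  have h1 := (ψ.contDiff.differentiable (by simp)).differentiableAt (x := x)
  have : (conjTest ψ : EuclideanSpace ℝ (Fin d) → ℂ) = Complex.conjCLE ∘ ψ := by
    ext x; simp [conjTest_apply]
  rw [this, Complex.conjCLE.comp_fderiv]
  simp

theorem memLp_laplacian (ψ : 𝓓(O, ℂ)) : MemLp (fun x => Laplacian.laplacian (ψ : _ → ℂ) x) 2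
    (volume.restrict (O : Set (EuclideanSpace ℝ (Fin d)))) := by
  have hL : (fun x => Laplacian.laplacian (ψ : _ → ℂ) x) =
      ⇑(Laplacian.laplacian (ψ.hasCompactSupport.toSchwartzMap ψ.contDiff)) := by
    ext x
    rw [SchwartzMap.laplacian_apply]
    rfl
  rw [hL]
  exact ((SchwartzMap.memLp _ 2 volume)).restrict _

/-- Integration by parts for a function in `H¹₀(O)` and a test function. -/
theorem integral_mul_laplacian_of_mem_gradGraph {f : L2 O} {g : Fin d → L2 O}
    (hfg : (f, g) ∈ gradGraph O) (ψ : 𝓓(O, ℂ)) :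
    ∫ x in (O : Set (EuclideanSpace ℝ (Fin d))), f x * Laplacian.laplacian (ψ : _ → ℂ) x =
      -∑ i, inner ℂ (testFunction_memLp_fderiv (conjTest ψ) i).toLp (g i) := by
  have h1 : ∀ f : L2 O, ∫ x in (O : Set (EuclideanSpace ℝ (Fin d))),
      f x * Laplacian.laplacian (ψ : _ → ℂ) x = inner ℂ (memLp_laplacian ψ).star.toLp f := by
    intro f
    rw [inner_toLp_left]
    simp
  rw [h1]
  have hcl : IsClosed {p : L2 O × (Fin d → L2 O) | inner ℂ (memLp_laplacian ψ).star.toLp p.1 =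
      -∑ i, inner ℂ (testFunction_memLp_fderiv (conjTest ψ) i).toLp (p.2 i)} :=
    isClosed_eq (by fun_prop) (by fun_prop)
  refine closure_minimal ?_ hcl hfg
  rintro _ ⟨χ, rfl⟩
  have e1 : ∫ x in (O : Set (EuclideanSpace ℝ (Fin d))), ((testFunction_memLp χ).toLp : L2 O) x *
      Laplacian.laplacian (ψ : _ → ℂ) x = ∫ x in (O : Set (EuclideanSpace ℝ (Fin d))), χ x *
      Laplacian.laplacian (ψ : _ → ℂ) x := by
    refine integral_congr_ae ?_
    filter_upwards [(testFunction_memLp χ).coeFn_toLp] with x hx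
    rw [hx]
  change inner ℂ (memLp_laplacian ψ).star.toLp (testFunction_memLp χ).toLp =
    -∑ i, inner ℂ (testFunction_memLp_fderiv (conjTest ψ) i).toLp
      (testFunction_memLp_fderiv χ i).toLp
  rw [← h1, e1, integral_mul_laplacian_testFunction]
  congr 1
  refine Finset.sum_congr rfl fun i _ => ?_
  rw [inner_toLp_left]
  refine integral_congr_ae ?_
  filter_upwards [(testFunction_memLp_fderiv χ i).coeFn_toLp] with x hx
  rw [hx, fderiv_conjTest, Complex.conj_conj]

/-- **Green's formula** for the Dirichlet Laplacian. -/
theorem inner_weakLaplacian {f h w : L2 O} {g k : Fin d → L2 O}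
    (hfg : (f, g) ∈ gradGraph O) (hfh : HasWeakLaplacian O f h) (hwk : (w, k) ∈ gradGraph O) :
    inner ℂ w h = -∑ i, inner ℂ (k i) (g i) := by
  have hcl : IsClosed {p : L2 O × (Fin d → L2 O) |
      inner ℂ p.1 h = -∑ i, inner ℂ (p.2 i) (g i)} :=
    isClosed_eq (by fun_prop) (by fun_prop)
  refine closure_minimal ?_ hcl hwk
  rintro _ ⟨ψ, rfl⟩
  change inner ℂ (testFunction_memLp ψ).toLp h =
    -∑ i, inner ℂ (testFunction_memLp_fderiv ψ i).toLp (g i)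
  have h1 := integral_mul_laplacian_of_mem_gradGraph hfg (conjTest ψ)
  have h2 := hfh (conjTest ψ)
  rw [inner_toLp_left]
  simp_rw [conjTest_apply] at h2
  rw [← h2, h1]
  congr 1
  refine Finset.sum_congr rfl fun i _ => ?_
  congr 1
  refine MemLp.toLp_congr _ _ (Eventually.of_forall fun x => ?_)
  simp [fderiv_conjTest]

/-- The Dirichlet Laplacian is symmetric: both sides equal minus the Dirichlet form of `f` and `w`. -/
theorem IsDirichletLaplacian.inner_symm {f h w k : L2 O} (hf : IsDirichletLaplacian O f h)
    (hw : IsDirichletLaplacian O w k) : inner ℂ w h = inner ℂ k f := by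
  obtain ⟨g, hg⟩ := memH10_iff.1 hf.1
  obtain ⟨l, hl⟩ := memH10_iff.1 hw.1
  rw [inner_weakLaplacian hg hf.2 hl, ← inner_conj_symm k f, inner_weakLaplacian hl hw.2 hg]
  simp

/-- The weak Laplacian tested through inner products, which makes linearity and closedness in `f`
and `h` evident. -/
theorem hasWeakLaplacian_iff {f h : L2 O} : HasWeakLaplacian O f h ↔ ∀ ψ : 𝓓(O, ℂ),
    inner ℂ (memLp_laplacian ψ).star.toLp f = inner ℂ (testFunction_memLp ψ).star.toLp h := by
  refine forall_congr' fun ψ => ?_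
  rw [inner_toLp_left, inner_toLp_left]
  simp

variable (O) in
/-- The graph of the Dirichlet Laplacian as a subspace of `L²(O) × L²(O)`. -/
def laplacianGraph : Submodule ℂ (L2 O × L2 O) where
  carrier := {p | IsDirichletLaplacian O p.1 p.2}
  zero_mem' := ⟨memH10_iff.2 ⟨0, (gradGraph O).zero_mem⟩, hasWeakLaplacian_iff.2 fun ψ => by simp⟩
  add_mem' := by
    rintro p q ⟨hp1, hp2⟩ ⟨hq1, hq2⟩
    obtain ⟨g, hg⟩ := memH10_iff.1 hp1
    obtain ⟨l, hl⟩ := memH10_iff.1 hq1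
    rw [hasWeakLaplacian_iff] at hp2 hq2
    refine ⟨memH10_iff.2 ⟨g + l, (gradGraph O).add_mem hg hl⟩,
      hasWeakLaplacian_iff.2 fun ψ => ?_⟩
    simp only [Prod.fst_add, Prod.snd_add, inner_add_right, hp2 ψ, hq2 ψ]
  smul_mem' := by
    rintro c p ⟨hp1, hp2⟩
    obtain ⟨g, hg⟩ := memH10_iff.1 hp1
    rw [hasWeakLaplacian_iff] at hp2
    refine ⟨memH10_iff.2 ⟨c • g, (gradGraph O).smul_mem c hg⟩,
      hasWeakLaplacian_iff.2 fun ψ => ?_⟩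
    simp only [Prod.smul_fst, Prod.smul_snd, inner_smul_right, hp2 ψ]

/-- The Dirichlet Laplacian is closed: by Green's formula, convergence of `f n` and of `Δ (f n)`
forces convergence of the gradients. -/
theorem isDirichletLaplacian_of_tendsto {f h : ℕ → L2 O} {F K : L2 O}
    (hfh : ∀ n, IsDirichletLaplacian O (f n) (h n)) (hf : Tendsto f atTop (𝓝 F))
    (hh : Tendsto h atTop (𝓝 K)) : IsDirichletLaplacian O F K := by
  choose g hg using fun n => memH10_iff.1 (hfh n).1
  have hgreen : ∀ m n, ∑ i, ‖g m i - g n i‖ ^ 2 = -(inner ℂ (f m - f n) (h m - h n)).re := by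
    intro m n
    have h1 : HasWeakLaplacian O (f m - f n) (h m - h n) := hasWeakLaplacian_iff.2 fun ψ => by
      simp only [inner_sub_right, hasWeakLaplacian_iff.1 (hfh m).2 ψ,
        hasWeakLaplacian_iff.1 (hfh n).2 ψ]
    have h2 : (f m - f n, g m - g n) ∈ gradGraph O := (gradGraph O).sub_mem (hg m) (hg n)
    rw [inner_weakLaplacian h2 h1 h2]
    simp only [Complex.neg_re, neg_neg, Complex.re_sum]
    refine Finset.sum_congr rfl fun i _ => ?_
    have := inner_self_eq_norm_sq (𝕜 := ℂ) (g m i - g n i)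
    simpa using this.symm
  have hbound : ∀ m n i, ‖g m i - g n i‖ ^ 2 ≤ ‖f m - f n‖ * ‖h m - h n‖ := by
    intro m n i
    calc ‖g m i - g n i‖ ^ 2 ≤ ∑ i, ‖g m i - g n i‖ ^ 2 :=
          Finset.single_le_sum (f := fun i => ‖g m i - g n i‖ ^ 2) (fun _ _ => by positivity)
            (Finset.mem_univ i)
      _ = -(inner ℂ (f m - f n) (h m - h n)).re := hgreen m n
      _ ≤ ‖inner ℂ (f m - f n) (h m - h n)‖ := (neg_le_abs _).trans (Complex.abs_re_le_norm _)
      _ ≤ _ := norm_inner_le_norm _ _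
  have hcauchy : ∀ i, CauchySeq fun n => g n i := by
    intro i
    rw [Metric.cauchySeq_iff]
    intro ε hε
    obtain ⟨N1, hN1⟩ := Metric.cauchySeq_iff.1 hf.cauchySeq ε hε
    obtain ⟨N2, hN2⟩ := Metric.cauchySeq_iff.1 hh.cauchySeq ε hε
    refine ⟨max N1 N2, fun m hm n hn => ?_⟩
    have a1 := hN1 m (le_of_max_le_left hm) n (le_of_max_le_left hn)
    have a2 := hN2 m (le_of_max_le_right hm) n (le_of_max_le_right hn)
    rw [dist_eq_norm] at a1 a2 ⊢
    refine lt_of_pow_lt_pow_left₀ 2 hε.le ((hbound m n i).trans_lt ?_)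
    rw [sq]
    exact mul_lt_mul'' a1 a2 (norm_nonneg _) (norm_nonneg _)
  choose G hG using fun i => cauchySeq_tendsto_of_complete (hcauchy i)
  refine ⟨memH10_iff.2 ⟨G, ?_⟩, hasWeakLaplacian_iff.2 fun ψ => ?_⟩
  · exact IsClosed.mem_of_tendsto (Submodule.isClosed_topologicalClosure _)
      (hf.prodMk_nhds (tendsto_pi_nhds.2 hG)) (Eventually.of_forall hg)
  · have h1 := (tendsto_const_nhds (x := ((memLp_laplacian ψ).star.toLp : L2 O))).inner (𝕜 := ℂ) hf
    have h2 := (tendsto_const_nhds (x := ((testFunction_memLp ψ).star.toLp : L2 O))).inner (𝕜 := ℂ) hh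
    refine tendsto_nhds_unique h1 (h2.congr fun n => ?_)
    exact (hasWeakLaplacian_iff.1 (hfh n).2 ψ).symm

variable {φ : HilbertBasis ℕ ℂ (L2 O)} {lam : ℕ → ℝ}

/-- The Dirichlet energy of a normalized eigenfunction is its eigenvalue. -/
theorem IsDirichletEigenbasis.exists_grad (hφ : IsDirichletEigenbasis O φ lam) (j : ℕ) :
    ∃ g, (φ j, g) ∈ gradGraph O ∧ ∑ i, ‖g i‖ ^ 2 = lam j := by
  obtain ⟨g, hg⟩ := memH10_iff.1 (hφ.eigen j).1
  refine ⟨g, hg, ?_⟩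
  have h1 := inner_weakLaplacian hg (hφ.eigen j).2 hg
  have h2 : (inner ℂ (φ j) (φ j) : ℂ) = 1 := by
    rw [inner_self_eq_norm_sq_to_K, φ.orthonormal.1 j]; simp
  rw [inner_neg_right, inner_smul_right, h2, mul_one, neg_inj] at h1
  simp_rw [inner_self_eq_norm_sq_to_K] at h1
  apply Complex.ofReal_injective
  push_cast
  exact h1.symm

theorem IsDirichletEigenbasis.nonneg (hφ : IsDirichletEigenbasis O φ lam) (j : ℕ) : 0 ≤ lam j := by
  obtain ⟨g, -, hg⟩ := hφ.exists_grad j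
  rw [← hg]
  positivity

/-- The Dirichlet Laplacian is diagonal in the basis `φ`, with its maximal domain. -/
theorem IsDirichletEigenbasis.isDirichletLaplacian_iff (hφ : IsDirichletEigenbasis O φ lam)
    {v h : L2 O} : IsDirichletLaplacian O v h ↔
      ∀ j, inner ℂ (φ j) h = -(lam j : ℂ) * inner ℂ (φ j) v := by
  constructor
  · intro hv j
    rw [hv.inner_symm (hφ.eigen j), inner_neg_left, inner_smul_left]
    simp
  · intro hv
    have hs : ∀ f : L2 O, Tendsto (fun n => ∑ j ∈ Finset.range n, inner ℂ (φ j) f • φ j) atTop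
        (𝓝 f) := fun f => by
      simpa [φ.repr_apply_apply] using (φ.hasSum_repr f).tendsto_sum_nat
    refine isDirichletLaplacian_of_tendsto (fun n => ?_) (hs v) (hs h)
    have : ∑ j ∈ Finset.range n, inner ℂ (φ j) v • ((φ j, -((lam j : ℂ) • φ j)) : L2 O × L2 O) ∈
        laplacianGraph O :=
      Submodule.sum_mem _ fun j _ => Submodule.smul_mem _ _ (hφ.eigen j)
    have h2 : ∑ j ∈ Finset.range n, inner ℂ (φ j) v • ((φ j, -((lam j : ℂ) • φ j)) : L2 O × L2 O) =
        (∑ j ∈ Finset.range n, inner ℂ (φ j) v • φ j,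
          ∑ j ∈ Finset.range n, inner ℂ (φ j) h • φ j) := by
      rw [Prod.ext_iff, Prod.fst_sum, Prod.snd_sum]
      refine ⟨rfl, Finset.sum_congr rfl fun j _ => ?_⟩
      simp only [Prod.smul_snd, hv j, smul_neg, smul_smul, neg_mul, neg_smul, mul_comm]
    rw [h2] at this
    exact this

end DirichletForm

/-! ### Square summability of the inverse eigenvalues -/

section Weyl

open scoped FourierTransform

variable {d : ℕ} {O : TopologicalSpace.Opens (EuclideanSpace ℝ (Fin d))}

theorem norm_sq_toLp_testFunction {k : EuclideanSpace ℝ (Fin d) → ℂ}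
    (hk : MemLp k 2 (volume.restrict (O : Set (EuclideanSpace ℝ (Fin d)))))
    (h0 : ∀ x ∉ (O : Set (EuclideanSpace ℝ (Fin d))), k x = 0) :
    ‖(hk.toLp : L2 O)‖ ^ 2 = ∫ x, ‖k x‖ ^ 2 := by
  rw [← setIntegral_eq_integral_of_forall_compl_eq_zero
    (s := (O : Set (EuclideanSpace ℝ (Fin d)))) fun x hx => by rw [h0 x hx]; simp]
  rw [← inner_self_eq_norm_sq (𝕜 := ℂ), L2.inner_def, ← integral_re]
  · refine integral_congr_ae ?_
    filter_upwards [hk.coeFn_toLp] with x hx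
    rw [hx]
    exact inner_self_eq_norm_sq (𝕜 := ℂ) (k x)
  · exact L2.integrable_inner _ _

variable [IsFiniteMeasure (volume.restrict (O : Set (EuclideanSpace ℝ (Fin d))))]

theorem planeWave_memLp (ξ : EuclideanSpace ℝ (Fin d)) :
    MemLp (fun x => Complex.exp (↑(2 * Real.pi * inner ℝ x ξ) * Complex.I)) 2
      (volume.restrict (O : Set (EuclideanSpace ℝ (Fin d)))) := by
  refine MemLp.of_bound (Continuous.aestronglyMeasurable (by fun_prop)) 1
    (Eventually.of_forall fun x => ?_)
  rw [Complex.norm_exp_ofReal_mul_I]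

variable (O) in
/-- The restriction to `O` of the plane wave `x ↦ exp (2πi ⟨x, ξ⟩)`, as an element of `L²(O)`. -/
def planeWave (ξ : EuclideanSpace ℝ (Fin d)) : L2 O := (planeWave_memLp ξ).toLp

theorem exists_norm_planeWave_le :
    ∃ C : ℝ, 0 ≤ C ∧ ∀ ξ : EuclideanSpace ℝ (Fin d), ‖planeWave O ξ‖ ≤ C := by
  refine ⟨_, ?_, fun ξ => Lp.norm_le_of_ae_bound (C := 1) zero_le_one ?_⟩
  · positivity
  · filter_upwards [(planeWave_memLp (O := O) ξ).coeFn_toLp] with x hx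
    rw [planeWave, hx, Complex.norm_exp_ofReal_mul_I]

theorem inner_planeWave (ξ : EuclideanSpace ℝ (Fin d)) (f : L2 O) : inner ℂ (planeWave O ξ) f =
    ∫ x in (O : Set (EuclideanSpace ℝ (Fin d))), Complex.exp (↑(-2 * Real.pi * inner ℝ x ξ) * Complex.I) * f x := by
  rw [planeWave, inner_toLp_left]
  refine integral_congr_ae (Eventually.of_forall fun x => ?_)
  simp only [← Complex.exp_conj, map_mul, Complex.conj_ofReal, Complex.conj_I]
  rw [mul_comm, neg_mul, neg_mul, Complex.ofReal_neg, neg_mul, mul_neg]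

theorem continuous_inner_planeWave (f : L2 O) :
    Continuous fun ξ => inner ℂ (planeWave O ξ) f := by
  simp_rw [inner_planeWave]
  refine continuous_of_dominated (bound := fun x => ‖f x‖) (fun ξ => ?_) (fun ξ => ?_) ?_ ?_
  · exact AEStronglyMeasurable.mul (Continuous.aestronglyMeasurable (by fun_prop))
      (Lp.aestronglyMeasurable f)
  · refine Eventually.of_forall fun x => ?_
    rw [norm_mul, Complex.norm_exp_ofReal_mul_I, one_mul]
  · exact ((Lp.memLp f).integrable (by norm_num)).norm
  · exact Eventually.of_forall fun x => by fun_prop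

/-- On test functions, pairing with plane waves is the Fourier transform. -/
theorem inner_planeWave_testFunction (ξ : EuclideanSpace ℝ (Fin d)) (ψ : 𝓓(O, ℂ)) :
    inner ℂ (planeWave O ξ) (testFunction_memLp ψ).toLp =
      𝓕 (ψ.hasCompactSupport.toSchwartzMap ψ.contDiff) ξ := by
  rw [inner_planeWave, SchwartzMap.fourier_coe, Real.fourier_eq']
  have h0 : ∀ x ∉ (O : Set (EuclideanSpace ℝ (Fin d))), ψ x = 0 := fun x hx =>
    image_eq_zero_of_notMem_tsupport fun h => hx (ψ.tsupport_subset h)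
  trans ∫ x in (O : Set (EuclideanSpace ℝ (Fin d))), Complex.exp (↑(-2 * Real.pi * inner ℝ x ξ) * Complex.I) * ψ x
  · refine integral_congr_ae ?_
    filter_upwards [(testFunction_memLp ψ).coeFn_toLp] with x hx
    rw [hx]
  · rw [setIntegral_eq_integral_of_forall_compl_eq_zero fun x hx => by rw [h0 x hx, mul_zero]]
    rfl

/-- The tangent to `x ↦ x⁻²` at `s` lies below the graph. -/
theorem tangent_inv_sq_le {x s : ℝ} (hx : 0 < x) (hs : 0 < s) :
    3 * s⁻¹ ^ 2 - 2 * s⁻¹ ^ 3 * x ≤ x⁻¹ ^ 2 := by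
  have : x⁻¹ ^ 2 - (3 * s⁻¹ ^ 2 - 2 * s⁻¹ ^ 3 * x) =
      (x - s) ^ 2 * (2 * x + s) * (x⁻¹ ^ 2 * s⁻¹ ^ 3) := by
    field_simp
    ring
  have h2 : 0 ≤ (x - s) ^ 2 * (2 * x + s) * (x⁻¹ ^ 2 * s⁻¹ ^ 3) := by positivity
  linarith

theorem norm_fourier_lineDeriv_sq (f : SchwartzMap (EuclideanSpace ℝ (Fin d)) ℂ) (i : Fin d)
    (ξ : EuclideanSpace ℝ (Fin d)) :
    ‖𝓕 (LineDeriv.lineDerivOp (EuclideanSpace.single i (1 : ℝ)) f) ξ‖ ^ 2 =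
      (2 * Real.pi) ^ 2 * ξ i ^ 2 * ‖𝓕 f ξ‖ ^ 2 := by
  rw [SchwartzMap.fourier_lineDerivOp_eq]
  have h := ((innerSL ℝ).flip (EuclideanSpace.single i (1 : ℝ))).hasTemperateGrowth
  have h' : (inner ℝ · (EuclideanSpace.single i (1 : ℝ)) :
    EuclideanSpace ℝ (Fin d) → ℝ).HasTemperateGrowth := h
  rw [smul_apply, SchwartzMap.smulLeftCLM_apply_apply h']
  simp only [EuclideanSpace.inner_single_right, norm_smul, norm_mul, mul_pow]
  simp
  ring

/-- The tangent inequality at `s`, applied to `1 + ‖ξ‖²` and integrated against a density `A`; the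
`B i` are the densities of the partial derivatives. -/
theorem tangent_le_integral {A : EuclideanSpace ℝ (Fin d) → ℝ}
    {B : Fin d → EuclideanSpace ℝ (Fin d) → ℝ} (hA : Integrable A) (hAc : Continuous A)
    (hA0 : ∀ ξ, 0 ≤ A ξ) (hB : ∀ i, Integrable (B i))
    (hAB : ∀ i ξ, B i ξ = (2 * Real.pi) ^ 2 * ξ i ^ 2 * A ξ) {s : ℝ} (hs : 0 < s) :
    3 * s⁻¹ ^ 2 * (∫ ξ, A ξ) - 2 * s⁻¹ ^ 3 * ((∫ ξ, A ξ) + ∑ i, ∫ ξ, B i ξ) ≤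
      ∫ ξ, ((1 + ‖ξ‖ ^ 2)⁻¹ : ℝ) ^ 2 * A ξ := by
  have hB' : Integrable fun ξ => ∑ i, B i ξ := integrable_finsetSum _ fun i _ => hB i
  have hsum : Integrable fun ξ => A ξ + ∑ i, B i ξ := hA.add hB'
  rw [← integral_finsetSum _ fun i _ => hB i, ← integral_add hA hB', ← integral_const_mul,
    ← integral_const_mul, ← integral_sub (hA.const_mul _) (hsum.const_mul _)]
  refine integral_mono ((hA.const_mul _).sub (hsum.const_mul _)) ?_ fun ξ => ?_
  · refine hA.mono' ?_ (Eventually.of_forall fun ξ => ?_)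
    · refine Continuous.aestronglyMeasurable ?_
      have : ∀ ξ : EuclideanSpace ℝ (Fin d), (1 + ‖ξ‖ ^ 2) ≠ 0 := fun ξ => by positivity
      fun_prop (disch := assumption)
    · rw [Real.norm_of_nonneg (mul_nonneg (by positivity) (hA0 ξ))]
      refine mul_le_of_le_one_left (hA0 ξ) (pow_le_one₀ (by positivity) ?_)
      exact inv_le_one_of_one_le₀ (by nlinarith [sq_nonneg ‖ξ‖])
  · have h4 := hA0 ξ
    simp only [hAB]
    rw [← Finset.sum_mul, ← Finset.mul_sum, ← EuclideanSpace.real_norm_sq_eq]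
    have h5 := tangent_inv_sq_le (x := 1 + ‖ξ‖ ^ 2) (by positivity) hs
    have h6 : 1 ≤ (2 * Real.pi) ^ 2 := by nlinarith [Real.pi_gt_three]
    calc _ ≤ 3 * s⁻¹ ^ 2 * A ξ - 2 * s⁻¹ ^ 3 * (A ξ + ‖ξ‖ ^ 2 * A ξ) := by
          gcongr
          exact le_mul_of_one_le_left (by positivity) h6
      _ = (3 * s⁻¹ ^ 2 - 2 * s⁻¹ ^ 3 * (1 + ‖ξ‖ ^ 2)) * A ξ := by ring
      _ ≤ _ := by gcongr

/-- By Plancherel, the integrated tangent inequality in terms of a test function and its gradient.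
Both sides are continuous in the `H¹`-norm, so it extends to `H¹₀(O)`. -/
theorem tangent_le_integral_testFunction (ψ : 𝓓(O, ℂ)) {s : ℝ} (hs : 0 < s) :
    3 * s⁻¹ ^ 2 * ‖(gradMap O ψ).1‖ ^ 2 -
      2 * s⁻¹ ^ 3 * (‖(gradMap O ψ).1‖ ^ 2 + ∑ i, ‖(gradMap O ψ).2 i‖ ^ 2) ≤
    ∫ ξ, ((1 + ‖ξ‖ ^ 2)⁻¹ : ℝ) ^ 2 * ‖inner ℂ (planeWave O ξ) (gradMap O ψ).1‖ ^ 2 := by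
  let f := ψ.hasCompactSupport.toSchwartzMap ψ.contDiff
  have hint : ∀ g : SchwartzMap (EuclideanSpace ℝ (Fin d)) ℂ, Integrable fun ξ => ‖g ξ‖ ^ 2 :=
    fun g => (g.memLp 2 volume).integrable_norm_pow (by norm_num)
  have h1 : ‖(gradMap O ψ).1‖ ^ 2 = ∫ ξ, ‖𝓕 f ξ‖ ^ 2 := by
    rw [SchwartzMap.integral_norm_sq_fourier]
    exact norm_sq_toLp_testFunction (testFunction_memLp ψ) fun x hx =>
      image_eq_zero_of_notMem_tsupport fun h => hx (ψ.tsupport_subset h)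
  have h2 : ∀ i, ‖(gradMap O ψ).2 i‖ ^ 2 =
      ∫ ξ, ‖𝓕 (LineDeriv.lineDerivOp (EuclideanSpace.single i (1 : ℝ)) f) ξ‖ ^ 2 := by
    intro i
    rw [SchwartzMap.integral_norm_sq_fourier]
    refine norm_sq_toLp_testFunction (testFunction_memLp_fderiv ψ i) fun x hx => ?_
    have : fderiv ℝ ψ x = 0 := image_eq_zero_of_notMem_tsupport fun h =>
      hx (ψ.tsupport_subset (tsupport_fderiv_subset ℝ h))
    rw [this]; rfl
  have h3 : ∀ ξ, inner ℂ (planeWave O ξ) (gradMap O ψ).1 = 𝓕 f ξ :=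
    fun ξ => inner_planeWave_testFunction ξ ψ
  simp_rw [h3, h1, h2]
  exact tangent_le_integral (hint _) ((𝓕 f).continuous.norm.pow 2) (fun ξ => by positivity)
    (fun i => hint _) (fun i ξ => norm_fourier_lineDeriv_sq f i ξ) hs

theorem integrable_inv_one_add_norm_sq_sq (hd : d ≤ 3) :
    Integrable fun ξ : EuclideanSpace ℝ (Fin d) => ((1 + ‖ξ‖ ^ 2)⁻¹ : ℝ) ^ 2 := by
  have h := integrable_rpow_neg_one_add_norm_sq (E := EuclideanSpace ℝ (Fin d)) (μ := volume)
    (r := 4) (by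
      rw [finrank_euclideanSpace_fin]
      have : (d : ℝ) ≤ 3 := by exact_mod_cast hd
      linarith)
  refine h.congr (Eventually.of_forall fun ξ => ?_)
  change (1 + ‖ξ‖ ^ 2) ^ (-4 / 2 : ℝ) = _
  rw [show (-4 / 2 : ℝ) = -(2 : ℕ) by norm_num, Real.rpow_neg (by positivity), Real.rpow_natCast]
  exact (inv_pow _ _).symm

theorem integrable_weighted_inner_planeWave (hd : d ≤ 3) (f : L2 O) :
    Integrable fun ξ => ((1 + ‖ξ‖ ^ 2)⁻¹ : ℝ) ^ 2 * ‖inner ℂ (planeWave O ξ) f‖ ^ 2 := by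
  obtain ⟨C, hC0, hC⟩ := exists_norm_planeWave_le (O := O)
  refine (integrable_inv_one_add_norm_sq_sq hd).mul_bdd (c := (C * ‖f‖) ^ 2) ?_ ?_
  · exact ((continuous_inner_planeWave f).norm.pow 2).aestronglyMeasurable
  · refine Eventually.of_forall fun ξ => ?_
    rw [Real.norm_of_nonneg (by positivity)]
    gcongr
    exact (norm_inner_le_norm _ _).trans (by gcongr; exact hC ξ)

theorem continuous_integral_inner_planeWave (hd : d ≤ 3) : Continuous fun f : L2 O =>
    ∫ ξ, ((1 + ‖ξ‖ ^ 2)⁻¹ : ℝ) ^ 2 * ‖inner ℂ (planeWave O ξ) f‖ ^ 2 := by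
  obtain ⟨C, hC0, hC⟩ := exists_norm_planeWave_le (O := O)
  refine continuous_iff_continuousAt.2 fun f₀ => ?_
  refine tendsto_integral_filter_of_dominated_convergence
    (bound := fun ξ => ((1 + ‖ξ‖ ^ 2)⁻¹ : ℝ) ^ 2 * (C * (‖f₀‖ + 1)) ^ 2) ?_ ?_ ?_ ?_
  · exact Eventually.of_forall fun f => (integrable_weighted_inner_planeWave hd f).1
  · have : ∀ᶠ f : L2 O in 𝓝 f₀, ‖f‖ < ‖f₀‖ + 1 :=
      (continuous_norm.tendsto f₀).eventually_lt_const (by linarith)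
    filter_upwards [this] with f hf
    refine Eventually.of_forall fun ξ => ?_
    rw [Real.norm_of_nonneg (by positivity)]
    gcongr
    exact (norm_inner_le_norm _ _).trans (by gcongr; exact hC ξ)
  · exact (integrable_inv_one_add_norm_sq_sq hd).mul_const _
  · refine Eventually.of_forall fun ξ => ?_
    have : Continuous fun f : L2 O =>
        ((1 + ‖ξ‖ ^ 2)⁻¹ : ℝ) ^ 2 * ‖inner ℂ (planeWave O ξ) f‖ ^ 2 := by fun_prop
    exact this.tendsto f₀

variable {φ : HilbertBasis ℕ ℂ (L2 O)} {lam : ℕ → ℝ}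

/-- The tangent at `s = 1 + lam j` gives a Jensen inequality for the spectral density of `φ j`: the
average of `1 + ‖ξ‖²` is at most `1 + lam j`, so that of its inverse square is at least
`(1 + lam j)⁻²`. -/
theorem IsDirichletEigenbasis.inv_one_add_sq_le (hφ : IsDirichletEigenbasis O φ lam) (hd : d ≤ 3)
    (j : ℕ) : ((1 + lam j)⁻¹ : ℝ) ^ 2 ≤
      ∫ ξ, ((1 + ‖ξ‖ ^ 2)⁻¹ : ℝ) ^ 2 * ‖inner ℂ (planeWave O ξ) (φ j)‖ ^ 2 := by
  obtain ⟨g, hg, hgl⟩ := hφ.exists_grad j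
  have hs : 0 < 1 + lam j := by linarith [hφ.nonneg j]
  have hcl : IsClosed {p : L2 O × (Fin d → L2 O) |
      3 * (1 + lam j)⁻¹ ^ 2 * ‖p.1‖ ^ 2 -
        2 * (1 + lam j)⁻¹ ^ 3 * (‖p.1‖ ^ 2 + ∑ i, ‖p.2 i‖ ^ 2) ≤
      ∫ ξ, ((1 + ‖ξ‖ ^ 2)⁻¹ : ℝ) ^ 2 * ‖inner ℂ (planeWave O ξ) p.1‖ ^ 2} :=
    isClosed_le (by fun_prop) ((continuous_integral_inner_planeWave hd).comp continuous_fst)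
  have h := closure_minimal (by
    rintro _ ⟨ψ, rfl⟩
    exact tangent_le_integral_testFunction ψ hs) hcl hg
  refine le_trans (le_of_eq ?_) h
  simp only [φ.orthonormal.1 j, hgl]
  field_simp
  ring

/-- The Green operator of an open set of finite measure in dimension at most three is
Hilbert–Schmidt. Summing the lower bounds of `inv_one_add_sq_le`, Bessel's inequality for the plane
wave bounds the integrand by a multiple of `(1 + ‖ξ‖²)⁻²`, which is integrable as `d < 4`. -/
theorem IsDirichletEigenbasis.summable_inv_sq (hφ : IsDirichletEigenbasis O φ lam) (hd : d ≤ 3) :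
    Summable fun j => ((1 + lam j)⁻¹ : ℝ) ^ 2 := by
  obtain ⟨C, hC0, hC⟩ := exists_norm_planeWave_le (O := O)
  refine summable_of_sum_le (c := ∫ ξ : EuclideanSpace ℝ (Fin d),
    ((1 + ‖ξ‖ ^ 2)⁻¹ : ℝ) ^ 2 * C ^ 2) (fun j => by positivity) fun s => ?_
  calc ∑ j ∈ s, ((1 + lam j)⁻¹ : ℝ) ^ 2
      ≤ ∑ j ∈ s, ∫ ξ, ((1 + ‖ξ‖ ^ 2)⁻¹ : ℝ) ^ 2 * ‖inner ℂ (planeWave O ξ) (φ j)‖ ^ 2 :=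
        Finset.sum_le_sum fun j _ => hφ.inv_one_add_sq_le hd j
    _ = ∫ ξ, ∑ j ∈ s, ((1 + ‖ξ‖ ^ 2)⁻¹ : ℝ) ^ 2 * ‖inner ℂ (planeWave O ξ) (φ j)‖ ^ 2 :=
        (integral_finsetSum _ fun j _ => integrable_weighted_inner_planeWave hd (φ j)).symm
    _ ≤ _ := by
        refine integral_mono (integrable_finsetSum _ fun j _ =>
          integrable_weighted_inner_planeWave hd (φ j))
          ((integrable_inv_one_add_norm_sq_sq hd).mul_const _) fun ξ => ?_
        simp only
        rw [← Finset.mul_sum]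
        gcongr
        calc ∑ j ∈ s, ‖inner ℂ (planeWave O ξ) (φ j)‖ ^ 2
            = ∑ j ∈ s, ‖inner ℂ (φ j) (planeWave O ξ)‖ ^ 2 := by simp_rw [norm_inner_symm]
          _ ≤ ‖planeWave O ξ‖ ^ 2 := φ.orthonormal.sum_inner_products_le _
          _ ≤ C ^ 2 := by gcongr; exact hC ξ

end Weyl

/-! ### Diagonal operators and resolvents -/

section Diagonal

variable {E : Type*} [NormedAddCommGroup E] [InnerProductSpace ℂ E]

theorem hilbertBasis_ext (φ : HilbertBasis ℕ ℂ E) {x y : E}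
    (h : ∀ j, inner ℂ (φ j) x = inner ℂ (φ j) y) : x = y := by
  apply φ.repr.injective
  ext j
  rw [φ.repr_apply_apply, φ.repr_apply_apply, h j]

theorem hilbertBasis_inner_basis (φ : HilbertBasis ℕ ℂ E) (i j : ℕ) :
    inner ℂ (φ i) (φ j) = if i = j then (1 : ℂ) else 0 :=
  orthonormal_iff_ite.1 φ.orthonormal i j

theorem hilbertBasis_hasSum_norm_sq (φ : HilbertBasis ℕ ℂ E) (x : E) :
    HasSum (fun j => ‖inner ℂ (φ j) x‖ ^ 2) (‖x‖ ^ 2) := by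
  have h := lp.hasSum_norm (p := 2) (by norm_num) (φ.repr x)
  simp only [ENNReal.toReal_ofNat, Real.rpow_ofNat] at h
  simp only [φ.repr_apply_apply, φ.repr.norm_map] at h
  exact h

/-- Coordinatewise domination gives domination of norms, by Parseval. -/
theorem norm_le_of_norm_inner_le (φ : HilbertBasis ℕ ℂ E) {x y : E} {C : ℝ} (hC : 0 ≤ C)
    (h : ∀ j, ‖inner ℂ (φ j) x‖ ≤ C * ‖inner ℂ (φ j) y‖) : ‖x‖ ≤ C * ‖y‖ := by
  refine le_of_sq_le_sq ?_ (by positivity)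
  rw [mul_pow]
  refine hasSum_le (fun j => ?_) (hilbertBasis_hasSum_norm_sq φ x)
    ((hilbertBasis_hasSum_norm_sq φ y).mul_left (C ^ 2))
  rw [← mul_pow]
  exact pow_le_pow_left₀ (norm_nonneg _) (h j) 2

theorem hilbertBasis_exists_of_summable (φ : HilbertBasis ℕ ℂ E) {c : ℕ → ℂ}
    (hc : Summable fun j => ‖c j‖ ^ 2) : ∃ x : E, ∀ j, inner ℂ (φ j) x = c j := by
  have hm : Memℓp c 2 := memℓp_gen (by simpa using hc)
  refine ⟨φ.repr.symm ⟨c, hm⟩, fun j => ?_⟩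
  rw [← φ.repr_apply_apply, LinearIsometryEquiv.apply_symm_apply]

/-- The bounded operator that is diagonal in a Hilbert basis with given bounded entries. -/
theorem exists_diagonal (φ : HilbertBasis ℕ ℂ E) {c : ℕ → ℂ} {C : ℝ} (hc : ∀ j, ‖c j‖ ≤ C) :
    ∃ D : E →L[ℂ] E, ∀ f j, inner ℂ (φ j) (D f) = c j * inner ℂ (φ j) f := by
  have hC : 0 ≤ C := (norm_nonneg _).trans (hc 0)
  have hs : ∀ f : E, Summable fun j => ‖c j * inner ℂ (φ j) f‖ ^ 2 := by
    intro f
    refine Summable.of_nonneg_of_le (fun j => by positivity) (fun j => ?_)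
      ((hilbertBasis_hasSum_norm_sq φ f).summable.mul_left (C ^ 2))
    rw [norm_mul, mul_pow]
    gcongr
    exact hc j
  choose D hD using fun f => hilbertBasis_exists_of_summable φ (hs f)
  refine ⟨LinearMap.mkContinuous ⟨⟨D, fun f g => ?_⟩, fun a f => ?_⟩ C fun f => ?_, hD⟩
  · exact hilbertBasis_ext φ fun j => by simp only [inner_add_right, hD, mul_add]
  · exact hilbertBasis_ext φ fun j => by
      simp only [inner_smul_right, hD, RingHom.id_apply]; ring
  · refine norm_le_of_norm_inner_le φ hC fun j => ?_
    change ‖inner ℂ (φ j) (D f)‖ ≤ _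
    rw [hD, norm_mul]
    gcongr
    exact hc j

end Diagonal

/-- A point off the closed negative half-axis stays away from all `-l` with `l ≥ 0`. -/
theorem exists_le_norm_add_of_mem_slitPlane {μ : ℂ} (hμ : μ ∈ Complex.slitPlane) :
    ∃ ε > 0, ∀ l : ℝ, 0 ≤ l → ε ≤ ‖μ + l‖ := by
  rcases hμ with h | h
  · refine ⟨μ.re, h, fun l hl => ?_⟩
    have := Complex.re_le_norm (μ + l)
    simp at this
    linarith
  · refine ⟨|μ.im|, abs_pos.2 h, fun l hl => ?_⟩
    have := Complex.abs_im_le_norm (μ + l)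
    simpa using this

theorem add_ofReal_ne_zero {l : ℝ} {μ : ℂ} (hμ : μ ∈ Complex.slitPlane) (hl : 0 ≤ l) : μ + l ≠ 0 := by
  obtain ⟨ε, hε, h⟩ := exists_le_norm_add_of_mem_slitPlane hμ
  exact norm_pos_iff.1 (hε.trans_le (h _ hl))

section Resolvent

variable {d : ℕ} {O : TopologicalSpace.Opens (EuclideanSpace ℝ (Fin d))}
  {φ : HilbertBasis ℕ ℂ (L2 O)} {lam : ℕ → ℝ}

theorem IsDirichletEigenbasis.isDirichletResolvent_of_inner
    (hφ : IsDirichletEigenbasis O φ lam) {μ : ℂ} (hμ : ∀ j, μ + lam j ≠ 0) {R : L2 O →L[ℂ] L2 O}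
    (hR : ∀ f j, inner ℂ (φ j) (R f) = (μ + lam j)⁻¹ * inner ℂ (φ j) f) :
    IsDirichletResolvent O μ R := by
  intro f v
  constructor
  · rintro rfl
    refine ⟨μ • R f - f, hφ.isDirichletLaplacian_iff.2 fun j => ?_, by abel⟩
    rw [inner_sub_right, inner_smul_right, hR]
    field_simp [hμ j]
    ring
  · rintro ⟨h, hh, rfl⟩
    refine hilbertBasis_ext φ fun j => ?_
    rw [hR, inner_sub_right, inner_smul_right, hφ.isDirichletLaplacian_iff.1 hh j]
    field_simp [hμ j]
    ring

theorem IsDirichletEigenbasis.add_ne_zero (hφ : IsDirichletEigenbasis O φ lam) {μ : ℂ}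
    (hμ : μ ∈ Complex.slitPlane) (j : ℕ) : μ + lam j ≠ 0 :=
  add_ofReal_ne_zero hμ (hφ.nonneg j)

theorem IsDirichletEigenbasis.isDirichletResolvent (hφ : IsDirichletEigenbasis O φ lam) {μ : ℂ}
    (hμ : μ ∈ Complex.slitPlane) : IsDirichletResolvent O μ (dirichletResolvent O μ) := by
  obtain ⟨ε, hε, h⟩ := exists_le_norm_add_of_mem_slitPlane hμ
  obtain ⟨D, hD⟩ := exists_diagonal φ (c := fun j => (μ + lam j)⁻¹) (C := ε⁻¹) fun j => by
    rw [norm_inv]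
    exact inv_anti₀ hε (h _ (hφ.nonneg j))
  have hex : ∃ R, IsDirichletResolvent O μ R :=
    ⟨D, hφ.isDirichletResolvent_of_inner (hφ.add_ne_zero hμ) hD⟩
  rw [dirichletResolvent, dif_pos hex]
  exact hex.choose_spec

theorem IsDirichletEigenbasis.inner_dirichletResolvent (hφ : IsDirichletEigenbasis O φ lam) {μ : ℂ}
    (hμ : μ ∈ Complex.slitPlane) (f : L2 O) (j : ℕ) :
    inner ℂ (φ j) (dirichletResolvent O μ f) = (μ + lam j)⁻¹ * inner ℂ (φ j) f := by
  obtain ⟨h, hh, e⟩ := (hφ.isDirichletResolvent hμ f _).1 rfl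
  have h0 := hφ.add_ne_zero hμ j
  conv_rhs => rw [← e]
  rw [inner_sub_right, inner_smul_right, hφ.isDirichletLaplacian_iff.1 hh j]
  field_simp
  ring

theorem IsDirichletEigenbasis.continuousOn_dirichletResolvent
    (hφ : IsDirichletEigenbasis O φ lam) (f : L2 O) :
    ContinuousOn (fun μ => dirichletResolvent O μ f) Complex.slitPlane := by
  intro μ₀ hμ₀
  refine ContinuousAt.continuousWithinAt ?_
  obtain ⟨ε, hε, h⟩ := exists_le_norm_add_of_mem_slitPlane hμ₀
  rw [ContinuousAt, tendsto_iff_norm_sub_tendsto_zero]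
  have hlim : Tendsto (fun μ : ℂ => ‖μ - μ₀‖ * ((ε / 2)⁻¹ * ε⁻¹) * ‖f‖) (𝓝 μ₀) (𝓝 0) := by
    have : Continuous fun μ : ℂ => ‖μ - μ₀‖ * ((ε / 2)⁻¹ * ε⁻¹) * ‖f‖ := by fun_prop
    simpa using this.tendsto μ₀
  refine squeeze_zero' (Eventually.of_forall fun _ => norm_nonneg _) ?_ hlim
  filter_upwards [Complex.isOpen_slitPlane.mem_nhds hμ₀,
    Metric.ball_mem_nhds μ₀ (half_pos hε)] with μ hμ hμ1
  refine norm_le_of_norm_inner_le φ (by positivity) fun j => ?_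
  have h1 := hφ.add_ne_zero hμ j
  have h2 := hφ.add_ne_zero hμ₀ j
  have h3 := h _ (hφ.nonneg j)
  have h4 : ε / 2 ≤ ‖μ + lam j‖ := by
    have h5 : ‖μ₀ + lam j‖ ≤ ‖μ + lam j‖ + ‖μ - μ₀‖ := by
      have := norm_sub_le (μ + lam j) (μ - μ₀)
      rwa [show μ + lam j - (μ - μ₀) = μ₀ + lam j by ring] at this
    rw [Metric.mem_ball, dist_eq_norm] at hμ1
    linarith
  rw [inner_sub_right, hφ.inner_dirichletResolvent hμ, hφ.inner_dirichletResolvent hμ₀,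
    show (μ + (lam j : ℂ))⁻¹ * inner ℂ (φ j) f - (μ₀ + (lam j : ℂ))⁻¹ * inner ℂ (φ j) f =
      -(μ - μ₀) * ((μ + lam j)⁻¹ * (μ₀ + lam j)⁻¹) * inner ℂ (φ j) f by field_simp; ring,
    norm_mul, norm_mul, norm_mul, norm_neg, norm_inv, norm_inv]
  gcongr

theorem IsDirichletEigenbasis.dirichletResolvent_basis (hφ : IsDirichletEigenbasis O φ lam) {μ : ℂ}
    (hμ : μ ∈ Complex.slitPlane) (j : ℕ) :
    dirichletResolvent O μ (φ j) = (μ + lam j)⁻¹ • φ j := by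
  refine hilbertBasis_ext φ fun i => ?_
  rw [hφ.inner_dirichletResolvent hμ, inner_smul_right, hilbertBasis_inner_basis]
  split_ifs with h
  · rw [h]
  · simp

end Resolvent

/-! ### The contour under the map `z ↦ 1 - e^{-zτ}` -/

section Sector

/-- On `(0, π/2)` `y - sin y ≤ 1 - cos y`, from `tan (y/2) > y/2`. -/
theorem sub_sin_le_one_sub_cos {y : ℝ} (h0 : 0 < y) (h1 : y < Real.pi / 2) :
    y - Real.sin y ≤ 1 - Real.cos y := by
  have ht := Real.lt_tan (x := y / 2) (by linarith) (by linarith)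
  have hc : 0 < Real.cos (y / 2) := Real.cos_pos_of_mem_Ioo ⟨by linarith, by linarith⟩
  have hs : 0 < Real.sin (y / 2) := Real.sin_pos_of_pos_of_lt_pi (by linarith) (by linarith)
  have hsc : Real.sin (y / 2) ≤ Real.cos (y / 2) := by
    rw [← Real.cos_pi_div_two_sub]
    exact Real.cos_le_cos_of_nonneg_of_le_pi (by linarith) (by linarith) (by linarith)
  rw [Real.tan_eq_sin_div_cos, lt_div_iff₀ hc] at ht
  have e1 : Real.sin y = 2 * Real.sin (y / 2) * Real.cos (y / 2) := by
    rw [← Real.sin_two_mul]; congr 1; ring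
  have e2 : Real.cos y = 1 - 2 * Real.sin (y / 2) ^ 2 := by
    have h2 := Real.cos_two_mul (y / 2)
    rw [show 2 * (y / 2) = y by ring] at h2
    linarith [Real.sin_sq_add_cos_sq (y / 2)]
  have e3 := Real.sin_sq_add_cos_sq (y / 2)
  rw [e1, e2]
  set s := Real.sin (y / 2)
  set c := Real.cos (y / 2)
  have key : (y - 2 * s * c) * c ≤ (1 - (1 - 2 * s ^ 2)) * c := by
    nlinarith [mul_nonneg (mul_nonneg hs.le hs.le) (sub_nonneg.2 hsc)]
  exact le_of_mul_le_mul_right key hc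

/-- In the upper half-plane `arg z ≤ θ` is linear in `z`: it says `Im (z e^{-iθ}) ≤ 0`. -/
theorem arg_le_iff_of_im_pos {z : ℂ} (hz : 0 < z.im) {θ : ℝ} (h0 : 0 < θ) (h1 : θ < Real.pi) :
    z.arg ≤ θ ↔ z.im * Real.cos θ ≤ z.re * Real.sin θ := by
  have hz0 : z ≠ 0 := fun h => by simp [h] at hz
  have hn : 0 < ‖z‖ := norm_pos_iff.2 hz0
  have ha0 : 0 ≤ z.arg := Complex.arg_nonneg_iff.2 hz.le
  have ha1 := Complex.arg_le_pi z
  have e : z.re * Real.sin θ - z.im * Real.cos θ = ‖z‖ * Real.sin (θ - z.arg) := by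
    rw [Real.sin_sub, ← Complex.norm_mul_cos_arg z, ← Complex.norm_mul_sin_arg z]
    ring
  rw [← sub_nonneg, ← sub_nonneg (b := z.im * Real.cos θ), e]
  constructor
  · intro h
    exact mul_nonneg hn.le (Real.sin_nonneg_of_nonneg_of_le_pi h (by linarith))
  · intro h
    by_contra hlt
    have := Real.sin_neg_of_neg_of_neg_pi_lt (x := θ - z.arg) (by linarith) (by linarith)
    nlinarith

theorem one_sub_exp_neg_ne_zero {w : ℂ} (hw : w ≠ 0) (hi : |w.im| ≤ Real.pi) :
    1 - Complex.exp (-w) ≠ 0 := by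
  intro h
  obtain ⟨n, hn⟩ := Complex.exp_eq_one_iff.1 (sub_eq_zero.1 h).symm
  have him : -w.im = n * (2 * Real.pi) := by
    have := congrArg Complex.im hn
    simpa using this
  have hn0 : n = 0 := by
    by_contra hne
    have h1 : (1 : ℝ) ≤ |(n : ℝ)| := by exact_mod_cast Int.one_le_abs hne
    rw [← abs_neg, him, abs_mul, abs_of_pos (by positivity : 0 < 2 * Real.pi)] at hi
    nlinarith [Real.pi_pos]
  rw [hn0] at hn
  simp at hn
  exact hw hn

/-- The part of `abs_arg_one_sub_exp_neg_le` with `w` in the second quadrant, where `Re w < 0`. -/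
theorem arg_one_sub_exp_neg_le {w : ℂ} (hi0 : 0 ≤ w.im) (hi : w.im ≤ Real.pi) (hre : w.re < 0)
    {θ : ℝ} (h0 : Real.pi / 2 < θ) (h1 : θ < 3 * Real.pi / 4) (ha : w.arg ≤ θ) :
    |(1 - Complex.exp (-w)).arg| ≤ θ := by
  have hpi := Real.pi_pos
  have him : 0 < w.im := by
    refine hi0.lt_of_ne fun h => ?_
    have : w.arg = Real.pi := Complex.arg_eq_pi_iff.2 ⟨hre, h.symm⟩
    linarith
  rw [arg_le_iff_of_im_pos him (by linarith) (by linarith)] at ha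
  have hre1 : (1 - Complex.exp (-w)).re = 1 - Real.exp (-w.re) * Real.cos w.im := by
    simp [Complex.exp_re]
  have him1 : (1 - Complex.exp (-w)).im = Real.exp (-w.re) * Real.sin w.im := by
    simp [Complex.exp_im]
  have hex : 0 < Real.exp (-w.re) := Real.exp_pos _
  have hsθ : 0 < Real.sin θ := Real.sin_pos_of_pos_of_lt_pi (by linarith) (by linarith)
  have hcθ : Real.cos θ < 0 := Real.cos_neg_of_pi_div_two_lt_of_lt h0 (by linarith)
  rcases hi.eq_or_lt with hi' | hi'
  · rw [hi', Real.sin_pi, mul_zero] at him1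
    rw [hi', Real.cos_pi] at hre1
    have : (1 - Complex.exp (-w)).arg = 0 :=
      Complex.arg_eq_zero_iff.2 ⟨by rw [hre1]; linarith, him1⟩
    rw [this, abs_zero]
    linarith
  · have hsy : 0 < Real.sin w.im := Real.sin_pos_of_pos_of_lt_pi him hi'
    have him2 : 0 < (1 - Complex.exp (-w)).im := by rw [him1]; positivity
    rw [abs_of_nonneg (Complex.arg_nonneg_iff.2 him2.le),
      arg_le_iff_of_im_pos him2 (by linarith) (by linarith), hre1, him1]
    -- With `arg_le_iff_of_im_pos`, the claim multiplied by `exp (Re w)`.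
    suffices h : Real.cos w.im * Real.sin θ + Real.sin w.im * Real.cos θ ≤
        Real.exp w.re * Real.sin θ by
      have e : Real.exp (-w.re) * Real.exp w.re = 1 := by rw [← Real.exp_add]; simp
      nlinarith [mul_le_mul_of_nonneg_left h hex.le]
    rcases le_or_gt (Real.pi / 2) w.im with hy | hy
    · have : Real.cos w.im ≤ 0 :=
        Real.cos_nonpos_of_pi_div_two_le_of_le hy (by linarith)
      have := Real.exp_pos w.re
      nlinarith [mul_pos this hsθ, mul_nonneg hsθ.le (neg_nonneg.2 ‹Real.cos w.im ≤ 0›),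
        mul_pos hsy (neg_pos.2 hcθ)]
    · have hk := sub_sin_le_one_sub_cos him hy
      have hsin := Real.sin_le him.le
      have hcs : -Real.cos θ ≤ Real.sin θ := by
        have h2 := Real.sin_nonneg_of_nonneg_of_le_pi (x := 3 * Real.pi / 4 - θ) (by linarith)
          (by linarith)
        have h3 : Real.sin (3 * Real.pi / 4 - θ) =
            Real.sin (Real.pi / 4) * (Real.cos θ + Real.sin θ) := by
          rw [Real.sin_sub, show 3 * Real.pi / 4 = Real.pi - Real.pi / 4 by ring, Real.sin_pi_sub,
            Real.cos_pi_sub, Real.cos_pi_div_four, Real.sin_pi_div_four]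
          ring
        rw [h3] at h2
        have h4 : 0 < Real.sin (Real.pi / 4) := by rw [Real.sin_pi_div_four]; positivity
        have := nonneg_of_mul_nonneg_right h2 h4
        linarith
      have hexp := Real.add_one_le_exp w.re
      nlinarith [mul_le_mul_of_nonneg_right hexp hsθ.le,
        mul_le_mul_of_nonneg_left hk hsθ.le,
        mul_le_mul_of_nonneg_right hcs (sub_nonneg.2 hsin)]

/-- The map `w ↦ 1 - e^{-w}` keeps the sector `|arg w| ≤ θ`, as long as `|Im w| ≤ π` and
`π/2 < θ < 3π/4`. -/
theorem abs_arg_one_sub_exp_neg_le {w : ℂ} (hi : |w.im| ≤ Real.pi)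
    {θ : ℝ} (h0 : Real.pi / 2 < θ) (h1 : θ < 3 * Real.pi / 4) (ha : |w.arg| ≤ θ) :
    |(1 - Complex.exp (-w)).arg| ≤ θ := by
  have hpi := Real.pi_pos
  rcases le_or_gt 0 w.re with hre | hre
  · refine le_trans (Complex.abs_arg_le_pi_div_two_iff.2 ?_) h0.le
    have hre1 : (1 - Complex.exp (-w)).re = 1 - Real.exp (-w.re) * Real.cos w.im := by
      simp [Complex.exp_re]
    rw [hre1]
    have h2 : Real.exp (-w.re) ≤ 1 := Real.exp_le_one_iff.2 (by linarith)
    nlinarith [Real.exp_pos (-w.re), Real.cos_le_one w.im]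
  · rcases le_or_gt 0 w.im with him | him
    · exact arg_one_sub_exp_neg_le him ((le_abs_self _).trans hi) hre h0 h1
        ((le_abs_self _).trans ha)
    · have hne : w.arg ≠ Real.pi := fun h => by
        rw [h, abs_of_pos hpi] at ha
        linarith
      have := arg_one_sub_exp_neg_le (w := (starRingEnd ℂ) w) (by simpa using him.le)
        (by rw [Complex.conj_im]; exact (neg_le_abs _).trans hi) (by simpa using hre) h0 h1
        (by rw [Complex.arg_conj, if_neg hne]; exact (neg_le_abs _).trans ha)
      have e : 1 - Complex.exp (-(starRingEnd ℂ) w) = (starRingEnd ℂ) (1 - Complex.exp (-w)) := by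
        rw [map_sub, ← Complex.exp_conj, map_neg, map_one]
      rw [e, Complex.arg_conj] at this
      split_ifs at this with h
      · rwa [h]
      · rwa [abs_neg] at this

/-- The upper bound on the angle of the contour enters only through `θ < 3π/4`. -/
theorem lt_of_lt_arccot {θ : ℝ} (h : θ < arccot (-2 / Real.pi)) : θ < 3 * Real.pi / 4 := by
  have h1 : Real.arctan (-1) < Real.arctan (-2 / Real.pi) := by
    apply Real.arctan_strictMono
    rw [neg_div, neg_lt_neg_iff, div_lt_one Real.pi_pos]
    linarith [Real.pi_gt_three]
  rw [Real.arctan_neg, Real.arctan_one] at h1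
  unfold arccot at h
  linarith

end Sector

/-! ### Taylor coefficients and primitives in a sector -/

section Taylor

/-- The Taylor coefficient of order `k` at the origin. -/
def taylorCoeff (f : ℂ → ℂ) (k : ℕ) : ℂ := ((k.factorial : ℂ))⁻¹ * iteratedDeriv k f 0

theorem taylorCoeff_congr {f g : ℂ → ℂ} (h : f =ᶠ[𝓝 0] g) (k : ℕ) :
    taylorCoeff f k = taylorCoeff g k := by
  rw [taylorCoeff, taylorCoeff, h.iteratedDeriv_eq k]

theorem taylorCoeff_mul {f g : ℂ → ℂ} (hf : AnalyticAt ℂ f 0) (hg : AnalyticAt ℂ g 0) (n : ℕ) :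
    taylorCoeff (f * g) n = ∑ i ∈ Finset.range (n + 1), taylorCoeff f (n - i) * taylorCoeff g i := by
  rw [← Finset.sum_range_reflect]
  simp only [taylorCoeff]
  rw [iteratedDeriv_mul hf.contDiffAt hg.contDiffAt, Finset.mul_sum]
  refine Finset.sum_congr rfl fun i hi => ?_
  have hi' : i ≤ n := Nat.lt_succ_iff.1 (Finset.mem_range.1 hi)
  have e1 : n + 1 - 1 - i = n - i := by omega
  have e2 : n - (n - i) = i := by omega
  rw [e1, e2, Nat.cast_choose ℂ hi']
  have h1 : (n.factorial : ℂ) ≠ 0 := by exact_mod_cast n.factorial_ne_zero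
  field_simp

theorem taylorCoeff_add {f g : ℂ → ℂ} (hf : AnalyticAt ℂ f 0) (hg : AnalyticAt ℂ g 0) (n : ℕ) :
    taylorCoeff (f + g) n = taylorCoeff f n + taylorCoeff g n := by
  rw [taylorCoeff, iteratedDeriv_add hf.contDiffAt hg.contDiffAt, mul_add]
  rfl

theorem taylorCoeff_const_mul (c : ℂ) (f : ℂ → ℂ) (n : ℕ) :
    taylorCoeff (fun ζ => c * f ζ) n = c * taylorCoeff f n := by
  rw [taylorCoeff, iteratedDeriv_const_mul_field, taylorCoeff]
  ring

theorem taylorCoeff_const (c : ℂ) (n : ℕ) :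
    taylorCoeff (fun _ => c) n = if n = 0 then c else 0 := by
  rw [taylorCoeff, iteratedDeriv_const]
  split_ifs with h <;> simp [h]

theorem taylorCoeff_id (n : ℕ) : taylorCoeff (fun ζ => ζ) n = if n = 1 then 1 else 0 := by
  rw [taylorCoeff, iteratedDeriv_fun_id_zero]
  split_ifs with h <;> simp [h]

/-- Division by `ζ` shifts the Taylor coefficients. -/
theorem taylorCoeff_dslope {f : ℂ → ℂ} (h1 : AnalyticAt ℂ (dslope f 0) 0)
    (n : ℕ) :
    taylorCoeff f (n + 1) = taylorCoeff (dslope f 0) n := by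
  have e : f = (fun _ => f 0) + (fun ζ => ζ) * dslope f 0 := by
    ext ζ
    have := sub_smul_dslope f 0 ζ
    simp only [sub_zero, smul_eq_mul] at this
    simp [this]
  have hid : AnalyticAt ℂ (fun ζ : ℂ => ζ) 0 := analyticAt_id
  conv_lhs => rw [e]
  rw [taylorCoeff_add analyticAt_const (hid.mul h1), taylorCoeff_mul hid h1, taylorCoeff_const,
    if_neg (Nat.succ_ne_zero n), zero_add, Finset.sum_eq_single n]
  · rw [taylorCoeff_id, if_pos (by omega), one_mul]
  · intro i hi hin
    have := Finset.mem_range.1 hi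
    rw [taylorCoeff_id]
    split_ifs with h
    · omega
    · rw [zero_mul]
  · intro h
    exact absurd (Finset.mem_range.2 (by omega)) h

/-- Taylor expansion with a holomorphic remainder. -/
theorem exists_taylor_remainder {U : Set ℂ} (hU : IsOpen U) (h0 : 0 ∈ U) (m : ℕ) :
    ∀ {f : ℂ → ℂ}, DifferentiableOn ℂ f U → ∃ R : ℂ → ℂ, DifferentiableOn ℂ R U ∧
      ∀ ζ, f ζ = ∑ k ∈ Finset.range m, taylorCoeff f k * ζ ^ k + ζ ^ m * R ζ := by
  induction m with
  | zero => exact fun {f} hf => ⟨f, hf, fun ζ => by simp⟩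
  | succ m ih =>
    intro f hf
    have hd : DifferentiableOn ℂ (dslope f 0) U :=
      (Complex.differentiableOn_dslope (hU.mem_nhds h0)).2 hf
    obtain ⟨R, hR, h⟩ := ih hd
    refine ⟨R, hR, fun ζ => ?_⟩
    have hc := taylorCoeff_dslope (hd.analyticAt (hU.mem_nhds h0))
    have h1 := sub_smul_dslope f 0 ζ
    simp only [sub_zero, smul_eq_mul] at h1
    rw [Finset.sum_range_succ']
    have e0 : taylorCoeff f 0 = f 0 := by simp [taylorCoeff]
    have e1 : ∑ k ∈ Finset.range m, taylorCoeff f (k + 1) * ζ ^ (k + 1) =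
        ζ * ∑ k ∈ Finset.range m, taylorCoeff (dslope f 0) k * ζ ^ k := by
      rw [Finset.mul_sum]
      exact Finset.sum_congr rfl fun k _ => by rw [hc]; ring
    rw [e0, e1]
    have h2 := h ζ
    calc f ζ = f 0 + ζ * dslope f 0 ζ := by rw [h1]; ring
      _ = _ := by rw [h2]; ring

end Taylor

section SectorPrimitive

/-- The points `ζ` for which `1 - ζ` lies in the open sector of half-angle `β` about the positive
real axis. -/
def sectorAtOne (β : ℝ) : Set ℂ := {ζ | 1 - ζ ∈ Complex.slitPlane ∧ |(1 - ζ).arg| < β}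

theorem isOpen_sectorAtOne (β : ℝ) : IsOpen (sectorAtOne β) := by
  have h : ContinuousOn (fun z : ℂ => |z.arg|) Complex.slitPlane := fun z hz =>
    (Complex.continuousAt_arg hz).abs.continuousWithinAt
  have h2 := h.isOpen_inter_preimage Complex.isOpen_slitPlane (isOpen_Iio (a := β))
  exact h2.preimage (f := fun ζ : ℂ => 1 - ζ) (by fun_prop)

theorem zero_mem_sectorAtOne {β : ℝ} (hβ : 0 < β) : 0 ∈ sectorAtOne β := by
  simp [sectorAtOne, hβ]

theorem arg_exp_of_abs_im_lt {ξ : ℂ} (h : |ξ.im| < Real.pi) : (Complex.exp ξ).arg = ξ.im := by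
  rw [← Complex.log_im, Complex.log_exp (abs_lt.1 h).1 (abs_lt.1 h).2.le]

theorem exp_mem_slitPlane {ξ : ℂ} (h : |ξ.im| < Real.pi) : Complex.exp ξ ∈ Complex.slitPlane := by
  rw [Complex.mem_slitPlane_iff_arg, arg_exp_of_abs_im_lt h]
  exact ⟨((abs_lt.1 h).2).ne, Complex.exp_ne_zero _⟩

theorem cpow_mem_slitPlane {x : ℂ} (hx : x ≠ 0) {α : ℝ} (h : |α * x.arg| < Real.pi) :
    x ^ (α : ℂ) ∈ Complex.slitPlane := by
  rw [Complex.cpow_def_of_ne_zero hx]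
  refine exp_mem_slitPlane ?_
  rwa [Complex.im_mul_ofReal, Complex.log_im, mul_comm]

/-- A holomorphic function on the sector has a primitive: the logarithm of `1 - ζ` maps the sector
to a strip, which is convex. -/
theorem exists_primitive_sectorAtOne {β : ℝ} (hβ : β ≤ Real.pi) {R : ℂ → ℂ}
    (hR : DifferentiableOn ℂ R (sectorAtOne β)) :
    ∃ Q : ℂ → ℂ, ∀ ζ ∈ sectorAtOne β, HasDerivAt Q (R ζ) ζ := by
  let S : Set ℂ := Complex.im ⁻¹' Set.Ioo (-β) β
  have hSo : IsOpen S := isOpen_Ioo.preimage Complex.continuous_im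
  have hSc : Convex ℝ S := (convex_Ioo (-β) β).linear_preimage Complex.imLm
  have hmaps : Set.MapsTo (fun ξ => 1 - Complex.exp ξ) S (sectorAtOne β) := by
    intro ξ hξ
    have h1 : |ξ.im| < β := abs_lt.2 (Set.mem_Ioo.1 hξ)
    have h2 := h1.trans_le hβ
    simp only [sectorAtOne, Set.mem_ofPred_eq, sub_sub_cancel]
    exact ⟨exp_mem_slitPlane h2, by rwa [arg_exp_of_abs_im_lt h2]⟩
  have hd : DifferentiableOn ℂ (fun ξ => R (1 - Complex.exp ξ) * -Complex.exp ξ) S :=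
    (hR.comp (f := fun ξ => 1 - Complex.exp ξ) (by fun_prop) hmaps).mul (by fun_prop)
  obtain ⟨q, hq⟩ := hSc.exists_forall_hasDerivWithinAt hd
  refine ⟨fun ζ => q (Complex.log (1 - ζ)), fun ζ hζ => ?_⟩
  have hmem : Complex.log (1 - ζ) ∈ S := by
    change (Complex.log (1 - ζ)).im ∈ Set.Ioo (-β) β
    rw [Complex.log_im]
    exact abs_lt.1 hζ.2
  have h1 := (hq _ hmem).hasDerivAt (hSo.mem_nhds hmem)
  have hne : (1 - ζ) ≠ 0 := Complex.slitPlane_ne_zero hζ.1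
  have h2 : HasDerivAt (fun ζ : ℂ => Complex.log (1 - ζ)) (-1 / (1 - ζ)) ζ :=
    ((hasDerivAt_id ζ).const_sub 1).clog hζ.1
  have h3 := h1.comp ζ h2
  simp only [Complex.exp_log hne, sub_sub_cancel] at h3
  have e : R ζ * -(1 - ζ) * (-1 / (1 - ζ)) = R ζ := by
    rw [mul_assoc, neg_mul_comm, neg_div, neg_neg, mul_one_div_cancel hne, mul_one]
  rw [e] at h3
  exact h3

end SectorPrimitive

/-! ### Integrals along the truncated contour -/

section Contour

variable {θ κ τ : ℝ}

/-- The conditions under which the three pieces of `contourIntegral` run through `truncContour`. -/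
structure ContourAdmissible (θ κ τ : ℝ) : Prop where
  tau_pos : 0 < τ
  pi_div_two_lt : Real.pi / 2 < θ
  lt_pi : θ < Real.pi
  kappa_pos : 0 < κ
  kappa_le : κ ≤ Real.pi / τ

namespace ContourAdmissible

theorem sin_pos (h : ContourAdmissible θ κ τ) : 0 < Real.sin θ :=
  Real.sin_pos_of_pos_of_lt_pi (by linarith [h.pi_div_two_lt, Real.pi_pos]) h.lt_pi

theorem kappa_le_end (h : ContourAdmissible θ κ τ) : κ ≤ Real.pi / (τ * Real.sin θ) := by
  refine h.kappa_le.trans ?_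
  have h1 := h.sin_pos
  have h2 := h.tau_pos
  have h3 := Real.pi_pos
  gcongr
  exact mul_le_of_le_one_right h2.le (Real.sin_le_one θ)

theorem im_ray (r : ℝ) : ((r : ℂ) * Complex.exp (θ * Complex.I)).im = r * Real.sin θ := by
  rw [Complex.im_ofReal_mul, Complex.exp_ofReal_mul_I_im]

theorem im_ray_neg (r : ℝ) : ((r : ℂ) * Complex.exp (-(θ * Complex.I))).im = -(r * Real.sin θ) := by
  rw [← neg_mul, ← Complex.ofReal_neg, Complex.im_ofReal_mul, Complex.exp_ofReal_mul_I_im,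
    Real.sin_neg, mul_neg]

theorem mul_sin_le (h : ContourAdmissible θ κ τ) {r : ℝ}
    (hr : r ∈ Set.Icc κ (Real.pi / (τ * Real.sin θ))) : |r * Real.sin θ| ≤ Real.pi / τ := by
  have h1 := h.sin_pos
  have h2 := h.tau_pos
  rw [abs_of_nonneg (mul_nonneg (h.kappa_pos.le.trans hr.1) h1.le)]
  calc r * Real.sin θ ≤ Real.pi / (τ * Real.sin θ) * Real.sin θ := by gcongr; exact hr.2
    _ = Real.pi / τ := by field_simp

theorem ray_mem (h : ContourAdmissible θ κ τ) {r : ℝ}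
    (hr : r ∈ Set.Icc κ (Real.pi / (τ * Real.sin θ))) :
    (r : ℂ) * Complex.exp (θ * Complex.I) ∈ truncContour θ κ τ :=
  ⟨Or.inr ⟨r, hr.1, Or.inl rfl⟩, by rw [im_ray]; exact h.mul_sin_le hr⟩

theorem ray_neg_mem (h : ContourAdmissible θ κ τ) {r : ℝ}
    (hr : r ∈ Set.Icc κ (Real.pi / (τ * Real.sin θ))) :
    (r : ℂ) * Complex.exp (-(θ * Complex.I)) ∈ truncContour θ κ τ :=
  ⟨Or.inr ⟨r, hr.1, Or.inr rfl⟩, by rw [im_ray_neg, abs_neg]; exact h.mul_sin_le hr⟩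

theorem arg_circle {r x : ℝ} (hr : 0 < r) (hx : |x| < Real.pi) :
    ((r : ℂ) * Complex.exp (x * Complex.I)).arg = x := by
  rw [Complex.arg_real_mul _ hr, arg_exp_of_abs_im_lt] <;> simp [hx]

theorem arc_mem (h : ContourAdmissible θ κ τ) {x : ℝ} (hx : x ∈ Set.Icc (-θ) θ) :
    (κ : ℂ) * Complex.exp (x * Complex.I) ∈ truncContour θ κ τ := by
  have hn : ‖(κ : ℂ) * Complex.exp (x * Complex.I)‖ = κ := by
    rw [norm_mul, Complex.norm_exp_ofReal_mul_I, mul_one, Complex.norm_of_nonneg h.kappa_pos.le]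
  have hx' : |x| ≤ θ := abs_le.2 hx
  refine ⟨Or.inl ⟨hn, ?_⟩, (Complex.abs_im_le_norm _).trans (hn.le.trans h.kappa_le)⟩
  rw [arg_circle h.kappa_pos (hx'.trans_lt h.lt_pi)]
  exact hx'

/-- The truncated contour lies in the sector and the strip, off the origin. -/
theorem sector_of_mem (h : ContourAdmissible θ κ τ) {z : ℂ} (hz : z ∈ truncContour θ κ τ) :
    z ≠ 0 ∧ |z.arg| ≤ θ ∧ |z.im| ≤ Real.pi / τ := by
  have hθ : 0 < θ := by linarith [h.pi_div_two_lt, Real.pi_pos]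
  have hθ' : |θ| < Real.pi := by rw [abs_of_pos hθ]; exact h.lt_pi
  rcases hz with ⟨⟨hn, ha⟩ | ⟨r, hr, rfl | rfl⟩, hi⟩
  · exact ⟨norm_pos_iff.1 (hn ▸ h.kappa_pos), ha, hi⟩
  · have hr0 := h.kappa_pos.trans_le hr
    refine ⟨mul_ne_zero (by exact_mod_cast hr0.ne') (Complex.exp_ne_zero _), ?_, hi⟩
    rw [arg_circle hr0 hθ', abs_of_pos hθ]
  · have hr0 := h.kappa_pos.trans_le hr
    refine ⟨mul_ne_zero (by exact_mod_cast hr0.ne') (Complex.exp_ne_zero _), ?_, hi⟩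
    rw [← neg_mul, ← Complex.ofReal_neg, arg_circle hr0 (by rwa [abs_neg]), abs_neg, abs_of_pos hθ]

theorem continuousOn_pieces {V : Type*} [NormedAddCommGroup V] (h : ContourAdmissible θ κ τ) {F : ℂ → V}
    (hF : ContinuousOn F (truncContour θ κ τ)) :
    ContinuousOn (fun r : ℝ => F (r * Complex.exp (-(θ * Complex.I))))
        (Set.uIcc κ (Real.pi / (τ * Real.sin θ))) ∧
      ContinuousOn (fun x : ℝ => F (κ * Complex.exp (x * Complex.I))) (Set.uIcc (-θ) θ) ∧
      ContinuousOn (fun r : ℝ => F (r * Complex.exp (θ * Complex.I)))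
        (Set.uIcc κ (Real.pi / (τ * Real.sin θ))) := by
  have hθ : -θ ≤ θ := by linarith [h.pi_div_two_lt, Real.pi_pos]
  rw [Set.uIcc_of_le h.kappa_le_end, Set.uIcc_of_le hθ]
  exact ⟨hF.comp (by fun_prop) fun r hr => h.ray_neg_mem hr,
    hF.comp (by fun_prop) fun x hx => h.arc_mem hx,
    hF.comp (by fun_prop) fun r hr => h.ray_mem hr⟩

variable {V W : Type*} [NormedAddCommGroup V] [NormedSpace ℂ V] [NormedAddCommGroup W]
  [NormedSpace ℂ W]

theorem contourIntegral_congr (h : ContourAdmissible θ κ τ) {F G : ℂ → V}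
    (hFG : ∀ z ∈ truncContour θ κ τ, F z = G z) :
    contourIntegral θ κ τ F = contourIntegral θ κ τ G := by
  have hθ : -θ ≤ θ := by linarith [h.pi_div_two_lt, Real.pi_pos]
  unfold contourIntegral
  congr 1
  · congr 1
    · congr 1
      refine intervalIntegral.integral_congr fun r hr => ?_
      rw [Set.uIcc_of_le h.kappa_le_end] at hr
      simp only [hFG _ (h.ray_neg_mem hr)]
    · refine intervalIntegral.integral_congr fun x hx => ?_
      rw [Set.uIcc_of_le hθ] at hx
      simp only [hFG _ (h.arc_mem hx)]
  · refine intervalIntegral.integral_congr fun r hr => ?_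
    rw [Set.uIcc_of_le h.kappa_le_end] at hr
    simp only [hFG _ (h.ray_mem hr)]

theorem contourIntegrable (h : ContourAdmissible θ κ τ) {F : ℂ → V}
    (hF : ContinuousOn F (truncContour θ κ τ)) : ContourIntegrable θ κ τ F :=
  ⟨(h.continuousOn_pieces hF).1.intervalIntegrable, (h.continuousOn_pieces hF).2.1.intervalIntegrable,
    (h.continuousOn_pieces hF).2.2.intervalIntegrable⟩

theorem map_contourIntegral [CompleteSpace V] [CompleteSpace W] (h : ContourAdmissible θ κ τ)
    (L : V →L[ℂ] W) {F : ℂ → V} (hF : ContinuousOn F (truncContour θ κ τ)) :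
    L (contourIntegral θ κ τ F) = contourIntegral θ κ τ fun z => L (F z) := by
  obtain ⟨h1, h2, h3⟩ := h.continuousOn_pieces hF
  unfold contourIntegral
  rw [map_add, map_add, map_neg]
  rw [← L.intervalIntegral_comp_comm, ← L.intervalIntegral_comp_comm,
    ← L.intervalIntegral_comp_comm]
  · simp only [map_smul]
  · exact ContinuousOn.intervalIntegrable (ContinuousOn.smul continuousOn_const h3)
  · exact ContinuousOn.intervalIntegrable (ContinuousOn.smul (by fun_prop) h2)
  · exact ContinuousOn.intervalIntegrable (ContinuousOn.smul continuousOn_const h1)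

/-- The fundamental theorem of calculus along the contour. -/
theorem contourIntegral_eq_sub (h : ContourAdmissible θ κ τ) {Ψ H : ℂ → ℂ}
    (hH : ContinuousOn H (truncContour θ κ τ))
    (hΨ : ∀ z ∈ truncContour θ κ τ, HasDerivAt Ψ (H z) z) :
    contourIntegral θ κ τ H =
      Ψ ((Real.pi / (τ * Real.sin θ) : ℝ) * Complex.exp (θ * Complex.I)) -
      Ψ ((Real.pi / (τ * Real.sin θ) : ℝ) * Complex.exp (-(θ * Complex.I))) := by
  have hθ : -θ ≤ θ := by linarith [h.pi_div_two_lt, Real.pi_pos]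
  obtain ⟨h1, h2, h3⟩ := h.continuousOn_pieces hH
  unfold contourIntegral
  rw [intervalIntegral.integral_eq_sub_of_hasDerivAt
      (f := fun r : ℝ => Ψ (r * Complex.exp (-(θ * Complex.I)))),
    intervalIntegral.integral_eq_sub_of_hasDerivAt
      (f := fun x : ℝ => Ψ (κ * Complex.exp (x * Complex.I))),
    intervalIntegral.integral_eq_sub_of_hasDerivAt
      (f := fun r : ℝ => Ψ (r * Complex.exp (θ * Complex.I)))]
  · rw [Complex.ofReal_neg, neg_mul]
    ring
  · intro r hr
    rw [Set.uIcc_of_le h.kappa_le_end] at hr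
    have h4 : HasDerivAt (fun r : ℝ => (r : ℂ) * Complex.exp (θ * Complex.I))
        (1 * Complex.exp (θ * Complex.I)) r := (Complex.ofRealCLM.hasDerivAt (x := r)).mul_const _
    have := (hΨ _ (h.ray_mem hr)).scomp r h4
    rwa [one_mul] at this
  · refine ContinuousOn.intervalIntegrable ?_
    simp only [smul_eq_mul]
    exact continuousOn_const.mul h3
  · intro x hx
    rw [Set.uIcc_of_le hθ] at hx
    have h4 : HasDerivAt (fun x : ℝ => (κ : ℂ) * Complex.exp (x * Complex.I))
        (κ * (Complex.exp (x * Complex.I) * (1 * Complex.I))) x :=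
      (((Complex.ofRealCLM.hasDerivAt (x := x)).mul_const Complex.I).cexp).const_mul _
    have := (hΨ _ (h.arc_mem hx)).scomp x h4
    convert this using 1
    congr 1
    ring
  · refine ContinuousOn.intervalIntegrable ?_
    simp only [smul_eq_mul]
    refine ContinuousOn.mul (Continuous.continuousOn ?_) h2
    fun_prop
  · intro r hr
    rw [Set.uIcc_of_le h.kappa_le_end] at hr
    have h4 : HasDerivAt (fun r : ℝ => (r : ℂ) * Complex.exp (-(θ * Complex.I)))
        (1 * Complex.exp (-(θ * Complex.I))) r :=
      (Complex.ofRealCLM.hasDerivAt (x := r)).mul_const _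
    have := (hΨ _ (h.ray_neg_mem hr)).scomp r h4
    rwa [one_mul] at this
  · refine ContinuousOn.intervalIntegrable ?_
    simp only [smul_eq_mul]
    exact continuousOn_const.mul h1

theorem continuous_integral_piece {X : Type*} [TopologicalSpace X] [FirstCountableTopology X]
    {K : Set ℂ} {F : X → ℂ → V} (hF : ContinuousOn (Function.uncurry F) (Set.univ ×ˢ K))
    {a b : ℝ} (hab : a ≤ b) {γ c : ℝ → ℂ} (hγ : Continuous γ) (hc : Continuous c)
    (hK : ∀ r ∈ Set.Icc a b, γ r ∈ K) :
    Continuous fun x => ∫ r in a..b, c r • F x (γ r) := by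
  have e : (fun x => ∫ r in a..b, c r • F x (γ r)) =
      fun x => ∫ r in a..b, c r • F x (γ (Set.projIcc a b hab r)) := by
    ext x
    refine intervalIntegral.integral_congr fun r hr => ?_
    rw [Set.uIcc_of_le hab] at hr
    simp only [Set.projIcc_of_mem hab hr]
  rw [e]
  refine intervalIntegral.continuous_parametric_intervalIntegral_of_continuous' ?_ a b
  refine (hc.comp continuous_snd).smul (hF.comp_continuous
    (f := fun p : X × ℝ => (p.1, γ (Set.projIcc a b hab p.2))) ?_ fun p => ?_)
  · exact continuous_fst.prodMk (hγ.comp (continuous_subtype_val.comp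
      (continuous_projIcc.comp continuous_snd)))
  · exact ⟨trivial, hK _ (Set.projIcc a b hab p.2).2⟩

theorem integral_piece_swap {K : Set ℂ} {F : ℝ → ℂ → V}
    (hF : ContinuousOn (Function.uncurry F) (Set.univ ×ˢ K))
    {a b : ℝ} (hab : a ≤ b) {γ c : ℝ → ℂ} (hγ : Continuous γ) (hc : Continuous c)
    (hK : ∀ r ∈ Set.Icc a b, γ r ∈ K) (p q : ℝ) :
    ∫ s in p..q, ∫ r in a..b, c r • F s (γ r) = ∫ r in a..b, c r • ∫ s in p..q, F s (γ r) := by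
  have hcont : ContinuousOn (Function.uncurry fun s r => c r • F s (γ r))
      (Set.uIcc p q ×ˢ Set.uIcc a b) := by
    rw [Set.uIcc_of_le hab]
    refine ContinuousOn.smul (by fun_prop) (hF.comp (t := Set.univ ×ˢ K)
      (f := fun p : ℝ × ℝ => (p.1, γ p.2)) (by fun_prop) ?_)
    exact fun p hp => ⟨trivial, hK _ hp.2⟩
  have hint := hcont.integrableOn_compact (μ := volume) (isCompact_uIcc.prod isCompact_uIcc)
  rw [intervalIntegral_intervalIntegral_swap
    (hint.mono_set (Set.prod_mono Set.uIoc_subset_uIcc Set.uIoc_subset_uIcc))]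
  simp only [intervalIntegral.integral_smul]

end ContourAdmissible

end Contour

/-! ### The scalar scheme and its generating function -/

section Symbol

variable {α τ β l θ κ : ℝ}

/-- The generating function `δ_τ(ζ)^{α-1} (δ_τ(ζ)^α + l)⁻¹` of the scalar scheme with `-Δ` replaced
by `l`. -/
def cqSymbol (α τ l : ℝ) (ζ : ℂ) : ℂ :=
  deltaTau τ ζ ^ ((α : ℂ) - 1) * (deltaTau τ ζ ^ (α : ℂ) + l)⁻¹

theorem deltaTau_eq (τ : ℝ) (ζ : ℂ) : deltaTau τ ζ = (1 - ζ) * ((τ⁻¹ : ℝ) : ℂ) := by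
  rw [deltaTau, Complex.ofReal_inv, div_eq_mul_inv]

theorem arg_deltaTau (hτ : 0 < τ) (ζ : ℂ) : (deltaTau τ ζ).arg = (1 - ζ).arg := by
  rw [deltaTau_eq, Complex.arg_mul_real (inv_pos.2 hτ)]

theorem deltaTau_mem_slitPlane (hτ : 0 < τ) {ζ : ℂ} (hζ : ζ ∈ sectorAtOne β) :
    deltaTau τ ζ ∈ Complex.slitPlane := by
  have h := Complex.mem_slitPlane_iff_arg.1 hζ.1
  rw [Complex.mem_slitPlane_iff_arg, arg_deltaTau hτ]
  refine ⟨h.1, ?_⟩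
  rw [deltaTau_eq]
  exact mul_ne_zero h.2 (by exact_mod_cast (inv_pos.2 hτ).ne')

theorem deltaTau_cpow_mem_slitPlane (hτ : 0 < τ) (hα : 0 < α) (hαβ : α * β ≤ Real.pi) {ζ : ℂ}
    (hζ : ζ ∈ sectorAtOne β) : deltaTau τ ζ ^ (α : ℂ) ∈ Complex.slitPlane := by
  refine cpow_mem_slitPlane (Complex.slitPlane_ne_zero (deltaTau_mem_slitPlane hτ hζ)) ?_
  rw [arg_deltaTau hτ, abs_mul, abs_of_pos hα]
  exact (mul_lt_mul_of_pos_left hζ.2 hα).trans_le hαβ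

theorem differentiableOn_cqSymbol (hτ : 0 < τ) (hα : 0 < α) (hαβ : α * β ≤ Real.pi) (hl : 0 ≤ l) :
    DifferentiableOn ℂ (cqSymbol α τ l) (sectorAtOne β) := by
  have hd : DifferentiableOn ℂ (deltaTau τ) (sectorAtOne β) := by
    unfold deltaTau
    fun_prop
  have h1 : ∀ c : ℂ, DifferentiableOn ℂ (fun ζ => deltaTau τ ζ ^ c) (sectorAtOne β) := fun c =>
    hd.cpow_const fun ζ hζ => deltaTau_mem_slitPlane hτ hζ
  exact (h1 _).mul (((h1 _).add_const _).inv fun ζ hζ =>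
    add_ofReal_ne_zero (deltaTau_cpow_mem_slitPlane hτ hα hαβ hζ) hl)

theorem mul_ofReal_cpow {x : ℂ} (hx : x ≠ 0) {r : ℝ} (hr : 0 < r) (c : ℝ) :
    (x * r) ^ (c : ℂ) = x ^ (c : ℂ) * ((r ^ c : ℝ) : ℂ) := by
  have hr' : (r : ℂ) ≠ 0 := by exact_mod_cast hr.ne'
  rw [Complex.ofReal_cpow hr.le, Complex.cpow_def_of_ne_zero hx, Complex.cpow_def_of_ne_zero hr',
    Complex.cpow_def_of_ne_zero (mul_ne_zero hx hr'), Complex.log_mul_ofReal r hr x hx, add_mul,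
    Complex.exp_add, Complex.ofReal_log hr.le, mul_comm]

/-- The coefficients of the power series `δ_τ(ζ) + l δ_τ(ζ)^{1-α}`: the weights of the scalar scheme
with `-Δ` replaced by `l`. -/
def schemeCoeff (α τ l : ℝ) (k : ℕ) : ℂ :=
  (τ : ℂ)⁻¹ * ((if k = 0 then 1 else 0) - (if k = 1 then 1 else 0)) +
    l * (((τ ^ (1 - α) : ℝ) : ℂ))⁻¹ * cqCoeff (1 - α) k

/-- The left-hand side of the scalar scheme as a convolution with `schemeCoeff`. -/
theorem sum_schemeCoeff {n : ℕ} (hn : 1 ≤ n) (x : ℕ → ℂ) :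
    ∑ i ∈ Finset.range (n + 1), schemeCoeff α τ l (n - i) * x i =
      (τ : ℂ)⁻¹ * (x n - x (n - 1)) + l * cqDeriv (1 - α) τ x n := by
  have e1 : ∑ i ∈ Finset.range (n + 1), (if n - i = 0 then (1 : ℂ) else 0) * x i = x n := by
    rw [Finset.sum_eq_single n]
    · simp
    · intro i hi hin
      have := Finset.mem_range.1 hi
      rw [if_neg (by omega), zero_mul]
    · intro h; exact absurd (Finset.mem_range.2 (by omega)) h
  have e2 : ∑ i ∈ Finset.range (n + 1), (if n - i = 1 then (1 : ℂ) else 0) * x i = x (n - 1) := by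
    rw [Finset.sum_eq_single (n - 1)]
    · rw [if_pos (by omega), one_mul]
    · intro i hi hin
      have := Finset.mem_range.1 hi
      rw [if_neg (by omega), zero_mul]
    · intro h; exact absurd (Finset.mem_range.2 (by omega)) h
  rw [← e1, ← e2, cqDeriv, ← Finset.sum_sub_distrib, Finset.mul_sum, smul_eq_mul, Finset.mul_sum,
    Finset.mul_sum, ← Finset.sum_add_distrib]
  refine Finset.sum_congr rfl fun i _ => ?_
  simp only [schemeCoeff, smul_eq_mul]
  ring

/-- The weights of the scalar scheme and the Taylor coefficients of `cqSymbol` are inverse to each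
other for convolution, because `δ + l δ^{1-α} = δ^{1-α} (δ^α + l)` is the inverse of the symbol. -/
theorem sum_schemeCoeff_mul_taylorCoeff (hτ : 0 < τ) (hα : 0 < α) (hl : 0 ≤ l) (n : ℕ) :
    ∑ i ∈ Finset.range (n + 1), schemeCoeff α τ l (n - i) * taylorCoeff (cqSymbol α τ l) i =
      if n = 0 then 1 else 0 := by
  have hpi := Real.pi_pos
  have hαβ : α * (Real.pi / α) ≤ Real.pi := by rw [mul_div_cancel₀ _ hα.ne']
  have hmem := (isOpen_sectorAtOne (Real.pi / α)).mem_nhds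
    (zero_mem_sectorAtOne (div_pos hpi hα))
  have hG : AnalyticAt ℂ (cqSymbol α τ l) 0 :=
    (differentiableOn_cqSymbol hτ hα hαβ hl).analyticAt hmem
  have hp : AnalyticAt ℂ (fun ζ : ℂ => (1 - ζ) ^ ((1 - α : ℝ) : ℂ)) 0 := by
    refine AnalyticAt.cpow (by fun_prop) analyticAt_const ?_
    simp
  have h0 : AnalyticAt ℂ (fun _ : ℂ => (τ : ℂ)⁻¹) 0 := analyticAt_const
  have h1 : AnalyticAt ℂ (fun ζ : ℂ => -(τ : ℂ)⁻¹ * ζ) 0 := by fun_prop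
  have h2 : AnalyticAt ℂ (fun ζ : ℂ => l * (((τ ^ (1 - α) : ℝ) : ℂ))⁻¹ *
      (1 - ζ) ^ ((1 - α : ℝ) : ℂ)) 0 := analyticAt_const.mul hp
  have hA : ∀ k, taylorCoeff ((fun _ : ℂ => (τ : ℂ)⁻¹) + (fun ζ : ℂ => -(τ : ℂ)⁻¹ * ζ) +
      fun ζ : ℂ => l * (((τ ^ (1 - α) : ℝ) : ℂ))⁻¹ * (1 - ζ) ^ ((1 - α : ℝ) : ℂ)) k =
      schemeCoeff α τ l k := by
    intro k
    rw [taylorCoeff_add (h0.add h1) h2, taylorCoeff_add h0 h1, taylorCoeff_const_mul,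
      taylorCoeff_const_mul, taylorCoeff_const, taylorCoeff_id, schemeCoeff]
    change _ + _ * cqCoeff (1 - α) k = _
    split_ifs <;> ring
  simp_rw [← hA]
  rw [← taylorCoeff_mul ((h0.add h1).add h2) hG, ← taylorCoeff_const]
  refine taylorCoeff_congr ?_ n
  filter_upwards [hmem] with ζ hζ
  have hs := deltaTau_mem_slitPlane hτ hζ
  have hne := Complex.slitPlane_ne_zero hs
  have hne2 := add_ofReal_ne_zero (deltaTau_cpow_mem_slitPlane hτ hα hαβ hζ) hl
  have hτ' : (τ : ℂ) ≠ 0 := by exact_mod_cast hτ.ne'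
  have hτ2 : (((τ ^ (1 - α) : ℝ) : ℂ)) ≠ 0 := by exact_mod_cast (Real.rpow_pos_of_pos hτ _).ne'
  have e1 : (1 - ζ) = deltaTau τ ζ * τ := by rw [deltaTau, div_mul_cancel₀ _ hτ']
  have e2 : (τ : ℂ)⁻¹ + -(τ : ℂ)⁻¹ * ζ = deltaTau τ ζ := by rw [deltaTau]; field_simp; ring
  simp only [Pi.mul_apply, Pi.add_apply]
  rw [e2, e1, mul_ofReal_cpow hne hτ, cqSymbol]
  set δ := deltaTau τ ζ
  have e3 : δ * δ ^ ((α : ℂ) - 1) = δ ^ (α : ℂ) := by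
    rw [Complex.cpow_sub _ _ hne, Complex.cpow_one, mul_div_cancel₀ _ hne]
  have e4 : δ ^ ((1 - α : ℝ) : ℂ) * δ ^ ((α : ℂ) - 1) = 1 := by
    rw [← Complex.cpow_add _ _ hne]
    push_cast
    simp
  calc _ = (δ * δ ^ ((α : ℂ) - 1) + l * (δ ^ ((1 - α : ℝ) : ℂ) * δ ^ ((α : ℂ) - 1)) *
        ((((τ ^ (1 - α) : ℝ) : ℂ))⁻¹ * ((τ ^ (1 - α) : ℝ) : ℂ))) * (δ ^ (α : ℂ) + l)⁻¹ := by ring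
    _ = 1 := by rw [e3, e4, inv_mul_cancel₀ hτ2, mul_one, mul_one, mul_inv_cancel₀ hne2]

end Symbol

section Convolution

theorem coeff_mk_mul_mk (a g : ℕ → ℂ) (n : ℕ) :
    PowerSeries.coeff n (PowerSeries.mk a * PowerSeries.mk g) =
      ∑ i ∈ Finset.range (n + 1), a (n - i) * g i := by
  rw [PowerSeries.coeff_mul, Finset.Nat.antidiagonal_eq_map', Finset.sum_map]
  simp only [PowerSeries.coeff_mk]
  rfl

variable {a g : ℕ → ℂ}

theorem mk_mul_mk_eq_one
    (h : ∀ n, ∑ i ∈ Finset.range (n + 1), a (n - i) * g i = if n = 0 then 1 else 0) :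
    PowerSeries.mk a * PowerSeries.mk g = 1 := by
  ext n
  rw [coeff_mk_mul_mk, h, PowerSeries.coeff_one]

/-- Convolution with `g` solves the convolution equation with weights `a`. -/
theorem conv_conv_eq
    (h : ∀ n, ∑ i ∈ Finset.range (n + 1), a (n - i) * g i = if n = 0 then 1 else 0)
    (ξ : ℕ → ℂ) (n : ℕ) :
    ∑ i ∈ Finset.range (n + 1), a (n - i) * ∑ k ∈ Finset.range (i + 1), g (i - k) * ξ k = ξ n := by
  have e : PowerSeries.mk (fun i => ∑ k ∈ Finset.range (i + 1), g (i - k) * ξ k) =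
      PowerSeries.mk g * PowerSeries.mk ξ := by
    ext i
    rw [coeff_mk_mul_mk, PowerSeries.coeff_mk]
  rw [← coeff_mk_mul_mk a, e, ← mul_assoc, mk_mul_mk_eq_one h, one_mul, PowerSeries.coeff_mk]

/-- Up to any index, the solution of the convolution equation with weights `a` is unique. -/
theorem eq_conv_of_conv_eq
    (h : ∀ n, ∑ i ∈ Finset.range (n + 1), a (n - i) * g i = if n = 0 then 1 else 0)
    {x ξ : ℕ → ℂ} {N : ℕ}
    (hx : ∀ n ≤ N, ∑ i ∈ Finset.range (n + 1), a (n - i) * x i = ξ n) {n : ℕ} (hn : n ≤ N) :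
    x n = ∑ k ∈ Finset.range (n + 1), g (n - k) * ξ k := by
  have e : PowerSeries.mk x = PowerSeries.mk g * (PowerSeries.mk a * PowerSeries.mk x) := by
    rw [← mul_assoc, mul_comm (PowerSeries.mk g), mk_mul_mk_eq_one h, one_mul]
  have e2 := congrArg (PowerSeries.coeff n) e
  have e3 : PowerSeries.mk a * PowerSeries.mk x =
      PowerSeries.mk fun k => ∑ i ∈ Finset.range (k + 1), a (k - i) * x i := by
    ext k
    rw [coeff_mk_mul_mk, PowerSeries.coeff_mk]
  rw [PowerSeries.coeff_mk, e3, coeff_mk_mul_mk] at e2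
  rw [e2]
  refine Finset.sum_congr rfl fun k hk => ?_
  rw [hx k ((Nat.lt_succ_iff.1 (Finset.mem_range.1 hk)).trans hn)]

end Convolution

/-! ### Contour integrals as Taylor coefficients -/

section ContourCoefficient

variable {α τ β θ κ : ℝ}

theorem ContourAdmissible.abs_im_mul_le (h : ContourAdmissible θ κ τ) {z : ℂ}
    (hz : z ∈ truncContour θ κ τ) : |(z * τ).im| ≤ Real.pi := by
  have h1 := (h.sector_of_mem hz).2.2
  rw [Complex.im_mul_ofReal, abs_mul, abs_of_pos h.tau_pos]
  exact (le_div_iff₀ h.tau_pos).1 h1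

theorem ContourAdmissible.exp_mem_sectorAtOne (h : ContourAdmissible θ κ τ)
    (h34 : θ < 3 * Real.pi / 4) (hβ : θ < β) {z : ℂ} (hz : z ∈ truncContour θ κ τ) :
    Complex.exp (-(z * τ)) ∈ sectorAtOne β := by
  obtain ⟨hz0, ha, -⟩ := h.sector_of_mem hz
  have hw : z * τ ≠ 0 := mul_ne_zero hz0 (by exact_mod_cast h.tau_pos.ne')
  have h1 := h.abs_im_mul_le hz
  have h2 := abs_arg_one_sub_exp_neg_le h1 h.pi_div_two_lt h34
    (by rwa [Complex.arg_mul_real h.tau_pos])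
  refine ⟨Complex.mem_slitPlane_iff_arg.2 ⟨fun h3 => ?_, one_sub_exp_neg_ne_zero hw h1⟩,
    h2.trans_lt hβ⟩
  rw [h3, abs_of_pos Real.pi_pos] at h2
  linarith [h.lt_pi]

/-- The contour integral extracts Taylor coefficients: in the variable `ζ = e^{-zτ}` the contour is
a closed curve around the origin inside the sector, on which `G` minus its Taylor polynomial, divided
by the appropriate power of `ζ`, has a primitive. -/
theorem ContourAdmissible.contourIntegral_eq_taylorCoeff (h : ContourAdmissible θ κ τ)
    (h34 : θ < 3 * Real.pi / 4) (hβ : θ < β) (hβπ : β ≤ Real.pi) {G : ℂ → ℂ}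
    (hG : DifferentiableOn ℂ G (sectorAtOne β)) (m : ℕ) :
    contourIntegral θ κ τ (fun z => Complex.exp (z * τ) ^ m * τ * G (Complex.exp (-(z * τ)))) =
      2 * Real.pi * Complex.I * taylorCoeff G m := by
  have hβ0 : 0 < β := by linarith [h.pi_div_two_lt, Real.pi_pos]
  have hτ : (τ : ℂ) ≠ 0 := by exact_mod_cast h.tau_pos.ne'
  obtain ⟨R, hR, hGR⟩ :=
    exists_taylor_remainder (isOpen_sectorAtOne β) (zero_mem_sectorAtOne hβ0) (m + 1) hG
  obtain ⟨Q, hQ⟩ := exists_primitive_sectorAtOne hβπ hR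
  have hcont : ContinuousOn
      (fun z : ℂ => Complex.exp (z * τ) ^ m * τ * G (Complex.exp (-(z * τ))))
      (truncContour θ κ τ) :=
    ContinuousOn.mul (by fun_prop) (hG.continuousOn.comp (by fun_prop) fun z hz =>
      h.exp_mem_sectorAtOne h34 hβ hz)
  -- A primitive of the integrand: only the linear term, from the coefficient of order `m`, fails to be
  -- `2πi/τ`-periodic, and the endpoints of the contour differ by `2πi/τ`.
  let Ψ : ℂ → ℂ := fun z => taylorCoeff G m * (τ * z) +
    ∑ k ∈ Finset.range m, taylorCoeff G k * (Complex.exp (z * τ) ^ (m - k) / ((m - k : ℕ) : ℂ)) -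
      Q (Complex.exp (-(z * τ)))
  have hΨ : ∀ z ∈ truncContour θ κ τ, HasDerivAt Ψ
      (Complex.exp (z * τ) ^ m * τ * G (Complex.exp (-(z * τ)))) z := by
    intro z hz
    have hlin : HasDerivAt (fun z : ℂ => z * τ) (1 * τ) z := (hasDerivAt_id z).mul_const _
    have hE := hlin.cexp
    have hE' : HasDerivAt (fun z : ℂ => Complex.exp (-(z * τ)))
        (Complex.exp (-(z * τ)) * -(1 * τ)) z := hlin.neg.cexp
    have d1 : HasDerivAt (fun z : ℂ => taylorCoeff G m * (τ * z)) (taylorCoeff G m * (τ * 1)) z :=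
      ((hasDerivAt_id z).const_mul _).const_mul _
    have d2 : HasDerivAt (fun z : ℂ => ∑ k ∈ Finset.range m,
        taylorCoeff G k * (Complex.exp (z * τ) ^ (m - k) / ((m - k : ℕ) : ℂ)))
        (∑ k ∈ Finset.range m, taylorCoeff G k * (((m - k : ℕ) : ℂ) *
          Complex.exp (z * τ) ^ (m - k - 1) * (Complex.exp (z * τ) * (1 * τ)) /
            ((m - k : ℕ) : ℂ))) z :=
      HasDerivAt.fun_sum fun k _ => ((hE.fun_pow (m - k)).div_const _).const_mul _
    have d3 := (hQ _ (h.exp_mem_sectorAtOne h34 hβ hz)).comp z hE'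
    refine ((d1.add d2).sub d3).congr_deriv ?_
    rw [hGR]
    have hE0 := Complex.exp_ne_zero (z * τ)
    rw [Complex.exp_neg]
    set E := Complex.exp (z * τ)
    have e1 : ∑ k ∈ Finset.range m, taylorCoeff G k * (((m - k : ℕ) : ℂ) * E ^ (m - k - 1) *
        (E * (1 * τ)) / ((m - k : ℕ) : ℂ)) =
        E ^ m * τ * ∑ k ∈ Finset.range m, taylorCoeff G k * E⁻¹ ^ k := by
      rw [Finset.mul_sum]
      refine Finset.sum_congr rfl fun k hk => ?_
      have hk' := Finset.mem_range.1 hk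
      have h3 : ((m - k : ℕ) : ℂ) ≠ 0 := by
        exact_mod_cast (Nat.sub_pos_of_lt hk').ne'
      obtain ⟨p, hp⟩ : ∃ p, m = k + p + 1 := ⟨m - k - 1, by omega⟩
      rw [show m - k - 1 = p by omega, show E ^ m = E ^ k * E ^ p * E by rw [hp]; ring,
        inv_pow]
      field_simp
    have e2 : E ^ m * τ * (taylorCoeff G m * E⁻¹ ^ m) = taylorCoeff G m * τ := by
      rw [inv_pow]
      field_simp
    have e3 : E ^ m * τ * (E⁻¹ ^ (m + 1) * R E⁻¹) = R E⁻¹ * (E⁻¹ * τ) := by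
      rw [inv_pow, pow_succ]
      field_simp
    rw [e1, Finset.sum_range_succ, mul_add, mul_add, e2, e3]
    ring
  rw [h.contourIntegral_eq_sub hcont hΨ]
  have hend : ((Real.pi / (τ * Real.sin θ) : ℝ) : ℂ) * Complex.exp (θ * Complex.I) * τ =
      ((Real.pi / (τ * Real.sin θ) : ℝ) : ℂ) * Complex.exp (-(θ * Complex.I)) * τ +
        2 * Real.pi * Complex.I := by
    have hs : (Real.sin θ : ℂ) ≠ 0 := by exact_mod_cast h.sin_pos.ne'
    rw [← neg_mul, Complex.exp_mul_I, Complex.exp_mul_I, Complex.cos_neg, Complex.sin_neg]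
    push_cast at hs ⊢
    field_simp
    ring
  have hper : Complex.exp (((Real.pi / (τ * Real.sin θ) : ℝ) : ℂ) *
      Complex.exp (θ * Complex.I) * τ) = Complex.exp (((Real.pi / (τ * Real.sin θ) : ℝ) : ℂ) *
        Complex.exp (-(θ * Complex.I)) * τ) := by
    rw [hend, Complex.exp_add, Complex.exp_two_pi_mul_I, mul_one]
  simp only [Ψ]
  have hper' : ∀ x y : ℂ, Complex.exp x = Complex.exp y → Complex.exp (-x) = Complex.exp (-y) :=
    fun x y hxy => by rw [Complex.exp_neg, Complex.exp_neg, hxy]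
  rw [hper' _ _ hper, hper]
  linear_combination taylorCoeff G m * hend

end ContourCoefficient

/-! ### The kernel in the eigenbasis -/

namespace ContourAdmissible

variable {α β θ κ τ : ℝ}

section Parametric

variable {V : Type*} [NormedAddCommGroup V] [NormedSpace ℂ V]

theorem neg_le (h : ContourAdmissible θ κ τ) : -θ ≤ θ := by
  linarith [h.pi_div_two_lt, Real.pi_pos]

theorem continuous_contourIntegral (h : ContourAdmissible θ κ τ)
    {X : Type*} [TopologicalSpace X] [FirstCountableTopology X] {F : X → ℂ → V}
    (hF : ContinuousOn (Function.uncurry F) (Set.univ ×ˢ truncContour θ κ τ)) :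
    Continuous fun x => contourIntegral θ κ τ (F x) :=
  ((continuous_integral_piece hF h.kappa_le_end (by fun_prop) (by fun_prop)
      fun r hr => h.ray_neg_mem hr).neg.add
    (continuous_integral_piece hF h.neg_le (by fun_prop) (by fun_prop) fun x hx => h.arc_mem hx)).add
    (continuous_integral_piece hF h.kappa_le_end (by fun_prop) (by fun_prop)
      fun r hr => h.ray_mem hr)

/-- Fubini for a time integral and a contour integral. -/
theorem integral_contourIntegral (h : ContourAdmissible θ κ τ) {F : ℝ → ℂ → V}
    (hF : ContinuousOn (Function.uncurry F) (Set.univ ×ˢ truncContour θ κ τ)) (p q : ℝ) :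
    ∫ s in p..q, contourIntegral θ κ τ (F s) =
      contourIntegral θ κ τ fun z => ∫ s in p..q, F s z := by
  have c1 := continuous_integral_piece hF h.kappa_le_end (γ := fun r => r *
    Complex.exp (-(θ * Complex.I))) (c := fun _ => Complex.exp (-(θ * Complex.I)))
    (by fun_prop) (by fun_prop) fun r hr => h.ray_neg_mem hr
  have c2 := continuous_integral_piece hF h.neg_le (γ := fun x => κ * Complex.exp (x * Complex.I))
    (c := fun x => κ * Complex.I * Complex.exp (x * Complex.I))
    (by fun_prop) (by fun_prop) fun x hx => h.arc_mem hx
  have c3 := continuous_integral_piece hF h.kappa_le_end (γ := fun r => r *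
    Complex.exp (θ * Complex.I)) (c := fun _ => Complex.exp (θ * Complex.I))
    (by fun_prop) (by fun_prop) fun r hr => h.ray_mem hr
  unfold contourIntegral
  rw [intervalIntegral.integral_add, intervalIntegral.integral_add, intervalIntegral.integral_neg,
    integral_piece_swap hF h.kappa_le_end (γ := fun r => r *
    Complex.exp (-(θ * Complex.I))) (c := fun _ => Complex.exp (-(θ * Complex.I)))
    (by fun_prop) (by fun_prop) fun r hr => h.ray_neg_mem hr,
    integral_piece_swap hF h.neg_le (γ := fun x => κ * Complex.exp (x * Complex.I))
    (c := fun x => κ * Complex.I * Complex.exp (x * Complex.I))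
    (by fun_prop) (by fun_prop) fun x hx => h.arc_mem hx,
    integral_piece_swap hF h.kappa_le_end (γ := fun r => r *
    Complex.exp (θ * Complex.I)) (c := fun _ => Complex.exp (θ * Complex.I))
    (by fun_prop) (by fun_prop) fun r hr => h.ray_mem hr]
  · exact c1.neg.intervalIntegrable _ _
  · exact c2.intervalIntegrable _ _
  · exact (c1.neg.add c2).intervalIntegrable _ _
  · exact c3.intervalIntegrable _ _

end Parametric

/-- An angle `β` for which `sectorAtOne β` contains the image of the contour under `z ↦ e^{-zτ}`, while
`δ_τ^α` maps `sectorAtOne β` into the slit plane. -/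
theorem exists_sector_angle (h : ContourAdmissible θ κ τ) (hα : 0 < α) (hαθ : α * θ < Real.pi) :
    ∃ β, θ < β ∧ β ≤ Real.pi ∧ α * β ≤ Real.pi := by
  refine ⟨min Real.pi (Real.pi / α), lt_min h.lt_pi ?_, min_le_left _ _, ?_⟩
  · rwa [lt_div_iff₀ hα, mul_comm]
  · calc α * min Real.pi (Real.pi / α) ≤ α * (Real.pi / α) := by
          gcongr; exact min_le_right _ _
      _ = Real.pi := mul_div_cancel₀ _ hα.ne'

theorem deltaTau_exp_mem (h : ContourAdmissible θ κ τ) (h34 : θ < 3 * Real.pi / 4) (hα : 0 < α)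
    (hαθ : α * θ < Real.pi) {z : ℂ} (hz : z ∈ truncContour θ κ τ) :
    deltaTau τ (Complex.exp (-(z * τ))) ∈ Complex.slitPlane ∧
      deltaTau τ (Complex.exp (-(z * τ))) ^ (α : ℂ) ∈ Complex.slitPlane := by
  obtain ⟨β, h1, h2, h3⟩ := h.exists_sector_angle hα hαθ
  have hm := h.exp_mem_sectorAtOne h34 h1 hz
  exact ⟨deltaTau_mem_slitPlane h.tau_pos hm, deltaTau_cpow_mem_slitPlane h.tau_pos hα h3 hm⟩

theorem exp_sub_one_ne_zero (h : ContourAdmissible θ κ τ) {z : ℂ} (hz : z ∈ truncContour θ κ τ) :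
    Complex.exp (z * τ) - 1 ≠ 0 := by
  have h1 := one_sub_exp_neg_ne_zero
    (mul_ne_zero (h.sector_of_mem hz).1 (by exact_mod_cast h.tau_pos.ne')) (h.abs_im_mul_le hz)
  have h2 : Complex.exp (z * τ) - 1 = Complex.exp (z * τ) * (1 - Complex.exp (-(z * τ))) := by
    rw [mul_sub, ← Complex.exp_add]
    simp
  rw [h2]
  exact mul_ne_zero (Complex.exp_ne_zero _) h1

theorem continuousOn_deltaTau_cpow (h : ContourAdmissible θ κ τ) (h34 : θ < 3 * Real.pi / 4)
    (hα : 0 < α) (hαθ : α * θ < Real.pi) (c : ℂ) :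
    ContinuousOn (fun z : ℂ => deltaTau τ (Complex.exp (-(z * τ))) ^ c) (truncContour θ κ τ) := by
  refine ContinuousOn.cpow_const ?_ fun z hz => (h.deltaTau_exp_mem h34 hα hαθ hz).1
  unfold deltaTau
  fun_prop

theorem continuousOn_kernelWeight (h : ContourAdmissible θ κ τ) (h34 : θ < 3 * Real.pi / 4)
    (hα : 0 < α) (hαθ : α * θ < Real.pi) :
    ContinuousOn (fun z : ℂ => z * τ / (Complex.exp (z * τ) - 1) *
      deltaTau τ (Complex.exp (-(z * τ))) ^ ((α : ℂ) - 1)) (truncContour θ κ τ) :=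
  ContinuousOn.mul (ContinuousOn.div (by fun_prop) (by fun_prop) fun _ hz => h.exp_sub_one_ne_zero hz)
    (h.continuousOn_deltaTau_cpow h34 hα hαθ _)

variable {d : ℕ} {O : TopologicalSpace.Opens (EuclideanSpace ℝ (Fin d))}
  {φ : HilbertBasis ℕ ℂ (L2 O)} {lam : ℕ → ℝ}

theorem continuousOn_resolvent (h : ContourAdmissible θ κ τ) (h34 : θ < 3 * Real.pi / 4)
    (hα : 0 < α) (hαθ : α * θ < Real.pi) (hφ : IsDirichletEigenbasis O φ lam) (f : L2 O) :
    ContinuousOn (fun z : ℂ => dirichletResolvent O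
      (deltaTau τ (Complex.exp (-(z * τ))) ^ (α : ℂ)) f) (truncContour θ κ τ) :=
  (hφ.continuousOn_dirichletResolvent f).comp (h.continuousOn_deltaTau_cpow h34 hα hαθ _)
    fun _ hz => (h.deltaTau_exp_mem h34 hα hαθ hz).2

theorem continuousOn_kernelIntegrand (h : ContourAdmissible θ κ τ) (h34 : θ < 3 * Real.pi / 4)
    (hα : 0 < α) (hαθ : α * θ < Real.pi) (hφ : IsDirichletEigenbasis O φ lam) (t : ℝ) (f : L2 O) :
    ContinuousOn (kernelIntegrand O α τ t f) (truncContour θ κ τ) := by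
  have h1 : ContinuousOn (fun z : ℂ => Complex.exp (z * t)) (truncContour θ κ τ) := by fun_prop
  have h2 := (h1.mul (h.continuousOn_kernelWeight h34 hα hαθ)).smul
    (h.continuousOn_resolvent h34 hα hαθ hφ f)
  refine h2.congr fun z _ => ?_
  simp only [kernelIntegrand, mul_assoc, Pi.smul_apply', Pi.mul_apply]

/-- Integrating `e^{z(t_n - s)}` over a grid interval cancels the weight `zτ / (e^{zτ} - 1)`. -/
theorem integral_exp_mul_kernelWeight (h : ContourAdmissible θ κ τ) {z : ℂ}
    (hz : z ∈ truncContour θ κ τ) {n k : ℕ} (hkn : k ≤ n) :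
    (∫ s in (((k : ℝ) - 1) * τ)..(k * τ), Complex.exp (z * ((n * τ - s : ℝ) : ℂ))) *
      (z * τ / (Complex.exp (z * τ) - 1)) = Complex.exp (z * τ) ^ (n - k) * τ := by
  have hz0 := (h.sector_of_mem hz).1
  have he := h.exp_sub_one_ne_zero hz
  have hd : ∀ s : ℝ, HasDerivAt (fun s : ℝ => -Complex.exp (z * ((n * τ - s : ℝ) : ℂ)) / z)
      (Complex.exp (z * ((n * τ - s : ℝ) : ℂ))) s := by
    intro s
    have h1 : HasDerivAt (fun s : ℝ => z * ((n * τ - s : ℝ) : ℂ)) (z * (-1)) s := by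
      have h2 : HasDerivAt (fun s : ℝ => ((n * τ - s : ℝ) : ℂ)) (((-1 : ℝ)) : ℂ) s :=
        ((hasDerivAt_id s).const_sub (n * τ)).ofReal_comp
      exact (h2.const_mul z).congr_deriv (by push_cast; ring)
    have h3 := (h1.cexp.neg.div_const z)
    refine h3.congr_deriv ?_
    field_simp
  rw [intervalIntegral.integral_eq_sub_of_hasDerivAt (fun s _ => hd s)
    (Continuous.intervalIntegrable (by fun_prop) _ _)]
  have e1 : z * ((n * τ - k * τ : ℝ) : ℂ) = ((n - k : ℕ) : ℂ) * (z * τ) := by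
    rw [Nat.cast_sub hkn]; push_cast; ring
  have e2 : z * ((n * τ - (k - 1) * τ : ℝ) : ℂ) = ((n - k : ℕ) : ℂ) * (z * τ) + z * τ := by
    rw [Nat.cast_sub hkn]; push_cast; ring
  rw [e1, e2, Complex.exp_add, Complex.exp_nat_mul]
  field_simp
  ring

/-- A continuous `L²(O)`-valued function `e` whose `j`-th coordinate is the eigenvalue of `E_τ(t)` at
`φ j`. That the coordinates are square summable rests on the Hilbert–Schmidt property of the
resolvent. The integral of `e` over a grid interval has as coordinates the Taylor coefficients of
the generating functions of the scalar schemes. -/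
theorem exists_kernelVector (h : ContourAdmissible θ κ τ) (h34 : θ < 3 * Real.pi / 4)
    (hα : 0 < α) (hαθ : α * θ < Real.pi) (hφ : IsDirichletEigenbasis O φ lam)
    (hsum : Summable fun j => ((1 + lam j)⁻¹ : ℝ) ^ 2) :
    ∃ e : ℝ → L2 O, Continuous e ∧
      (∀ t j, Etau O α θ κ τ t (φ j) = inner ℂ (φ j) (e t) • φ j) ∧
      ∀ n k : ℕ, k ≤ n → ∀ j,
        inner ℂ (φ j) (∫ s in (((k : ℝ) - 1) * τ)..(k * τ), e (n * τ - s)) =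
          taylorCoeff (cqSymbol α τ (lam j)) (n - k) := by
  obtain ⟨β, hβ1, hβ2, hβ3⟩ := h.exists_sector_angle hα hαθ
  obtain ⟨f₀, hf₀⟩ := hilbertBasis_exists_of_summable φ (c := fun j => ((1 + lam j : ℝ) : ℂ)⁻¹) (by
    refine hsum.congr fun j => ?_
    rw [norm_inv, Complex.norm_of_nonneg (by linarith [hφ.nonneg j])])
  let μ : ℂ → ℂ := fun z => deltaTau τ (Complex.exp (-(z * τ))) ^ (α : ℂ)
  let m : ℂ → ℂ := fun z => z * τ / (Complex.exp (z * τ) - 1) *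
      deltaTau τ (Complex.exp (-(z * τ))) ^ ((α : ℂ) - 1)
  -- The first resolvent identity `(μ + l)⁻¹ = (1 + l)⁻¹ (1 + (1 - μ) (μ + l)⁻¹)` reduces the resolvents
  -- at all points of the contour to the square summable sequence `(1 + lam j)⁻¹`.
  let V : ℂ → L2 O := fun z => m z • (f₀ + (1 - μ z) • dirichletResolvent O (μ z) f₀)
  have hμ : ∀ z ∈ truncContour θ κ τ, μ z ∈ Complex.slitPlane := fun z hz =>
    (h.deltaTau_exp_mem h34 hα hαθ hz).2
  have hμc : ContinuousOn μ (truncContour θ κ τ) := h.continuousOn_deltaTau_cpow h34 hα hαθ _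
  have hmc : ContinuousOn m (truncContour θ κ τ) := h.continuousOn_kernelWeight h34 hα hαθ
  have hVc : ContinuousOn V (truncContour θ κ τ) :=
    hmc.smul (continuousOn_const.add ((continuousOn_const.sub hμc).smul
      (h.continuousOn_resolvent h34 hα hαθ hφ f₀)))
  have hVj : ∀ z ∈ truncContour θ κ τ, ∀ j, inner ℂ (φ j) (V z) = m z * (μ z + lam j)⁻¹ := by
    intro z hz j
    have h1 := hφ.add_ne_zero (hμ z hz) j
    have h2 : (1 + lam j : ℂ) ≠ 0 := by
      have : (1 + lam j : ℝ) ≠ 0 := by linarith [hφ.nonneg j]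
      exact_mod_cast this
    simp only [V]
    rw [inner_smul_right, inner_add_right, inner_smul_right,
      hφ.inner_dirichletResolvent (hμ z hz), hf₀]
    push_cast
    field_simp
    ring
  have hjoint : ContinuousOn (Function.uncurry fun (t : ℝ) (z : ℂ) => Complex.exp (z * t) • V z)
      (Set.univ ×ˢ truncContour θ κ τ) :=
    ContinuousOn.smul (f := fun p : ℝ × ℂ => Complex.exp (p.2 * p.1)) (g := fun p => V p.2)
      (by fun_prop) (hVc.comp continuousOn_snd fun p hp => hp.2)
  have hslice : ∀ t : ℝ, ContinuousOn (fun z : ℂ => Complex.exp (z * t) • V z)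
      (truncContour θ κ τ) := fun t =>
    ContinuousOn.smul (f := fun z : ℂ => Complex.exp (z * t)) (by fun_prop) hVc
  let e : ℝ → L2 O := fun t => (2 * Real.pi * Complex.I : ℂ)⁻¹ •
    contourIntegral θ κ τ fun z => Complex.exp (z * t) • V z
  have hec : Continuous e := by
    have h1 := h.continuous_contourIntegral hjoint
    simp only [e]
    fun_prop
  have hej : ∀ t j, inner ℂ (φ j) (e t) = (2 * Real.pi * Complex.I : ℂ)⁻¹ *
      contourIntegral θ κ τ fun z => Complex.exp (z * t) * (m z * (μ z + lam j)⁻¹) := by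
    intro t j
    simp only [e]
    rw [inner_smul_right]
    congr 1
    have := h.map_contourIntegral (innerSL ℂ (φ j)) (hslice t)
    rw [innerSL_apply_apply] at this
    rw [this]
    refine h.contourIntegral_congr fun z hz => ?_
    rw [innerSL_apply_apply, inner_smul_right, hVj z hz]
  refine ⟨e, hec, fun t j => ?_, fun n k hkn j => ?_⟩
  · rw [hej, Etau, mul_smul]
    congr 1
    have hsc : ContinuousOn (fun z : ℂ => Complex.exp (z * t) * (m z * (μ z + lam j)⁻¹))
        (truncContour θ κ τ) :=
      ContinuousOn.mul (by fun_prop) (hmc.mul ((hμc.add continuousOn_const).inv₀ fun z hz =>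
        hφ.add_ne_zero (hμ z hz) j))
    have := h.map_contourIntegral (ContinuousLinearMap.toSpanSingleton ℂ (φ j)) hsc
    rw [ContinuousLinearMap.toSpanSingleton_apply] at this
    rw [this]
    refine h.contourIntegral_congr fun z hz => ?_
    rw [ContinuousLinearMap.toSpanSingleton_apply, kernelIntegrand,
      hφ.dirichletResolvent_basis (hμ z hz), smul_smul]
    congr 1
    simp only [m, μ]
    ring
  · have hcomm := (innerSL ℂ (φ j)).intervalIntegral_comp_comm
      (f := fun s : ℝ => e (n * τ - s)) (a := ((k : ℝ) - 1) * τ) (b := k * τ) (μ := volume)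
      (Continuous.intervalIntegrable (by fun_prop) _ _)
    simp only [innerSL_apply_apply] at hcomm
    rw [← hcomm]
    simp only [hej]
    have hjc : ContinuousOn (Function.uncurry fun (s : ℝ) (z : ℂ) =>
        Complex.exp (z * ((n * τ - s : ℝ) : ℂ)) * (m z * (μ z + lam j)⁻¹))
        (Set.univ ×ˢ truncContour θ κ τ) := by
      refine ContinuousOn.mul (f := fun p : ℝ × ℂ => Complex.exp (p.2 * ((n * τ - p.1 : ℝ) : ℂ)))
        (g := fun p => m p.2 * (μ p.2 + lam j)⁻¹) (by fun_prop) ?_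
      exact (hmc.mul ((hμc.add continuousOn_const).inv₀ fun z hz =>
        hφ.add_ne_zero (hμ z hz) j)).comp continuousOn_snd fun p hp => hp.2
    rw [intervalIntegral.integral_const_mul, h.integral_contourIntegral hjc]
    have hG := differentiableOn_cqSymbol h.tau_pos hα hβ3 (hφ.nonneg j)
    have hfin := h.contourIntegral_eq_taylorCoeff h34 hβ1 hβ2 hG (n - k)
    have hpi : (2 * Real.pi * Complex.I : ℂ) ≠ 0 := Complex.two_pi_I_ne_zero
    rw [inv_mul_eq_iff_eq_mul₀ hpi, ← hfin]
    refine h.contourIntegral_congr fun z hz => ?_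
    rw [intervalIntegral.integral_mul_const, ← h.integral_exp_mul_kernelWeight hz hkn]
    simp only [m, μ, cqSymbol]
    ring

end ContourAdmissible

/-! ### Series of random vectors and the noise operator -/

section SeriesL2

variable {Ω : Type*} [MeasurableSpace Ω] {P : Measure Ω}
  {E F : Type*} [NormedAddCommGroup E] [NormedAddCommGroup F]

theorem HasSumL2.congr_ae {f g : ℕ → Ω → F} {S T : Ω → F} (h : HasSumL2 P f S)
    (hfg : ∀ j, f j =ᵐ[P] g j) (hST : S =ᵐ[P] T) : HasSumL2 P g T := by
  refine Tendsto.congr (fun m => eLpNorm_congr_ae ?_) h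
  filter_upwards [ae_all_iff.2 hfg, hST] with ω h1 h2
  simp only [h1, h2]

theorem HasSumL2.sub {f g : ℕ → Ω → F} {S T : Ω → F} (hf : HasSumL2 P f S) (hg : HasSumL2 P g T)
    (hfm : ∀ j, AEStronglyMeasurable (f j) P) (hgm : ∀ j, AEStronglyMeasurable (g j) P)
    (hS : AEStronglyMeasurable S P) (hT : AEStronglyMeasurable T P) :
    HasSumL2 P (fun j ω => f j ω - g j ω) (fun ω => S ω - T ω) := by
  refine tendsto_of_tendsto_of_tendsto_of_le_of_le tendsto_const_nhds
    (by simpa using Tendsto.add hf hg) (fun _ => zero_le) fun m => ?_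
  have hA := (Finset.aestronglyMeasurable_fun_sum (Finset.range m) fun j _ => hfm j).sub hS
  have hB := (Finset.aestronglyMeasurable_fun_sum (Finset.range m) fun j _ => hgm j).sub hT
  refine le_trans (le_of_eq (eLpNorm_congr_ae (Eventually.of_forall fun ω => ?_)))
    (eLpNorm_sub_le hA hB one_le_two)
  simp only [Pi.sub_apply, Finset.sum_sub_distrib]
  abel

theorem HasSumL2.clm [NormedSpace ℂ E] [NormedSpace ℂ F] {f : ℕ → Ω → E} {S : Ω → E}
    (hf : HasSumL2 P f S) (L : E →L[ℂ] F) :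
    HasSumL2 P (fun j ω => L (f j ω)) (fun ω => L (S ω)) := by
  have h0 : Tendsto (fun m : ℕ => ENNReal.ofReal ‖L‖ *
      eLpNorm (fun ω => (∑ j ∈ Finset.range m, f j ω) - S ω) 2 P) atTop (𝓝 0) := by
    simpa using ENNReal.Tendsto.const_mul hf (Or.inr (ENNReal.ofReal_ne_top (r := ‖L‖)))
  refine tendsto_of_tendsto_of_tendsto_of_le_of_le tendsto_const_nhds h0
    (fun _ => zero_le) fun m => ?_
  refine eLpNorm_le_mul_eLpNorm_of_ae_le_mul (Eventually.of_forall fun ω => ?_) 2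
  rw [← map_sum, ← map_sub]
  exact L.le_opNorm _

/-- A series whose only nonzero term has index `i` has that term as its sum. -/
theorem HasSumL2.eq_single {f : ℕ → Ω → F} {S : Ω → F} (h : HasSumL2 P f S) (i : ℕ)
    (hi : ∀ j ≠ i, f j = 0) (hfm : AEStronglyMeasurable (f i) P)
    (hS : AEStronglyMeasurable S P) : S =ᵐ[P] f i := by
  have h1 : Tendsto (fun _ : ℕ => eLpNorm (f i - S) 2 P) atTop (𝓝 0) := by
    refine h.congr' ?_
    filter_upwards [eventually_gt_atTop i] with m hm
    congr 1
    funext ω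
    rw [Finset.sum_eq_single_of_mem i (Finset.mem_range.2 hm)
      fun j _ hj => congrFun (hi j hj) ω, Pi.sub_apply]
  have h2 := (eLpNorm_eq_zero_iff (hfm.sub hS) two_ne_zero).1 (tendsto_nhds_unique
    tendsto_const_nhds h1)
  filter_upwards [h2] with ω hω
  exact (sub_eq_zero.1 hω).symm

end SeriesL2

section Expansion

variable {Ω : Type*} [MeasurableSpace Ω] {P : Measure Ω}
  {E : Type*} [NormedAddCommGroup E] [InnerProductSpace ℂ E]

/-- The pointwise basis expansion of a square integrable random vector converges in `L²(Ω; E)`,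
by dominated convergence: the remainders are bounded by the norm of the vector. -/
theorem hasSumL2_expansion (φ : HilbertBasis ℕ ℂ E) {F : Ω → E} (hF : MemLp F 2 P) :
    HasSumL2 P (fun j ω => inner ℂ (φ j) (F ω) • φ j) F := by
  have hle : ∀ m ω, ‖(∑ j ∈ Finset.range m, inner ℂ (φ j) (F ω) • φ j) - F ω‖ ≤ ‖F ω‖ := by
    intro m ω
    rw [← one_mul ‖F ω‖]
    refine norm_le_of_norm_inner_le φ zero_le_one fun i => ?_
    simp only [inner_sub_right, inner_sum, inner_smul_right, hilbertBasis_inner_basis, mul_ite,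
      mul_one, mul_zero, Finset.sum_ite_eq, Finset.mem_range, one_mul]
    split_ifs <;> simp
  have hlim : ∀ ω, Tendsto (fun m => (∑ j ∈ Finset.range m, inner ℂ (φ j) (F ω) • φ j) - F ω)
      atTop (𝓝 0) := by
    intro ω
    have := (φ.hasSum_repr (F ω)).tendsto_sum_nat.sub_const (F ω)
    simpa only [φ.repr_apply_apply, sub_self] using this
  have hm : ∀ m, AEStronglyMeasurable
      (fun ω => (∑ j ∈ Finset.range m, inner ℂ (φ j) (F ω) • φ j) - F ω) P := fun m =>
    (Finset.aestronglyMeasurable_fun_sum _ fun j _ =>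
      (((innerSL ℂ (φ j)).continuous.comp_aestronglyMeasurable
        hF.aestronglyMeasurable).smul_const (φ j))).sub hF.aestronglyMeasurable
  have hfin := lintegral_rpow_enorm_lt_top_of_eLpNorm_lt_top two_ne_zero ENNReal.ofNat_ne_top hF.2
  have key := tendsto_lintegral_of_dominated_convergence' (μ := P)
    (F := fun m ω => ‖(∑ j ∈ Finset.range m, inner ℂ (φ j) (F ω) • φ j) - F ω‖ₑ
      ^ (2 : ℝ≥0∞).toReal) (f := fun _ => 0) (fun ω => ‖F ω‖ₑ ^ (2 : ℝ≥0∞).toReal)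
    (fun m => (hm m).enorm.pow_const _)
    (fun m => Eventually.of_forall fun ω => by
      exact ENNReal.rpow_le_rpow (enorm_le_iff_norm_le.2 (hle m ω)) ENNReal.toReal_nonneg) hfin.ne
    (Eventually.of_forall fun ω => by
      have := ((hlim ω).enorm).ennrpow_const (2 : ℝ≥0∞).toReal
      simpa using this)
  simp only [HasSumL2, eLpNorm_eq_lintegral_rpow_enorm_toReal two_ne_zero ENNReal.ofNat_ne_top]
  have := key.ennrpow_const (1 / (2 : ℝ≥0∞).toReal)
  simpa using this

/-- The noise operator with coordinates `ξ j`: for real random variables `ξ j` with a common second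
moment, `J f = ∑ j, ξ j ⟨φ j, f⟩ φ j` defines a bounded operator from `E` to `L²(Ω; E)`. The
vectors `ξ j φ j` are orthogonal because the `φ j` are, whatever the joint law of the `ξ j`. -/
theorem exists_noiseMap [CompleteSpace E] (φ : HilbertBasis ℕ ℂ E) {ξ : ℕ → Ω → ℝ} {σ : ℝ}
    (hσ : 0 < σ) (hξ : ∀ j, MemLp (ξ j) 2 P) (hvar : ∀ j, ∫ ω, ξ j ω ^ 2 ∂P = σ ^ 2) :
    ∃ J : E →L[ℂ] Lp E 2 P, ∀ f, ∀ᵐ ω ∂P, ∀ j,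
      inner ℂ (φ j) (J f ω) = (ξ j ω : ℂ) * inner ℂ (φ j) f := by
  have hmem : ∀ j, MemLp (fun ω => ((σ⁻¹ * ξ j ω : ℝ) : ℂ) • φ j) 2 P := by
    intro j
    have h1 : MemLp (fun ω => ((σ⁻¹ * ξ j ω : ℝ) : ℂ)) 2 P := ((hξ j).const_mul σ⁻¹).ofReal
    exact (ContinuousLinearMap.toSpanSingleton ℂ (φ j)).comp_memLp' h1
  let ψ : ℕ → Lp E 2 P := fun j => (hmem j).toLp _
  have hψ : Orthonormal ℂ ψ := by
    rw [orthonormal_iff_ite]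
    intro i j
    rw [L2.inner_def]
    have h1 : ∀ᵐ ω ∂P, inner ℂ (ψ i ω) (ψ j ω) =
        if i = j then (((σ⁻¹) ^ 2 * ξ i ω ^ 2 : ℝ) : ℂ) else 0 := by
      filter_upwards [(hmem i).coeFn_toLp, (hmem j).coeFn_toLp] with ω hi hj
      rw [hi, hj, inner_smul_left, inner_smul_right, hilbertBasis_inner_basis, Complex.conj_ofReal]
      split_ifs with hij
      · subst hij; push_cast; ring
      · simp
    rw [integral_congr_ae h1]
    split_ifs
    · rw [integral_complex_ofReal, integral_const_mul, hvar]
      norm_cast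
      field_simp
    · simp
  let V := hψ.orthogonalFamily
  let J : E →L[ℂ] Lp E 2 P := (σ : ℂ) •
    V.linearIsometry.toContinuousLinearMap.comp (φ.repr.toContinuousLinearEquiv : E →L[ℂ] _)
  refine ⟨J, fun f => ae_all_iff.2 fun j => ?_⟩
  have hsum : HasSum (fun i => (σ : ℂ) • (inner ℂ (φ i) f • ψ i)) (J f) := by
    have := (V.hasSum_linearIsometry (φ.repr f)).const_smul (σ : ℂ)
    simp only [LinearIsometry.toSpanSingleton_apply, φ.repr_apply_apply] at this
    exact this
  have hcoord := hsum.mapL ((innerSL ℂ (φ j)).compLpL 2 P)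
  have hterm : ∀ i, (innerSL ℂ (φ j)).compLpL 2 P (ψ i) =
      if i = j then (innerSL ℂ (φ j)).compLpL 2 P (ψ j) else 0 := by
    intro i
    split_ifs with hij
    · rw [hij]
    · rw [Lp.eq_zero_iff_ae_eq_zero]
      filter_upwards [(innerSL ℂ (φ j)).coeFn_compLpL (ψ i), (hmem i).coeFn_toLp] with ω h1 h2
      rw [h1, h2, innerSL_apply_apply, inner_smul_right, hilbertBasis_inner_basis,
        if_neg (Ne.symm hij)]
      simp
  have heq : (innerSL ℂ (φ j)).compLpL 2 P (J f) =
      (innerSL ℂ (φ j)).compLpL 2 P ((σ : ℂ) • (inner ℂ (φ j) f • ψ j)) := by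
    refine hcoord.unique ?_
    refine hasSum_single j fun i hij => ?_
    rw [map_smul, map_smul, hterm, if_neg hij, smul_zero, smul_zero]
  filter_upwards [(innerSL ℂ (φ j)).coeFn_compLpL (J f), (innerSL ℂ (φ j)).coeFn_compLpL
    ((σ : ℂ) • (inner ℂ (φ j) f • ψ j)), Lp.coeFn_smul (σ : ℂ) (inner ℂ (φ j) f • ψ j),
    Lp.coeFn_smul (inner ℂ (φ j) f) (ψ j), (hmem j).coeFn_toLp] with ω h1 h2 h3 h4 h5
  rw [heq] at h1
  rw [innerSL_apply_apply] at h1 h2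
  rw [← h1, h2, h3, Pi.smul_apply, h4, Pi.smul_apply, h5]
  simp only [inner_smul_right, hilbertBasis_inner_basis, if_true]
  have : (σ : ℂ) ≠ 0 := by exact_mod_cast hσ.ne'
  push_cast
  field_simp

end Expansion

section Increments

variable {Ω : Type*} [MeasurableSpace Ω] {P : Measure Ω}

/-- The time `-τ` is truncated to `0`, so the increment of index `0` vanishes. -/
theorem diffQuot_zero (τ : ℝ) (hτ : 0 < τ) (w : ℝ≥0 → ℝ) : diffQuot τ w 0 = 0 := by
  have : Real.toNNReal (((0 : ℕ) - 1 : ℝ) * τ) = Real.toNNReal ((0 : ℕ) * τ) := by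
    rw [Real.toNNReal_of_nonpos (by push_cast; linarith), Nat.cast_zero, zero_mul,
      Real.toNNReal_zero]
  rw [diffQuot, this, sub_self, zero_div]

variable {W : ℝ≥0 → Ω → ℝ}

theorem hasLaw_increment (hW : IsBrownianReal W P) {τ : ℝ} (hτ : 0 < τ) {n : ℕ} (hn : 1 ≤ n) :
    HasLaw (W (Real.toNNReal (n * τ)) - W (Real.toNNReal ((n - 1) * τ)))
      (gaussianReal 0 (Real.toNNReal τ)) P := by
  have h1 := hW.toIsPreBrownianReal.hasLaw_sub (Real.toNNReal (n * τ))
    (Real.toNNReal ((n - 1) * τ))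
  have hn' : (1 : ℝ) ≤ n := by exact_mod_cast hn
  have h2 : nndist ((Real.toNNReal (n * τ) : ℝ≥0) : ℝ) ((Real.toNNReal ((n - 1) * τ) : ℝ≥0) : ℝ) =
      Real.toNNReal τ := by
    rw [Real.coe_toNNReal _ (by positivity), Real.coe_toNNReal _ (mul_nonneg (by linarith) hτ.le)]
    ext
    rw [coe_nndist, Real.dist_eq, Real.coe_toNNReal _ hτ.le]
    rw [show (n : ℝ) * τ - (n - 1) * τ = τ by ring, abs_of_pos hτ]
  rwa [← h2]

theorem memLp_diffQuot (hW : IsBrownianReal W P) {τ : ℝ} (hτ : 0 < τ) {n : ℕ} (hn : 1 ≤ n) :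
    MemLp (fun ω => diffQuot τ (fun t => W t ω) n) 2 P := by
  have := (hasLaw_increment hW hτ hn).hasGaussianLaw.memLp_two.mul_const τ⁻¹
  simpa only [diffQuot, div_eq_mul_inv, Pi.sub_apply] using this

theorem integral_diffQuot_sq [IsProbabilityMeasure P] (hW : IsBrownianReal W P) {τ : ℝ}
    (hτ : 0 < τ) {n : ℕ} (hn : 1 ≤ n) :
    ∫ ω, diffQuot τ (fun t => W t ω) n ^ 2 ∂P = ((√τ)⁻¹) ^ 2 := by
  have hl := hasLaw_increment hW hτ hn
  have h1 := hl.variance_eq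
  rw [variance_id_gaussianReal, variance_of_integral_eq_zero hl.aemeasurable
    (by rw [hl.integral_eq, integral_id_gaussianReal]), Real.coe_toNNReal _ hτ.le] at h1
  simp only [diffQuot, div_pow, integral_div]
  simp only [Pi.sub_apply] at h1
  rw [h1, inv_pow, Real.sq_sqrt hτ.le]
  field_simp

end Increments

/-! ### Functions glued along the time grid -/

section StepFunction

variable {V : Type*} [NormedAddCommGroup V]

/-- The function on the time grid that equals `F k` on `(t_{k-1}, t_k]` for `1 ≤ k ≤ N`, and `0`
elsewhere. -/
def gridGlue (τ : ℝ) (N : ℕ) (F : ℕ → ℝ → V) (s : ℝ) : V :=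
  ∑ k ∈ Finset.Icc 1 N, (Set.Ioc (((k : ℝ) - 1) * τ) ((k : ℝ) * τ)).indicator (F k) s

variable {τ : ℝ} {N : ℕ} {F : ℕ → ℝ → V} {s : ℝ}

theorem gridGlue_of_mem (hτ : 0 < τ) {k : ℕ} (hk : k ∈ Finset.Icc 1 N)
    (hs : s ∈ Set.Ioc (((k : ℝ) - 1) * τ) ((k : ℝ) * τ)) : gridGlue τ N F s = F k s := by
  rw [gridGlue, Finset.sum_eq_single_of_mem k hk, Set.indicator_of_mem hs]
  intro i _ hik
  refine Set.indicator_of_notMem (fun hi => hik ?_) _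
  have h1 : ((i : ℝ) - 1) < k := lt_of_mul_lt_mul_right (hi.1.trans_le hs.2) hτ.le
  have h2 : ((k : ℝ) - 1) < i := lt_of_mul_lt_mul_right (hs.1.trans_le hi.2) hτ.le
  have h3 : i < k + 1 := by exact_mod_cast (by linarith : (i : ℝ) < k + 1)
  have h4 : k < i + 1 := by exact_mod_cast (by linarith : (k : ℝ) < i + 1)
  omega

theorem gridGlue_of_forall_notMem
    (hs : ∀ k ∈ Finset.Icc 1 N, s ∉ Set.Ioc (((k : ℝ) - 1) * τ) ((k : ℝ) * τ)) :
    gridGlue τ N F s = 0 :=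
  Finset.sum_eq_zero fun k hk => Set.indicator_of_notMem (hs k hk) _

theorem pwDiffQuot_eq_gridGlue (τ : ℝ) (N : ℕ) (w : ℝ≥0 → ℝ) :
    pwDiffQuot τ N w = gridGlue τ N fun k _ => diffQuot τ w k := rfl

theorem ofReal_gridGlue_smul [NormedSpace ℂ V] (hτ : 0 < τ) (ξ : ℕ → ℝ) (c : ℝ → V) (s : ℝ) :
    ((gridGlue τ N (fun k _ => ξ k) s : ℝ) : ℂ) • c s =
      gridGlue τ N (fun k s => (ξ k : ℂ) • c s) s := by
  by_cases h : ∃ k ∈ Finset.Icc 1 N, s ∈ Set.Ioc (((k : ℝ) - 1) * τ) ((k : ℝ) * τ)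
  · obtain ⟨k, hk, hs⟩ := h
    rw [gridGlue_of_mem hτ hk hs, gridGlue_of_mem hτ hk hs]
  · push Not at h
    rw [gridGlue_of_forall_notMem h, gridGlue_of_forall_notMem h, Complex.ofReal_zero, zero_smul]

theorem eqOn_gridGlue (hτ : 0 < τ) {k : ℕ} (hk : k < N) :
    Set.EqOn (F (k + 1)) (gridGlue τ N F) (Set.uIoc ((k : ℝ) * τ) (((k + 1 : ℕ) : ℝ) * τ)) := by
  intro s hs
  rw [Set.uIoc_of_le (by gcongr; simp)] at hs
  refine (gridGlue_of_mem hτ (Finset.mem_Icc.2 ⟨by omega, by omega⟩) ?_).symm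
  push_cast at hs ⊢
  rwa [add_sub_cancel_right]

theorem intervalIntegrable_gridGlue (hτ : 0 < τ) (hF : ∀ k, Continuous (F k)) {n : ℕ}
    (hn : n ≤ N) : IntervalIntegrable (gridGlue τ N F) volume 0 (n * τ) := by
  have := IntervalIntegrable.trans_iterate (f := gridGlue τ N F) (μ := volume)
    (a := fun k : ℕ => (k : ℝ) * τ) (n := n) fun k hk =>
      (intervalIntegrable_congr (eqOn_gridGlue hτ (hk.trans_le hn))).1
        ((hF (k + 1)).intervalIntegrable _ _)
  simpa using this

theorem integral_gridGlue [NormedSpace ℝ V] (hτ : 0 < τ) (hF : ∀ k, Continuous (F k)) {n : ℕ}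
    (hn : n ≤ N) : ∫ s in (0 : ℝ)..(n * τ), gridGlue τ N F s =
      ∑ k ∈ Finset.range n, ∫ s in (((k + 1 : ℕ) : ℝ) - 1) * τ..((k + 1 : ℕ) : ℝ) * τ,
        F (k + 1) s := by
  have := intervalIntegral.sum_integral_adjacent_intervals (f := gridGlue τ N F) (μ := volume)
    (a := fun k : ℕ => (k : ℝ) * τ) (n := n) fun k hk =>
      (intervalIntegrable_congr (eqOn_gridGlue hτ (hk.trans_le hn))).1
        ((hF (k + 1)).intervalIntegrable _ _)
  simp only [Nat.cast_zero, zero_mul] at this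
  rw [← this]
  refine Finset.sum_congr rfl fun k hk => ?_
  have hkN := (Finset.mem_range.1 hk).trans_le hn
  rw [show (((k + 1 : ℕ) : ℝ) - 1) = k by push_cast; ring]
  refine intervalIntegral.integral_congr_ae (Eventually.of_forall fun s hs => ?_)
  exact (eqOn_gridGlue hτ hkN hs).symm

end StepFunction

/-! ### Solutions of the scheme and their representation -/

section Scheme

variable {d : ℕ} {O : TopologicalSpace.Opens (EuclideanSpace ℝ (Fin d))}
  {φ : HilbertBasis ℕ ℂ (L2 O)} {lam : ℕ → ℝ}
  {Ω : Type*} [MeasurableSpace Ω] {P : Measure Ω}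
  {W : ℕ → ℝ≥0 → Ω → ℝ} {α τ : ℝ} {N : ℕ}

theorem memLp_cqDeriv {u : ℕ → Ω → L2 O} {n : ℕ} (hu : ∀ k ≤ n, MemLp (u k) 2 P) (β τ : ℝ) :
    MemLp (fun ω => cqDeriv β τ (fun k => u k ω) n) 2 P := by
  have h : MemLp (fun ω => ∑ j ∈ Finset.range (n + 1), cqCoeff β (n - j) • u j ω) 2 P :=
    memLp_finsetSum _ fun j hj =>
      (hu j (Nat.lt_succ_iff.1 (Finset.mem_range.1 hj))).const_smul (cqCoeff β (n - j))
  exact h.const_smul (((τ ^ β : ℝ) : ℂ))⁻¹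

theorem sum_schemeCoeff_inner {n : ℕ} (hn : 1 ≤ n) (x : ℕ → L2 O) (l : ℝ) (v : L2 O) :
    ∑ i ∈ Finset.range (n + 1), schemeCoeff α τ l (n - i) * inner ℂ v (x i) =
      inner ℂ v ((τ : ℂ)⁻¹ • (x n - x (n - 1))) + l * inner ℂ v (cqDeriv (1 - α) τ x n) := by
  rw [sum_schemeCoeff hn]
  simp only [cqDeriv, inner_smul_right, inner_sub_right, inner_sum, smul_eq_mul]

/-- In the eigenbasis the scheme decouples: `u` is a solution if and only if almost surely each
coordinate solves the scalar scheme with `-Δ` replaced by the eigenvalue. -/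
theorem isCQSolution_iff (hφ : IsDirichletEigenbasis O φ lam) (hW : ∀ j, IsBrownianReal (W j) P)
    (hτ : 0 < τ) {u : ℕ → Ω → L2 O} (hu : ∀ n ≤ N, MemLp (u n) 2 P) (hu0 : u 0 =ᵐ[P] 0) :
    IsCQSolution P O φ W α τ N u ↔ ∀ n, 1 ≤ n → n ≤ N → ∀ᵐ ω ∂P, ∀ j,
      ∑ i ∈ Finset.range (n + 1), schemeCoeff α τ (lam j) (n - i) * inner ℂ (φ j) (u i ω) =
        (diffQuot τ (fun t => W j t ω) n : ℂ) := by
  have hξ : ∀ n, 1 ≤ n → ∀ j,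
      AEStronglyMeasurable (fun ω => (diffQuot τ (fun t => W j t ω) n : ℂ)) P := fun n hn j =>
    (memLp_diffQuot (hW j) hτ hn).ofReal.aestronglyMeasurable
  have hw : ∀ n ≤ N, MemLp (fun ω => (τ : ℂ)⁻¹ • (u n ω - u (n - 1) ω)) 2 P := fun n hn =>
    ((hu n hn).sub (hu (n - 1) (by omega))).const_smul (τ : ℂ)⁻¹
  have hy : ∀ n ≤ N, MemLp (fun ω => cqDeriv (1 - α) τ (fun k => u k ω) n) 2 P := fun n hn =>
    memLp_cqDeriv (fun k hk => hu k (hk.trans hn)) _ _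
  have hin : ∀ (v : L2 O) {F : Ω → L2 O}, MemLp F 2 P →
      AEStronglyMeasurable (fun ω => inner ℂ v (F ω)) P := fun v F hF =>
    (innerSL ℂ v).continuous.comp_aestronglyMeasurable hF.aestronglyMeasurable
  constructor
  · intro hsol n hn1 hnN
    refine ae_all_iff.2 fun j => ?_
    have hs := hsol.step n hn1 hnN _ _ (hφ.eigen j)
    have h1 := hs.eq_single j (fun i hij => by
        funext ω
        rw [hilbertBasis_inner_basis, if_neg (Ne.symm hij), zero_mul, Pi.zero_apply])
      ((hξ n hn1 j).const_mul _) ((hin _ (hw n hnN)).sub (hin _ (hy n hnN)))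
    filter_upwards [h1] with ω hω
    rw [sum_schemeCoeff_inner hn1 (fun i => u i ω)]
    rw [hilbertBasis_inner_basis, if_pos rfl, one_mul, inner_neg_left, inner_smul_left,
      Complex.conj_ofReal, sub_neg_eq_add] at hω
    exact hω
  · intro hcoord
    refine ⟨hu, hu0, fun n hn1 hnN v h hv => ?_⟩
    have hvh := hφ.isDirichletLaplacian_iff.1 hv
    have hvh' : ∀ j, inner ℂ h (φ j) = -(lam j : ℂ) * inner ℂ v (φ j) := fun j => by
      rw [← inner_conj_symm, hvh, map_mul, map_neg, Complex.conj_ofReal, inner_conj_symm]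
    have hterm : ∀ (a : L2 O) {F : Ω → L2 O}, MemLp F 2 P → ∀ j,
        AEStronglyMeasurable (fun ω => innerSL ℂ a (inner ℂ (φ j) (F ω) • φ j)) P :=
      fun a F hF j => (innerSL ℂ a).continuous.comp_aestronglyMeasurable
        ((hin (φ j) hF).smul_const (φ j))
    have h1 := ((hasSumL2_expansion φ (hw n hnN)).clm (innerSL ℂ v)).sub
      ((hasSumL2_expansion φ (hy n hnN)).clm (innerSL ℂ h)) (hterm v (hw n hnN))
      (hterm h (hy n hnN)) (hin v (hw n hnN)) (hin h (hy n hnN))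
    refine h1.congr_ae (fun j => ?_) ae_eq_rfl
    filter_upwards [hcoord n hn1 hnN] with ω hω
    have h2 := hω j
    rw [sum_schemeCoeff_inner hn1 (fun i => u i ω)] at h2
    rw [innerSL_apply_apply, innerSL_apply_apply, inner_smul_right v, inner_smul_right h, hvh', ← h2]
    ring

/-- The coordinates of a solution are the convolutions of the Taylor coefficients of the symbol with
the increments; this is uniqueness for the scheme. -/
theorem inner_solution (hφ : IsDirichletEigenbasis O φ lam) (hW : ∀ j, IsBrownianReal (W j) P)
    (hτ : 0 < τ) (hα : 0 < α) {u : ℕ → Ω → L2 O} (hu : IsCQSolution P O φ W α τ N u) :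
    ∀ᵐ ω ∂P, ∀ j, ∀ n ≤ N, inner ℂ (φ j) (u n ω) = ∑ k ∈ Finset.range (n + 1),
      taylorCoeff (cqSymbol α τ (lam j)) (n - k) * (diffQuot τ (fun t => W j t ω) k : ℂ) := by
  have h1 := (isCQSolution_iff hφ hW hτ hu.memLp hu.init).1 hu
  have h2 : ∀ᵐ ω ∂P, ∀ n, 1 ≤ n → n ≤ N → ∀ j,
      ∑ i ∈ Finset.range (n + 1), schemeCoeff α τ (lam j) (n - i) * inner ℂ (φ j) (u i ω) =
        (diffQuot τ (fun t => W j t ω) n : ℂ) :=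
    ae_all_iff.2 fun n => eventually_imp_distrib_left.2 fun hn =>
      eventually_imp_distrib_left.2 fun hN => h1 n hn hN
  filter_upwards [h2, hu.init] with ω hω h0 j n hn
  refine eq_conv_of_conv_eq (x := fun n => inner ℂ (φ j) (u n ω))
    (sum_schemeCoeff_mul_taylorCoeff hτ hα (hφ.nonneg j)) (fun m hm => ?_) hn
  rcases Nat.eq_zero_or_pos m with rfl | hm1
  · simp [h0, diffQuot_zero τ hτ]
  · exact hω m hm1 hm j

variable [IsProbabilityMeasure P]

/-- The noise operators of the Brownian increments; the one of index `0` is zero. -/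
theorem exists_noiseMaps (φ : HilbertBasis ℕ ℂ (L2 O)) (hW : ∀ j, IsBrownianReal (W j) P)
    (hτ : 0 < τ) : ∃ J : ℕ → L2 O →L[ℂ] Lp (L2 O) 2 P, ∀ k f, ∀ᵐ ω ∂P, ∀ j,
      inner ℂ (φ j) (J k f ω) = (diffQuot τ (fun t => W j t ω) k : ℂ) * inner ℂ (φ j) f := by
  have h : ∀ k, ∃ J : L2 O →L[ℂ] Lp (L2 O) 2 P, ∀ f, ∀ᵐ ω ∂P, ∀ j,
      inner ℂ (φ j) (J f ω) = (diffQuot τ (fun t => W j t ω) k : ℂ) * inner ℂ (φ j) f := by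
    intro k
    rcases Nat.eq_zero_or_pos k with rfl | hk
    · refine ⟨0, fun f => ?_⟩
      filter_upwards [Lp.coeFn_zero (L2 O) 2 P] with ω hω j
      rw [zero_apply, hω, Pi.zero_apply, inner_zero_right, diffQuot_zero τ hτ,
        Complex.ofReal_zero, zero_mul]
    · exact exists_noiseMap φ (ξ := fun j ω => diffQuot τ (fun t => W j t ω) k)
        (inv_pos.2 (Real.sqrt_pos.2 hτ)) (fun j => memLp_diffQuot (hW j) hτ hk)
        fun j => integral_diffQuot_sq (hW j) hτ hk
  choose J hJ using h
  exact ⟨J, hJ⟩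

/-- If the Taylor coefficients of the symbols are, for each order `m`, the coordinates of a vector
`g m`, then the convolution of the noise operators with `g` is a solution. -/
theorem exists_isCQSolution (hφ : IsDirichletEigenbasis O φ lam)
    (hW : ∀ j, IsBrownianReal (W j) P) (hτ : 0 < τ) (hα : 0 < α) {g : ℕ → L2 O}
    (hg : ∀ m j, inner ℂ (φ j) (g m) = taylorCoeff (cqSymbol α τ (lam j)) m) :
    ∃ u : ℕ → Ω → L2 O, IsCQSolution P O φ W α τ N u := by
  obtain ⟨J, hJ⟩ := exists_noiseMaps φ hW hτ
  let U : ℕ → Lp (L2 O) 2 P := fun n => ∑ k ∈ Finset.range (n + 1), J k (g (n - k))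
  have hU : ∀ n, ∀ᵐ ω ∂P, ∀ j, inner ℂ (φ j) (U n ω) = ∑ k ∈ Finset.range (n + 1),
      taylorCoeff (cqSymbol α τ (lam j)) (n - k) * (diffQuot τ (fun t => W j t ω) k : ℂ) := by
    intro n
    have h1 : ∀ᵐ ω ∂P, ∀ k, ∀ j, inner ℂ (φ j) (J k (g (n - k)) ω) =
        (diffQuot τ (fun t => W j t ω) k : ℂ) * inner ℂ (φ j) (g (n - k)) :=
      ae_all_iff.2 fun k => hJ k _
    filter_upwards [h1, Lp.coeFn_finsetSum (Finset.range (n + 1)) fun k => J k (g (n - k))]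
      with ω hω hs j
    rw [hs, Finset.sum_apply, inner_sum]
    refine Finset.sum_congr rfl fun k _ => ?_
    rw [hω, hg, mul_comm]
  refine ⟨fun n => U n, (isCQSolution_iff hφ hW hτ (fun n _ => Lp.memLp _) ?_).2 ?_⟩
  · filter_upwards [hU 0] with ω hω
    refine hilbertBasis_ext φ fun j => ?_
    rw [hω, Finset.sum_range_one, diffQuot_zero τ hτ]
    simp
  · intro n _ _
    filter_upwards [ae_all_iff.2 hU] with ω hω j
    simp only [hω]
    exact conv_conv_eq (sum_schemeCoeff_mul_taylorCoeff hτ hα (hφ.nonneg j)) _ n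

/-- The representation of a solution at time `t_n`, with the kernel given by a vector `e t` whose
coordinates are the diagonal entries of `E_τ(t)`. -/
theorem IsCQSolution.representation (hφ : IsDirichletEigenbasis O φ lam)
    (hW : ∀ j, IsBrownianReal (W j) P) (hτ : 0 < τ) (hα : 0 < α) {u : ℕ → Ω → L2 O}
    (hu : IsCQSolution P O φ W α τ N u) {e : ℝ → L2 O} (he : Continuous e) {n : ℕ} (hn : n ≤ N)
    (hcoef : ∀ k ≤ n, ∀ j, inner ℂ (φ j) (∫ s in (((k : ℝ) - 1) * τ)..(k * τ), e (n * τ - s)) =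
      taylorCoeff (cqSymbol α τ (lam j)) (n - k)) :
    (∃ Y : ℝ → Lp (L2 O) 2 P,
      (∀ s, HasSumL2 P (fun j ω => ((pwDiffQuot τ N (fun t => W j t ω) s : ℝ) : ℂ) •
        (inner ℂ (φ j) (e (n * τ - s)) • φ j)) (Y s)) ∧
      IntervalIntegrable Y volume 0 (n * τ) ∧
      u n =ᵐ[P] (∫ s in (0 : ℝ)..(n * τ), Y s : Lp (L2 O) 2 P)) ∧
    (∀ j ω, IntervalIntegrable (fun s => ((pwDiffQuot τ N (fun t => W j t ω) s : ℝ) : ℂ) •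
      (inner ℂ (φ j) (e (n * τ - s)) • φ j)) volume 0 (n * τ)) ∧
    HasSumL2 P (fun j ω => ∫ s in (0 : ℝ)..(n * τ),
      ((pwDiffQuot τ N (fun t => W j t ω) s : ℝ) : ℂ) •
        (inner ℂ (φ j) (e (n * τ - s)) • φ j)) (u n) := by
  obtain ⟨J, hJ⟩ := exists_noiseMaps φ hW hτ
  have hen : Continuous fun s : ℝ => e (n * τ - s) := by fun_prop
  have hJc : ∀ k, Continuous fun s : ℝ => J k (e (n * τ - s)) := fun k => (J k).continuous.comp hen
  have hcc : ∀ j (c : ℂ), Continuous fun s : ℝ => c • (inner ℂ (φ j) (e (n * τ - s)) • φ j) :=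
    fun j c => by fun_prop
  -- The coordinates of the solution, with the vanishing increment of index `0` dropped.
  have hcoord : ∀ᵐ ω ∂P, ∀ j, inner ℂ (φ j) (u n ω) = ∑ k ∈ Finset.range n,
      (diffQuot τ (fun t => W j t ω) (k + 1) : ℂ) *
        taylorCoeff (cqSymbol α τ (lam j)) (n - (k + 1)) := by
    filter_upwards [inner_solution hφ hW hτ hα hu] with ω hω j
    rw [hω j n hn, Finset.sum_range_succ', diffQuot_zero τ hτ, Complex.ofReal_zero, mul_zero,
      add_zero]
    exact Finset.sum_congr rfl fun k _ => mul_comm _ _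
  have hcoef' : ∀ k ∈ Finset.range n, ∀ j, inner ℂ (φ j)
      (∫ s in (((k + 1 : ℕ) : ℝ) - 1) * τ..((k + 1 : ℕ) : ℝ) * τ, e (n * τ - s)) =
        taylorCoeff (cqSymbol α τ (lam j)) (n - (k + 1)) := fun k hk j =>
    hcoef (k + 1) (Finset.mem_range.1 hk) j
  refine ⟨⟨gridGlue τ N fun k s => J k (e (n * τ - s)), fun s => ?_,
    intervalIntegrable_gridGlue hτ hJc hn, ?_⟩, fun j ω => ?_, ?_⟩
  · have hY : ∀ᵐ ω ∂P, ∀ j, inner ℂ (φ j) (gridGlue τ N (fun k s => J k (e (n * τ - s))) s ω) =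
        (pwDiffQuot τ N (fun t => W j t ω) s : ℂ) * inner ℂ (φ j) (e (n * τ - s)) := by
      by_cases h : ∃ k ∈ Finset.Icc 1 N, s ∈ Set.Ioc (((k : ℝ) - 1) * τ) ((k : ℝ) * τ)
      · obtain ⟨k, hk, hs⟩ := h
        simp only [pwDiffQuot_eq_gridGlue, gridGlue_of_mem hτ hk hs]
        exact hJ k _
      · push Not at h
        simp only [pwDiffQuot_eq_gridGlue, gridGlue_of_forall_notMem h]
        filter_upwards [Lp.coeFn_zero (L2 O) 2 P] with ω hω j
        rw [hω, Pi.zero_apply, inner_zero_right, Complex.ofReal_zero, zero_mul]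
    refine (hasSumL2_expansion φ (Lp.memLp _)).congr_ae (fun j => ?_) ae_eq_rfl
    filter_upwards [hY] with ω hω
    rw [hω, smul_smul]
  · rw [integral_gridGlue hτ hJc hn]
    have hint : ∀ k, ∫ s in (((k + 1 : ℕ) : ℝ) - 1) * τ..((k + 1 : ℕ) : ℝ) * τ,
        J (k + 1) (e (n * τ - s)) =
      J (k + 1) (∫ s in (((k + 1 : ℕ) : ℝ) - 1) * τ..((k + 1 : ℕ) : ℝ) * τ, e (n * τ - s)) :=
      fun k => (J (k + 1)).intervalIntegral_comp_comm (hen.intervalIntegrable _ _)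
    simp only [hint]
    have hJa := ae_all_iff.2 fun k => hJ (k + 1)
      (∫ s in (((k + 1 : ℕ) : ℝ) - 1) * τ..((k + 1 : ℕ) : ℝ) * τ, e (n * τ - s))
    filter_upwards [hcoord, hJa, Lp.coeFn_finsetSum (Finset.range n) fun k => J (k + 1)
      (∫ s in (((k + 1 : ℕ) : ℝ) - 1) * τ..((k + 1 : ℕ) : ℝ) * τ, e (n * τ - s))] with ω h1 h2 h3
    refine hilbertBasis_ext φ fun j => ?_
    rw [h1, h3, Finset.sum_apply, inner_sum]
    refine Finset.sum_congr rfl fun k hk => ?_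
    rw [h2, hcoef' k hk]
  · simp only [pwDiffQuot_eq_gridGlue, ofReal_gridGlue_smul hτ (fun k =>
      diffQuot τ (fun t => W j t ω) k) (fun s => inner ℂ (φ j) (e (n * τ - s)) • φ j)]
    exact intervalIntegrable_gridGlue hτ (fun k => hcc j _) hn
  · refine (hasSumL2_expansion φ (hu.memLp n hn)).congr_ae (fun j => ?_) ae_eq_rfl
    filter_upwards [hcoord] with ω hω
    simp only [pwDiffQuot_eq_gridGlue, ofReal_gridGlue_smul hτ (fun k =>
      diffQuot τ (fun t => W j t ω) k) (fun s => inner ℂ (φ j) (e (n * τ - s)) • φ j)]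
    rw [integral_gridGlue hτ (fun k => hcc j _) hn, hω, Finset.sum_smul]
    refine Finset.sum_congr rfl fun k hk => ?_
    have hL := ((ContinuousLinearMap.toSpanSingleton ℂ (φ j)).comp
      (innerSL ℂ (φ j))).intervalIntegral_comp_comm (μ := volume)
        (hen.intervalIntegrable ((((k + 1 : ℕ) : ℝ) - 1) * τ) (((k + 1 : ℕ) : ℝ) * τ))
    simp only [ContinuousLinearMap.comp_apply, innerSL_apply_apply,
      ContinuousLinearMap.toSpanSingleton_apply] at hL
    rw [intervalIntegral.integral_smul, hL, hcoef' k hk, smul_smul]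

end Scheme

end FracCQ

end

theorem proposition3p4
    {d : ℕ} (hd1 : 1 ≤ d) (hd3 : d ≤ 3)
    (O : TopologicalSpace.Opens (EuclideanSpace ℝ (Fin d)))
    (hO : Bornology.IsBounded (O : Set (EuclideanSpace ℝ (Fin d))))
    (φ : HilbertBasis ℕ ℂ (FracCQ.L2 O)) (lam : ℕ → ℝ)
    (hφ : FracCQ.IsDirichletEigenbasis O φ lam)
    {Ω : Type*} [MeasurableSpace Ω] (P : Measure Ω) [IsProbabilityMeasure P]
    (W : ℕ → ℝ≥0 → Ω → ℝ)
    (hW : ∀ j, IsBrownianReal (W j) P)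
    (hindep : iIndepFun (fun j ω t => W j t ω) P)
    (α : ℝ) (hα0 : 0 < α) (hα2 : α < 2 / d)
    (T : ℝ) (hT : 0 < T) (N : ℕ) (hN : 1 ≤ N) (τ : ℝ) (hτ : τ = T / N) :
    (∃ u : ℕ → Ω → FracCQ.L2 O, FracCQ.IsCQSolution P O φ W α τ N u) ∧
    ∀ θ κ : ℝ, Real.pi / 2 < θ → θ < FracCQ.arccot (-2 / Real.pi) → α * θ < Real.pi →
      0 < κ → κ ≤ 1 / T →
      (∀ z ∈ FracCQ.truncContour θ κ τ,
        FracCQ.IsDirichletResolvent O (FracCQ.deltaTau τ (Complex.exp (-(z * τ))) ^ (α : ℂ))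
          (FracCQ.dirichletResolvent O
            (FracCQ.deltaTau τ (Complex.exp (-(z * τ))) ^ (α : ℂ)))) ∧
      (∀ (t : ℝ) (f : FracCQ.L2 O),
        FracCQ.ContourIntegrable θ κ τ (FracCQ.kernelIntegrand O α τ t f)) ∧
      ∀ u : ℕ → Ω → FracCQ.L2 O, FracCQ.IsCQSolution P O φ W α τ N u →
        ∀ n : ℕ, 1 ≤ n → n ≤ N →
          (∃ Y : ℝ → Lp (FracCQ.L2 O) 2 P,
            (∀ s ∈ Set.Icc 0 (n * τ), FracCQ.HasSumL2 P
              (fun j ω => ((FracCQ.pwDiffQuot τ N (fun t => W j t ω) s : ℝ) : ℂ) •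
                FracCQ.Etau O α θ κ τ (n * τ - s) (φ j))
              (Y s)) ∧
            IntervalIntegrable Y volume 0 (n * τ) ∧
            u n =ᵐ[P] (∫ s in (0 : ℝ)..(n * τ), Y s : Lp (FracCQ.L2 O) 2 P)) ∧
          (∀ j ω, IntervalIntegrable
            (fun s => ((FracCQ.pwDiffQuot τ N (fun t => W j t ω) s : ℝ) : ℂ) •
              FracCQ.Etau O α θ κ τ (n * τ - s) (φ j)) volume 0 (n * τ)) ∧
          FracCQ.HasSumL2 P
            (fun j ω => ∫ s in (0 : ℝ)..(n * τ),
              ((FracCQ.pwDiffQuot τ N (fun t => W j t ω) s : ℝ) : ℂ) •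
                FracCQ.Etau O α θ κ τ (n * τ - s) (φ j))
            (u n) := by
  have hpi := Real.pi_gt_three
  have : IsFiniteMeasure
      ((volume : Measure (EuclideanSpace ℝ (Fin d))).restrict (O : Set (EuclideanSpace ℝ (Fin d)))) :=
    ⟨by rw [Measure.restrict_apply_univ]; exact hO.measure_lt_top⟩
  have hsum := hφ.summable_inv_sq hd3
  have hN' : (1 : ℝ) ≤ N := by exact_mod_cast hN
  have hτ0 : 0 < τ := by rw [hτ]; positivity
  have hτT : τ ≤ T := by rw [hτ]; exact div_le_self hT.le hN'
  have hκτ : ∀ κ, κ ≤ 1 / T → κ ≤ Real.pi / τ := fun κ hκ =>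
    hκ.trans (div_le_div₀ (by linarith) (by linarith) hτ0 hτT)
  have hα : α < 2 := by
    refine hα2.trans_le (div_le_self zero_le_two ?_)
    exact_mod_cast hd1
  refine ⟨?_, fun θ κ hθ hθ' hαθ hκ hκT => ?_⟩
  · -- Any admissible contour provides a kernel; the angle lies between `π/2` and `min (3π/4) (π/α)`.
    obtain ⟨θ, hθ, hθ'⟩ := exists_between (show Real.pi / 2 < min (3 * Real.pi / 4) (Real.pi / α) from
      lt_min (by linarith) (div_lt_div_of_pos_left Real.pi_pos hα0 hα))
    have h34 := hθ'.trans_le (min_le_left _ _)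
    have hαθ : α * θ < Real.pi := by
      have := (lt_div_iff₀ hα0).1 (hθ'.trans_le (min_le_right _ _))
      linarith
    have hadm : FracCQ.ContourAdmissible θ (1 / T) τ :=
      ⟨hτ0, hθ, by linarith, by positivity, hκτ _ le_rfl⟩
    obtain ⟨e, -, -, he⟩ := hadm.exists_kernelVector h34 hα0 hαθ hφ hsum
    exact FracCQ.exists_isCQSolution hφ hW hτ0 hα0 fun m j => he m 0 (Nat.zero_le m) j
  · have h34 := FracCQ.lt_of_lt_arccot hθ'
    have hadm : FracCQ.ContourAdmissible θ κ τ := ⟨hτ0, hθ, by linarith, hκ, hκτ _ hκT⟩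
    refine ⟨fun z hz => hφ.isDirichletResolvent (hadm.deltaTau_exp_mem h34 hα0 hαθ hz).2,
      fun t f => hadm.contourIntegrable (hadm.continuousOn_kernelIntegrand h34 hα0 hαθ hφ t f),
      fun u hu n _ hn => ?_⟩
    obtain ⟨e, hec, hE, he⟩ := hadm.exists_kernelVector h34 hα0 hαθ hφ hsum
    obtain ⟨⟨Y, hY, hYi, hYu⟩, h2, h3⟩ :=
      hu.representation hφ hW hτ0 hα0 hec hn fun k hk j => he n k hk j
    simp only [hE]
    exact ⟨⟨Y, fun s _ => hY s, hYi, hYu⟩, h2, h3⟩
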